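/- Let $\hat{\mathcal U}$ be the enveloping algebra of affine $\mathfrak{sl}_2$ (type $A_1^{(1)}$), i.e. the associative unital $\mathbb Q$-algebra generated by $x_r^+,x_r^-,h_r$ ($r\in\mathbb Z$) and $c$ with relations: $c$ is central, $$[h_r,h_s]=2r\,\delta_{r+s,0}\,c,\quad [h_r,x_s^{\pm}]=\pm 2x_{r+s}^{\pm},\quad [x_r^{+},x_s^{+}]=0=[x_r^{-},x_s^{-}],\quad [x_r^+,x_s^-]=h_{r+s}+r\,\delta_{r+s,0}\,c .$$ For an element $a$ of a $\mathbb Q$-algebra and $k\in\mathbb N=\{0,1,2,\dots\}$ put $a^{(k)}=a^k/k!$ and $\binom ak=a(a-1)\cdots(a-k+1)/k!$, and define $\hat h_{\pm k}\in\hat{\mathcal U}$ ($k\ge 0$) by $$\sum_{k\ge 0}\hat h_{\pm k}u^k=\exp\Big(\sum_{r\ge1}(-1)^{r-1}\frac{h_{\pm r}}{r}u^r\Big)\in\hat{\mathcal U}[[u]].$$ Consider the following $\mathbb Z$-subalgebras of $\hat{\mathcal U}$: - $\hat{\mathcal U}_{\mathbb Z}$, generated by $\{(x_r^{+})^{(k)},(x_r^{-})^{(k)}\mid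 r\in\mathbb Z,\ k\in\mathbb N\}$; - $\hat{\mathcal U}_{\mathbb Z}^{\pm}=\mathbb Z^{(div)}[x_r^{\pm}\mid r\in\mathbb Z]$, generated by the divided powers $a^{(k)}$, $k\in\mathbb N$, of all $a$ in the $\mathbb Z$-span of the $x_r^{\pm}$, $r\in\mathbb Z$; - $\hat{\mathcal U}_{\mathbb Z}^{0,0}=\mathbb Z^{(bin)}[h_0,c]$, generated by the binomials $\binom ak$, $k\in\mathbb N$, of all $a\in\mathbb Zh_0+\mathbb Zc$; - $\hat{\mathcal U}_{\mathbb Z}^{0,\pm}=\mathbb Z[\hat h_{\pm k}\mid k>0]$, generated by the $\hat h_{\pm k}$, $k>0$; - $\hat{\mathcal U}_{\mathbb Z}^{0}$, generated by $\hat{\mathcal U}_{\mathbb Z}^{0,-}$, $\hat{\mathcal U}_{\mathbb Z}^{0,0}$ and $\hat{\mathcal U}_{\mathbb Z}^{0,+}$. Theorem. $\hat{\mathcal U}_{\mathbb Z}$ is an integral form of $\hat{\mathcal U}$: it is a free $\mathbb Z$-module and the natural map $\mathbb Q\otimes_{\mathbb Z}\hat{\mathcal U}_{\mathbb Z}\to\hat{\mathcal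 U}$ is an isomorphism. More precisely, multiplication in $\hat{\mathcal U}$ induces isomorphisms of $\mathbb Z$-modules $$\hat{\mathcal U}_{\mathbb Z}\cong\hat{\mathcal U}_{\mathbb Z}^-\otimes_{\mathbb Z}\hat{\mathcal U}_{\mathbb Z}^0\otimes_{\mathbb Z}\hat{\mathcal U}_{\mathbb Z}^+\cong\hat{\mathcal U}_{\mathbb Z}^-\otimes_{\mathbb Z}\hat{\mathcal U}_{\mathbb Z}^{0,-}\otimes_{\mathbb Z}\hat{\mathcal U}_{\mathbb Z}^{0,0}\otimes_{\mathbb Z}\hat{\mathcal U}_{\mathbb Z}^{0,+}\otimes_{\mathbb Z}\hat{\mathcal U}_{\mathbb Z}^+,$$ and a $\mathbb Z$-basis of $\hat{\mathcal U}_{\mathbb Z}$ is given by the products $B^-B^{0,-}B^{0,0}B^{0,+}B^+$, where $$B^{\pm}=\Big\{\prod_{r\in\mathbb Z}(x_r^{\pm})^{(k_r)}\ \Big|\ \mathbf k:\mathbb Z\to\mathbb N\text{ finitely supported}\Big\},\qquad B^{0,\pm}=\Big\{\prod_{l>0}\hat h_{\pm l}^{\,k_l}\ \Big|\ \mathbf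 k:\mathbb Z_{>0}\to\mathbb N\text{ finitely supported}\Big\},$$ $$B^{0,0}=\Big\{\tbinom{h_0}{k}\tbinom{c}{\tilde k}\ \Big|\ k,\tilde k\in\mathbb N\Big\}$$ are $\mathbb Z$-bases of $\hat{\mathcal U}_{\mathbb Z}^{\pm}$, $\hat{\mathcal U}_{\mathbb Z}^{0,\pm}$ and $\hat{\mathcal U}_{\mathbb Z}^{0,0}$ respectively (distinct exponents giving distinct basis elements). In particular $\hat{\mathcal U}_{\mathbb Z}^{0,+}$ and $\hat{\mathcal U}_{\mathbb Z}^{0,-}$ are the algebras of polynomials over $\mathbb Z$ in the $\hat h_k$, respectively the $\hat h_{-k}$, $k>0$. -/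

import Mathlib

open scoped TensorProduct

namespace AffineSl2

section General

variable {A : Type*} [Ring A] [Algebra ℚ A]

/-- The divided power `a ^ k / k!` of an element of a `ℚ`-algebra. -/
noncomputable def divPow (a : A) (k : ℕ) : A :=
  ((k.factorial : ℚ)⁻¹) • a ^ k

/-- The binomial `a (a - 1) ⋯ (a - k + 1) / k!` of an element of a `ℚ`-algebra. -/
noncomputable def binom (a : A) (k : ℕ) : A :=
  ((k.factorial : ℚ)⁻¹) • Polynomial.aeval a (descPochhammer ℚ k)

/-- The exponential `∑ₘ f ^ m / m!` of a power series `f` with zero constant term.  For such `f`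
only the terms with `m ≤ n` contribute to the coefficient of `u ^ n`. -/
noncomputable def expSeries (f : PowerSeries A) : PowerSeries A :=
  PowerSeries.mk fun n =>
    ∑ m ∈ Finset.range (n + 1), ((m.factorial : ℚ)⁻¹) • PowerSeries.coeff n (f ^ m)

/-- `ℤ^(div)[v i | i]`: the `ℤ`-subalgebra generated by the divided powers of all the elements of
the `ℤ`-module spanned by the (pairwise commuting) `v i`. -/
noncomputable def divSubalgebra {ι : Type*} (v : ι → A) : Subalgebra ℤ A :=
  Algebra.adjoin ℤ {y | ∃ a ∈ Submodule.span ℤ (Set.range v), ∃ k : ℕ, y = divPow a k}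

/-- `ℤ^(bin)[v i | i]`: the `ℤ`-subalgebra generated by the binomials of all the elements of
the `ℤ`-module spanned by the (pairwise commuting) `v i`. -/
noncomputable def binSubalgebra {ι : Type*} (v : ι → A) : Subalgebra ℤ A :=
  Algebra.adjoin ℤ {y | ∃ a ∈ Submodule.span ℤ (Set.range v), ∃ k : ℕ, y = binom a k}

/-- A `ℤ`-subalgebra `S` of a `ℚ`-algebra `A` is an integral form of `A` if it is a free
`ℤ`-module and `ℚ ⊗ S → A`, `q ⊗ s ↦ q s`, is an isomorphism. -/
def IsIntegralForm (S : Subalgebra ℤ A) : Prop :=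
  Module.Free ℤ S ∧ IsBaseChange ℚ (S.val.toLinearMap : S →ₗ[ℤ] A)

/-- The product, over the finite support of `k`, of the `g i (k i)`, taken in increasing order
of `i`.  (It is used only where the factors commute with each other.) -/
def orderedProd {ι M : Type*} [LinearOrder ι] [Monoid M] (g : ι → ℕ → M) (k : ι →₀ ℕ) : M :=
  ((k.support.sort (· ≤ ·)).map fun i => g i (k i)).prod

end General

/-- The generators `x_r^+`, `x_r^-`, `h_r` (`r ∈ ℤ`) and `c`. -/
inductive Gen : Type
  | xPlus (r : ℤ)
  | xMinus (r : ℤ)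
  | h (r : ℤ)
  | c

/-- The defining relations of the enveloping algebra of affine `sl₂`; each one identifies a
commutator of generators (here `⁅a, b⁆ = a * b - b * a`) with its value. -/
inductive Rel : FreeAlgebra ℚ Gen → FreeAlgebra ℚ Gen → Prop
  | c_central (g : Gen) : Rel ⁅FreeAlgebra.ι ℚ Gen.c, FreeAlgebra.ι ℚ g⁆ 0
  | h_h (r s : ℤ) : Rel ⁅FreeAlgebra.ι ℚ (Gen.h r), FreeAlgebra.ι ℚ (Gen.h s)⁆
      (if r + s = 0 then (2 * (r : ℚ)) • FreeAlgebra.ι ℚ Gen.c else 0)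
  | h_xPlus (r s : ℤ) : Rel ⁅FreeAlgebra.ι ℚ (Gen.h r), FreeAlgebra.ι ℚ (Gen.xPlus s)⁆
      ((2 : ℚ) • FreeAlgebra.ι ℚ (Gen.xPlus (r + s)))
  | h_xMinus (r s : ℤ) : Rel ⁅FreeAlgebra.ι ℚ (Gen.h r), FreeAlgebra.ι ℚ (Gen.xMinus s)⁆
      ((-2 : ℚ) • FreeAlgebra.ι ℚ (Gen.xMinus (r + s)))
  | xPlus_xPlus (r s : ℤ) :
      Rel ⁅FreeAlgebra.ι ℚ (Gen.xPlus r), FreeAlgebra.ι ℚ (Gen.xPlus s)⁆ 0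
  | xMinus_xMinus (r s : ℤ) :
      Rel ⁅FreeAlgebra.ι ℚ (Gen.xMinus r), FreeAlgebra.ι ℚ (Gen.xMinus s)⁆ 0
  | xPlus_xMinus (r s : ℤ) :
      Rel ⁅FreeAlgebra.ι ℚ (Gen.xPlus r), FreeAlgebra.ι ℚ (Gen.xMinus s)⁆
        (FreeAlgebra.ι ℚ (Gen.h (r + s)) +
          (if r + s = 0 then (r : ℚ) • FreeAlgebra.ι ℚ Gen.c else 0))

/-- The enveloping algebra `Û` of affine `sl₂`: the associative unital `ℚ`-algebra with the
above generators and relations. -/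
def U : Type := RingQuot Rel

noncomputable instance : Ring U := inferInstanceAs (Ring (RingQuot Rel))

noncomputable instance : Algebra ℚ U := inferInstanceAs (Algebra ℚ (RingQuot Rel))

/-- The quotient map onto `Û`. -/
noncomputable def mk : FreeAlgebra ℚ Gen →ₐ[ℚ] U := RingQuot.mkAlgHom ℚ Rel

/-- The class in `Û` of a generator. -/
noncomputable def gen (g : Gen) : U := mk (FreeAlgebra.ι ℚ g)

/-- `x_r^+` -/
noncomputable def xPlus (r : ℤ) : U := gen (Gen.xPlus r)

/-- `x_r^-` -/
noncomputable def xMinus (r : ℤ) : U := gen (Gen.xMinus r)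

/-- `h_r` -/
noncomputable def h (r : ℤ) : U := gen (Gen.h r)

/-- `c` -/
noncomputable def c : U := gen Gen.c

/-- `h_±(u) = ∑_{r ≥ 1} (-1)^(r-1) (h_{± r} / r) u^r`, where `ε = ± 1` is the sign. -/
noncomputable def hSeries (ε : ℤˣ) : PowerSeries U :=
  PowerSeries.mk fun r => if r = 0 then 0 else ((-1 : ℚ) ^ (r - 1) / (r : ℚ)) • h ((ε : ℤ) * r)

/-- `ĥ_{ε k}` (`ε = ± 1`, `k ≥ 0`), the coefficient of `u^k` in `exp (h_ε(u))`. -/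
noncomputable def hHat (ε : ℤˣ) (k : ℕ) : U := PowerSeries.coeff k (expSeries (hSeries ε))

/-- `Û_ℤ`, generated by the divided powers of all the `x_r^+` and `x_r^-`. -/
noncomputable def UZ : Subalgebra ℤ U :=
  Algebra.adjoin ℤ {y | ∃ (r : ℤ) (k : ℕ), y = divPow (xPlus r) k ∨ y = divPow (xMinus r) k}

/-- `Û_ℤ^+ = ℤ^(div)[x_r^+ | r ∈ ℤ]` -/
noncomputable def UZPlus : Subalgebra ℤ U := divSubalgebra xPlus

/-- `Û_ℤ^- = ℤ^(div)[x_r^- | r ∈ ℤ]` -/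
noncomputable def UZMinus : Subalgebra ℤ U := divSubalgebra xMinus

/-- `Û_ℤ^{0,0} = ℤ^(bin)[h_0, c]` -/
noncomputable def UZZeroZero : Subalgebra ℤ U := binSubalgebra ![h 0, c]

/-- `Û_ℤ^{0,ε} = ℤ[ĥ_{ε k} | k > 0]`, `ε = ± 1` -/
noncomputable def UZZeroSign (ε : ℤˣ) : Subalgebra ℤ U :=
  Algebra.adjoin ℤ (Set.range fun k : ℕ+ => hHat ε k)

/-- `Û_ℤ^0`, generated by `Û_ℤ^{0,-}`, `Û_ℤ^{0,0}` and `Û_ℤ^{0,+}`. -/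
noncomputable def UZZero : Subalgebra ℤ U := UZZeroSign (-1) ⊔ UZZeroZero ⊔ UZZeroSign 1

/-- The elements `∏_r (x_r^+)^(k_r)` of `B^+`. -/
noncomputable def basisPlus (k : ℤ →₀ ℕ) : U := orderedProd (fun r n => divPow (xPlus r) n) k

/-- The elements `∏_r (x_r^-)^(k_r)` of `B^-`. -/
noncomputable def basisMinus (k : ℤ →₀ ℕ) : U := orderedProd (fun r n => divPow (xMinus r) n) k

/-- The elements `∏_{l > 0} ĥ_{ε l}^{k_l}` of `B^{0,ε}`. -/
noncomputable def basisZeroSign (ε : ℤˣ) (k : ℕ+ →₀ ℕ) : U :=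
  orderedProd (fun (l : ℕ+) n => hHat ε l ^ n) k

/-- The elements `(h_0 choose k) (c choose l)` of `B^{0,0}`. -/
noncomputable def basisZeroZero (p : ℕ × ℕ) : U := binom (h 0) p.1 * binom c p.2

end AffineSl2

open AffineSl2

namespace AffineSl2

/-! ### Power series with noncommuting coefficients, linear differential equations, Newton's
recursion. -/

section PowerSeriesCalculus

open PowerSeries Finset

variable {A : Type*} [Ring A] [Algebra ℚ A]

/-! The proof has two halves: the ordered products `pbw` span `UZ` over ℤ, and they are linearly
independent over ℚ.

Spanning. For fixed r and s the elements x⁺_{r+(r+s)i}, x⁻_{s+(r+s)i} and h_{(r+s)(i+1)} (corrected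
by r c when r + s = 0) satisfy the relations of one and the same loop algebra of sl₂ (`loopTriple`).
Hence a single straightening formula, `LoopTriple.divPow_mul_divPow`, covers all r and s: (x_r⁺)^(k)
(x_s⁻)^(l) is the sum over n of the coefficient of wⁿ in X⁻(w)^(l-n) E(w) X⁺(w)^(k-n). Here X⁺ and
X⁻ are alternating generating series and E solves E' = H E with E(0) = 1. The coefficients of E are
the ĥ_{±k} when r + s = ±1 and binomials of h₀ + r c when r + s = 0. When |r + s| = N > 1 they come
from the ĥ's by the plethysm p_i ↦ p_{Ni} of symmetric functions; since e_k(x₁^N, x₂^N, …) is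
symmetric with integer coefficients, it is an integral polynomial in the e_j, so nothing outside the
lattice appears (`newtonE_plethysm_mem`). The other factors are exchanged by simpler identities,
notably E₊(u) E₋(v) = E₋(v) (1 - uv)^{-2c} E₊(u). Together they show that U⁻ U⁰ U⁺ is stable under
left multiplication by the generators of `UZ`, so it contains `UZ`. Conversely, straightening with k
= l, solved for its last term, puts U⁰ inside `UZ`.

Independence. This is a Poincaré–Birkhoff–Witt argument made explicit. The Borel subalgebra spanned
by the h_r, x_r⁺ and c acts from the right on a polynomial ring, as it would on its own enveloping
algebra in ordered coordinates (`polyRep`). Inducing this action gives a module over the whole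
algebra (`BorelRep.induced`). Applied to 1 ⊗ 1 and evaluated at 1, an element of `pbw` becomes a
pure tensor of polynomials in disjoint sets of variables: divided-power monomials, monomials in
Newton polynomials, and binomials. Each of these families is independent, hence so is `pbw`.

The family `pbw` is thus a ℤ-basis of `UZ` and a ℚ-basis of the whole algebra; the integral form and
both tensor decompositions compare bases. -/

theorem coeff_rat_smul (q : ℚ) (f : PowerSeries A) (n : ℕ) : coeff n (q • f) = q • coeff n f :=
  rfl

/-- The formal derivative of power series over a noncommutative `ℚ`-algebra. -/
noncomputable def dSeries : PowerSeries A →ₗ[ℚ] PowerSeries A where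
  toFun f := PowerSeries.mk fun n => ((n : ℚ) + 1) • coeff (n + 1) f
  map_add' f g := by ext n; simp
  map_smul' q f := by
    ext n
    simp only [coeff_mk, coeff_rat_smul, RingHom.id_apply]
    rw [smul_comm]

theorem coeff_dSeries (f : PowerSeries A) (n : ℕ) :
    coeff n (dSeries f) = ((n : ℚ) + 1) • coeff (n + 1) f := by
  simp [dSeries]

theorem dSeries_mul (f g : PowerSeries A) :
    dSeries (f * g) = dSeries f * g + f * dSeries g := by
  ext n
  simp only [coeff_dSeries, map_add, coeff_mul]
  have h1 : ∑ p ∈ antidiagonal (n + 1), (p.1 : ℚ) • (coeff p.1 f * coeff p.2 g) =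
      ∑ p ∈ antidiagonal n, ((p.1 : ℚ) + 1) • coeff (p.1 + 1) f * coeff p.2 g := by
    rw [Finset.Nat.sum_antidiagonal_succ]
    simp
  have h2 : ∑ p ∈ antidiagonal (n + 1), (p.2 : ℚ) • (coeff p.1 f * coeff p.2 g) =
      ∑ p ∈ antidiagonal n, coeff p.1 f * ((p.2 : ℚ) + 1) • coeff (p.2 + 1) g := by
    rw [Finset.Nat.sum_antidiagonal_succ']
    simp
  rw [← h1, ← h2, ← sum_add_distrib, smul_sum]
  refine sum_congr rfl fun p hp => ?_
  rw [← add_smul]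
  congr 1
  have := mem_antidiagonal.1 hp
  exact_mod_cast this.symm

theorem dSeries_C (a : A) : dSeries (C a) = 0 := by
  ext n
  simp [coeff_dSeries]

theorem dSeries_one : dSeries (1 : PowerSeries A) = 0 := by
  simpa using dSeries_C (1 : A)

/-- The power rule needs f to commute with its derivative; for the series used here this holds
because the coefficients commute. -/
theorem dSeries_pow_succ (f : PowerSeries A) (hf : Commute f (dSeries f)) (n : ℕ) :
    dSeries (f ^ (n + 1)) = ((n : ℚ) + 1) • (f ^ n * dSeries f) := by
  induction n with
  | zero => simp
  | succ n ih =>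
    rw [pow_succ, dSeries_mul, ih, smul_mul_assoc, mul_assoc, ← hf.eq, ← mul_assoc, ← pow_succ]
    push_cast
    module

/-- A solution of the linear differential equation `F' = L F` is determined by its constant
coefficient. -/
theorem eq_of_dSeries_eq_mul {L F G : PowerSeries A} (hF : dSeries F = L * F)
    (hG : dSeries G = L * G) (h0 : coeff 0 F = coeff 0 G) : F = G := by
  ext n
  induction n using Nat.strong_induction_on with
  | _ n ih =>
    cases n with
    | zero => exact h0
    | succ n =>
      have h1 := congrArg (coeff n) hF
      have h2 := congrArg (coeff n) hG
      rw [coeff_dSeries, coeff_mul] at h1 h2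
      have h3 : ((n : ℚ) + 1) • coeff (n + 1) F = ((n : ℚ) + 1) • coeff (n + 1) G := by
        rw [h1, h2]
        refine sum_congr rfl fun p hp => ?_
        rw [ih p.2 (by have := mem_antidiagonal.1 hp; omega)]
      exact smul_right_injective A (by positivity : ((n : ℚ) + 1) ≠ 0) h3

/-- A solution of the linear differential equation `F' = F L` is determined by its constant
coefficient. -/
theorem eq_of_dSeries_eq_mul_right {L F G : PowerSeries A} (hF : dSeries F = F * L)
    (hG : dSeries G = G * L) (h0 : coeff 0 F = coeff 0 G) : F = G := by
  ext n
  induction n using Nat.strong_induction_on with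
  | _ n ih =>
    cases n with
    | zero => exact h0
    | succ n =>
      have h1 := congrArg (coeff n) hF
      have h2 := congrArg (coeff n) hG
      rw [coeff_dSeries, coeff_mul] at h1 h2
      have h3 : ((n : ℚ) + 1) • coeff (n + 1) F = ((n : ℚ) + 1) • coeff (n + 1) G := by
        rw [h1, h2]
        refine sum_congr rfl fun p hp => ?_
        rw [ih p.1 (by have := mem_antidiagonal.1 hp; omega)]
      exact smul_right_injective A (by positivity : ((n : ℚ) + 1) ≠ 0) h3

/-- The elementary-type elements attached by Newton's identities to the power sums
`a 0, a 1, …` (where `a i` has weight `i + 1`):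
`(n + 1) Eₙ₊₁ = ∑_{i + j = n} (-1)^i a i Eⱼ`. -/
noncomputable def newtonE (a : ℕ → A) : ℕ → A
  | 0 => 1
  | n + 1 => ((n : ℚ) + 1)⁻¹ • ∑ i : Fin (n + 1), (-1 : ℚ) ^ (i : ℕ) • (a i * newtonE a (n - i))

theorem newtonE_zero (a : ℕ → A) : newtonE a 0 = 1 := by rw [newtonE]

theorem newtonE_succ (a : ℕ → A) (n : ℕ) :
    ((n : ℚ) + 1) • newtonE a (n + 1) =
      ∑ p ∈ antidiagonal n, (-1 : ℚ) ^ p.1 • (a p.1 * newtonE a p.2) := by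
  rw [newtonE, smul_inv_smul₀ (by positivity), Finset.Nat.sum_antidiagonal_eq_sum_range_succ_mk,
    Finset.sum_range]

/-- The series `∑ (-1)^i a i w^i`. -/
noncomputable def altSeries (a : ℕ → A) : PowerSeries A :=
  PowerSeries.mk fun i => (-1 : ℚ) ^ i • a i

/-- The series `∑ (-1)^i (i + 1) a i w^i`. -/
noncomputable def altSeries₂ (a : ℕ → A) : PowerSeries A :=
  PowerSeries.mk fun i => ((-1 : ℚ) ^ i * ((i : ℚ) + 1)) • a i

/-- The generating series of the elements `newtonE a n`. -/
noncomputable def newtonSeries (a : ℕ → A) : PowerSeries A := PowerSeries.mk (newtonE a)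

theorem dSeries_newtonSeries (a : ℕ → A) :
    dSeries (newtonSeries a) = altSeries a * newtonSeries a := by
  ext n
  simp [coeff_dSeries, newtonSeries, altSeries, coeff_mul, newtonE_succ]

theorem eq_newtonSeries {a : ℕ → A} {F : PowerSeries A} (hF : dSeries F = altSeries a * F)
    (h0 : coeff 0 F = 1) : F = newtonSeries a :=
  eq_of_dSeries_eq_mul hF (dSeries_newtonSeries a) (by simp [h0, newtonSeries, newtonE_zero])

/-- The recursion says that the generating series solves F' = `altSeries a` · F, whose solution is
determined by its constant term. Most identities between Newton elements are proved through this
characterization. -/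
theorem newtonE_eq_of_recursion {a e : ℕ → A} (h0 : e 0 = 1)
    (h : ∀ n : ℕ, ((n : ℚ) + 1) • e (n + 1) =
      ∑ p ∈ antidiagonal n, (-1 : ℚ) ^ p.1 • (a p.1 * e p.2)) (n : ℕ) : e n = newtonE a n := by
  have : PowerSeries.mk e = newtonSeries a := by
    apply eq_newtonSeries
    · ext n
      simp [coeff_dSeries, altSeries, coeff_mul, h]
    · simpa using h0
  simpa [newtonSeries] using congrArg (coeff n) this

/-- In other words `altSeries₂ a` is the derivative of w · `altSeries a`; this is the form in which
it enters the straightening recursion. -/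
theorem altSeries₂_eq (a : ℕ → A) :
    altSeries₂ a = altSeries a + X * dSeries (altSeries a) := by
  ext n
  cases n with
  | zero => simp [altSeries₂, altSeries]
  | succ n =>
    simp only [altSeries₂, altSeries, coeff_mk, map_add, coeff_succ_X_mul, coeff_dSeries]
    push_cast
    module

theorem commute_of_coeff {B : Type*} [Ring B] {f g : PowerSeries B} (h : ∀ i j, Commute (coeff i f) (coeff j g)) :
    Commute f g := by
  ext n
  rw [coeff_mul, coeff_mul, ← Finset.Nat.sum_antidiagonal_swap]
  exact sum_congr rfl fun p _ => (h p.2 p.1).eq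

theorem commute_smul_both {a b : A} (h : Commute a b) (p q : ℚ) : Commute (p • a) (q • b) :=
  (h.smul_left p).smul_right q

theorem commute_newtonE {a : ℕ → A} {b : A} (h : ∀ i, Commute (a i) b) (n : ℕ) :
    Commute (newtonE a n) b := by
  induction n using Nat.strong_induction_on with
  | _ n ih =>
    cases n with
    | zero => simp [newtonE_zero]
    | succ n =>
      rw [newtonE]
      refine (Commute.sum_left _ _ _ fun i _ => ?_).smul_left _
      exact ((h i).mul_left (ih _ (by omega))).smul_left _

theorem commute_altSeries_newtonSeries {a : ℕ → A} (h : ∀ i j, Commute (a i) (a j)) :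
    Commute (altSeries a) (newtonSeries a) :=
  commute_of_coeff fun i j => by
    simp only [altSeries, newtonSeries, coeff_mk]
    exact (commute_newtonE (fun k => h k i) j).symm.smul_left _

theorem map_newtonE {B : Type*} [Ring B] [Algebra ℚ B] (φ : A →ₐ[ℚ] B) (a : ℕ → A) (n : ℕ) :
    φ (newtonE a n) = newtonE (fun i => φ (a i)) n := by
  refine newtonE_eq_of_recursion (e := fun n => φ (newtonE a n)) (by simp [newtonE_zero])
    (fun n => ?_) n
  rw [← map_smul, newtonE_succ, map_sum]
  simp

theorem newtonE_congr {a b : ℕ → A} {N : ℕ} (h : ∀ i < N, a i = b i) :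
    ∀ n ≤ N, newtonE a n = newtonE b n := by
  intro n
  induction n using Nat.strong_induction_on with
  | _ n ih =>
    intro hn
    cases n with
    | zero => simp [newtonE_zero]
    | succ n =>
      rw [newtonE, newtonE]
      congr 1
      refine sum_congr rfl fun i _ => ?_
      rw [h i (by omega), ih _ (by omega) (by omega)]

/-- If `a` and `b` have the same Newton elements up to `N`, they agree below `N`. -/
theorem eq_of_newtonE_eq {a b : ℕ → A} {N : ℕ} (h : ∀ n ≤ N, newtonE a n = newtonE b n) :
    ∀ i < N, a i = b i := by
  intro i
  induction i using Nat.strong_induction_on with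
  | _ i ih =>
    intro hi
    have h1 := newtonE_succ a i
    rw [h _ (by omega), newtonE_succ b i, Finset.Nat.sum_antidiagonal_eq_sum_range_succ_mk,
      Finset.Nat.sum_antidiagonal_eq_sum_range_succ_mk, sum_range_succ, sum_range_succ] at h1
    have h2 : ∑ k ∈ range i, (-1 : ℚ) ^ k • (b k * newtonE b (i - k)) =
        ∑ k ∈ range i, (-1 : ℚ) ^ k • (a k * newtonE a (i - k)) := by
      refine sum_congr rfl fun k hk => ?_
      have := mem_range.1 hk
      rw [ih k this (by omega), h (i - k) (by omega)]
    rw [h2] at h1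
    have h3 := add_left_cancel h1
    simp only [Nat.sub_self, newtonE_zero, mul_one] at h3
    exact (smul_right_injective A (by simp : ((-1 : ℚ) ^ i) ≠ 0) h3).symm

theorem newtonE_mem (S : Subalgebra ℚ A) {a : ℕ → A} (h : ∀ i, a i ∈ S) (n : ℕ) :
    newtonE a n ∈ S := by
  have := map_newtonE S.val (fun i => ⟨a i, h i⟩) n
  simp only [Subalgebra.coe_val] at this
  rw [← this]
  exact Subtype.property _

end PowerSeriesCalculus

/-! ### Divided powers and the straightening formula in the loop algebra of sl₂. -/

section Straightening

open PowerSeries Finset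

variable {A : Type*} [Ring A] [Algebra ℚ A]

theorem divPow_zero (a : A) : divPow a 0 = 1 := by simp [divPow]

theorem divPow_one (a : A) : divPow a 1 = a := by simp [divPow]

theorem mul_divPow (a : A) (k : ℕ) : a * divPow a k = ((k : ℚ) + 1) • divPow a (k + 1) := by
  rw [divPow, divPow, mul_smul_comm, ← pow_succ', smul_smul, Nat.factorial_succ]
  congr 1
  push_cast
  field_simp

theorem commute_divPow_left {a b : A} (h : Commute a b) (k : ℕ) : Commute (divPow a k) b :=
  (h.pow_left k).smul_left _

theorem map_divPow {B : Type*} [Ring B] [Algebra ℚ B] (φ : A →ₐ[ℚ] B) (a : A) (k : ℕ) :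
    φ (divPow a k) = divPow (φ a) k := by simp [divPow]

theorem dSeries_divPow_succ (f : PowerSeries A) (hf : Commute f (dSeries f)) (n : ℕ) :
    dSeries (divPow f (n + 1)) = divPow f n * dSeries f := by
  rw [divPow, divPow, map_smul, dSeries_pow_succ f hf, smul_smul, smul_mul_assoc,
    Nat.factorial_succ]
  congr 1
  push_cast
  field_simp

/-- Divided powers with integer exponents; they vanish for negative exponents. -/
noncomputable def divPowInt (a : A) : ℤ → A
  | Int.ofNat k => divPow a k
  | Int.negSucc _ => 0

theorem divPowInt_natCast (a : A) (k : ℕ) : divPowInt a k = divPow a k := rfl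

theorem divPowInt_zero (a : A) : divPowInt a 0 = 1 := divPow_zero a

theorem divPowInt_of_neg (a : A) {k : ℤ} (h : k < 0) : divPowInt a k = 0 := by
  obtain ⟨n, rfl⟩ := Int.eq_negSucc_of_lt_zero h
  rfl

theorem mul_divPowInt (a : A) (k : ℤ) :
    a * divPowInt a k = ((k : ℚ) + 1) • divPowInt a (k + 1) := by
  rcases lt_or_ge k 0 with hk | hk
  · rw [divPowInt_of_neg a hk]
    rcases lt_or_ge (k + 1) 0 with h | h
    · simp [divPowInt_of_neg a h]
    · have : k = -1 := by omega
      simp [this]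
  · lift k to ℕ using hk
    exact mul_divPow a k

theorem dSeries_divPowInt (f : PowerSeries A) (hf : Commute f (dSeries f)) (k : ℤ) :
    dSeries (divPowInt f k) = divPowInt f (k - 1) * dSeries f := by
  rcases lt_or_ge k 1 with hk | hk
  · rw [divPowInt_of_neg f (by omega : k - 1 < 0)]
    rcases lt_or_ge k 0 with h | h
    · simp [divPowInt_of_neg f h]
    · have : k = 0 := by omega
      simp [this, divPowInt_zero, dSeries_one]
  · obtain ⟨n, rfl⟩ : ∃ n : ℕ, k = n + 1 := ⟨(k - 1).toNat, by omega⟩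
    have := dSeries_divPow_succ f hf n
    rw [add_sub_cancel_right]
    exact this

/-- Sequences of elements satisfying the relations of `x_i^+`, `x_{i+1}^-`, `h_{i+1}`
(`i ≥ 0`) in the loop algebra of `sl₂`. -/
structure LoopTriple (xp xm hh : ℕ → A) : Prop where
  pp : ∀ i j, Commute (xp i) (xp j)
  mm : ∀ i j, Commute (xm i) (xm j)
  hc : ∀ i j, Commute (hh i) (hh j)
  hp : ∀ i j, hh i * xp j - xp j * hh i = (2 : ℚ) • xp (i + j + 1)
  hm : ∀ i j, hh i * xm j - xm j * hh i = (-2 : ℚ) • xm (i + j + 1)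
  pm : ∀ i j, xp i * xm j - xm j * xp i = hh (i + j)

theorem commute_dSeries_altSeries {a : ℕ → A} (h : ∀ i j, Commute (a i) (a j)) :
    Commute (altSeries a) (dSeries (altSeries a)) :=
  commute_of_coeff fun i j => by
    simp only [altSeries, coeff_mk, coeff_dSeries]
    exact commute_smul_both (h i _) _ _ |>.smul_right _

theorem coeff_altSeries_mul (a b : ℕ → A) (n : ℕ) :
    coeff n (altSeries a * altSeries b) =
      (-1 : ℚ) ^ n • ∑ p ∈ antidiagonal n, a p.1 * b p.2 := by
  rw [coeff_mul, smul_sum]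
  refine sum_congr rfl fun p hp => ?_
  simp only [altSeries, coeff_mk]
  rw [smul_mul_smul_comm, ← pow_add, mem_antidiagonal.1 hp]

theorem sum_antidiagonal_succ_snd (n : ℕ) :
    ∑ p ∈ antidiagonal n, ((p.2 : ℚ) + 1) = ((n : ℚ) + 1) * ((n : ℚ) + 2) / 2 := by
  rw [← Finset.Nat.sum_antidiagonal_swap, Finset.Nat.sum_antidiagonal_eq_sum_range_succ_mk]
  simp only [Prod.snd_swap]
  induction n with
  | zero => simp
  | succ n ih =>
    rw [sum_range_succ, ih]
    push_cast
    ring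

/-- If `[hh i, x j] = q x (i + j + 1)` then `[altSeries hh, altSeries x] = -q (altSeries x)'`. -/
theorem altSeries_commutator {hh x : ℕ → A} {q : ℚ}
    (h : ∀ i j, hh i * x j - x j * hh i = q • x (i + j + 1)) :
    altSeries hh * altSeries x - altSeries x * altSeries hh = (-q) • dSeries (altSeries x) := by
  ext n
  rw [map_sub, coeff_altSeries_mul, coeff_altSeries_mul, ← Finset.Nat.sum_antidiagonal_swap,
    ← smul_sub, ← sum_sub_distrib, coeff_rat_smul, coeff_dSeries]
  have : ∑ p ∈ antidiagonal n, (hh p.swap.1 * x p.swap.2 - x p.1 * hh p.2) =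
      ∑ p ∈ antidiagonal n, q • x (n + 1) := sum_congr rfl fun p hp => by
    rw [← mem_antidiagonal.1 hp, add_comm p.1 p.2]
    exact h _ _
  rw [this, sum_const, Finset.Nat.card_antidiagonal, altSeries, coeff_mk]
  rw [← Nat.cast_smul_eq_nsmul ℚ]
  push_cast
  module

/-- If `[hh i, x j] = q x (i + j + 1)` with `q = ± 2` then
`[altSeries hh, altSeries₂ x] = -(q / 2) (altSeries₂ x)'`. -/
theorem altSeries₂_commutator {hh x : ℕ → A} {q : ℚ}
    (h : ∀ i j, hh i * x j - x j * hh i = q • x (i + j + 1)) :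
    altSeries hh * altSeries₂ x - altSeries₂ x * altSeries hh =
      (-q / 2) • dSeries (altSeries₂ x) := by
  ext n
  rw [map_sub, coeff_mul, coeff_mul, ← Finset.Nat.sum_antidiagonal_swap, ← sum_sub_distrib,
    coeff_rat_smul, coeff_dSeries]
  have : ∀ p ∈ antidiagonal n, coeff p.swap.1 (altSeries hh) * coeff p.swap.2 (altSeries₂ x) -
      coeff p.1 (altSeries₂ x) * coeff p.2 (altSeries hh) =
      (((p.1 : ℚ) + 1) * ((-1) ^ n * q)) • x (n + 1) := fun p hp => by
    simp only [altSeries, altSeries₂, coeff_mk, Prod.fst_swap, Prod.snd_swap]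
    rw [smul_mul_smul_comm, smul_mul_smul_comm, ← mem_antidiagonal.1 hp, add_comm p.1 p.2]
    have h2 := h p.2 p.1
    rw [show (((p.1 : ℚ) + 1) * ((-1) ^ (p.2 + p.1) * q)) • x (p.2 + p.1 + 1) =
      (((p.1 : ℚ) + 1) * (-1) ^ (p.2 + p.1)) • q • x (p.2 + p.1 + 1) by module, ← h2, pow_add]
    module
  rw [sum_congr rfl this, ← sum_smul, ← sum_mul]
  have h3 := sum_antidiagonal_succ_snd n
  rw [← Finset.Nat.sum_antidiagonal_swap] at h3
  simp only [Prod.snd_swap] at h3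
  rw [h3, altSeries₂, coeff_mk, smul_smul, smul_smul]
  congr 1
  push_cast
  ring

namespace LoopTriple

variable {xp xm hh : ℕ → A} (T : LoopTriple xp xm hh)
include T

/-- Both sides solve F' = F · `altSeries hh` and have constant term `xp 0`. For the right side, the
bracket of `altSeries hh` with `altSeries₂ xp` is minus the derivative of the latter. -/
theorem C_mul_newtonSeries :
    C (xp 0) * newtonSeries hh = newtonSeries hh * altSeries₂ xp := by
  have hcom := commute_altSeries_newtonSeries T.hc
  apply eq_of_dSeries_eq_mul_right (L := altSeries hh)
  · rw [dSeries_mul, dSeries_C, zero_mul, zero_add, dSeries_newtonSeries, hcom.eq, mul_assoc]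
  · have := altSeries₂_commutator T.hp
    have h2 : dSeries (altSeries₂ xp) =
        altSeries₂ xp * altSeries hh - altSeries hh * altSeries₂ xp := by
      rw [← neg_sub, this]; module
    rw [dSeries_mul, dSeries_newtonSeries, h2, hcom.eq]
    noncomm_ring
  · simp [newtonSeries, newtonE_zero, altSeries₂]

theorem newtonSeries_mul_C :
    newtonSeries hh * C (xm 0) = altSeries₂ xm * newtonSeries hh := by
  apply eq_of_dSeries_eq_mul (L := altSeries hh)
  · rw [dSeries_mul, dSeries_C, mul_zero, add_zero, dSeries_newtonSeries, mul_assoc]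
  · have := altSeries₂_commutator T.hm
    have h2 : dSeries (altSeries₂ xm) =
        altSeries hh * altSeries₂ xm - altSeries₂ xm * altSeries hh := by
      rw [this]; module
    rw [dSeries_mul, dSeries_newtonSeries, h2]
    noncomm_ring
  · simp [newtonSeries, newtonE_zero, altSeries₂]

theorem C_mul_altSeries :
    C (xp 0) * altSeries xm - altSeries xm * C (xp 0) = altSeries hh := by
  ext n
  have := T.pm 0 n
  rw [zero_add] at this
  simp [altSeries, ← this, smul_sub]

/-- Passing `xp 0` through one factor X = `altSeries xm` produces H = `altSeries hh`, and H X = X H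
+ 2 X'. Carrying every H to the right of the powers of X accumulates the derivative term. -/
theorem C_mul_pow (i : ℕ) :
    C (xp 0) * altSeries xm ^ (i + 1) = altSeries xm ^ (i + 1) * C (xp 0) +
      ((i : ℚ) + 1) • (altSeries xm ^ i * altSeries hh) +
        ((i : ℚ) + 1) • dSeries (altSeries xm ^ i) := by
  have hX := commute_dSeries_altSeries T.mm
  have h1 : C (xp 0) * altSeries xm = altSeries xm * C (xp 0) + altSeries hh := by
    rw [← T.C_mul_altSeries]; abel
  have h2 : altSeries hh * altSeries xm =
      altSeries xm * altSeries hh + (2 : ℚ) • dSeries (altSeries xm) := by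
    have := altSeries_commutator T.hm
    rw [neg_neg] at this
    rw [← this]; abel
  induction i with
  | zero => simp [dSeries_one, h1]
  | succ i ih =>
    have h3 : dSeries (altSeries xm ^ (i + 1)) =
        dSeries (altSeries xm ^ i) * altSeries xm + altSeries xm ^ i * dSeries (altSeries xm) := by
      rw [pow_succ, dSeries_mul]
    have h4 : ((i : ℚ) + 1) • (altSeries xm ^ i * dSeries (altSeries xm)) =
        dSeries (altSeries xm ^ (i + 1)) := (dSeries_pow_succ _ hX i).symm
    rw [pow_succ (altSeries xm) (i + 1), ← mul_assoc, ih, add_mul, add_mul, mul_assoc, h1,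
      smul_mul_assoc, mul_assoc, h2, smul_mul_assoc]
    have h5 : ((i : ℚ) + 1) • (dSeries (altSeries xm ^ i) * altSeries xm) =
        ((i : ℚ) + 1) • dSeries (altSeries xm ^ (i + 1)) - dSeries (altSeries xm ^ (i + 1)) := by
      rw [eq_sub_iff_add_eq]
      conv_rhs => rw [h3, smul_add, h4]
    rw [h5, mul_add, mul_add, ← mul_assoc, ← pow_succ, ← mul_assoc, ← pow_succ, smul_add,
      mul_smul_comm, smul_comm _ (2 : ℚ), h4]
    push_cast
    module

theorem C_mul_divPowInt (i : ℤ) :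
    C (xp 0) * divPowInt (altSeries xm) i = divPowInt (altSeries xm) i * C (xp 0) +
      divPowInt (altSeries xm) (i - 1) * altSeries hh +
        dSeries (divPowInt (altSeries xm) (i - 1)) := by
  rcases lt_or_ge i 1 with hi | hi
  · rw [divPowInt_of_neg _ (by omega : i - 1 < 0)]
    rcases lt_or_ge i 0 with h | h
    · simp [divPowInt_of_neg _ h]
    · have : i = 0 := by omega
      simp [this, divPowInt_zero]
  · obtain ⟨n, rfl⟩ : ∃ n : ℕ, i = n + 1 := ⟨(i - 1).toNat, by omega⟩
    rw [add_sub_cancel_right]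
    change C (xp 0) * divPow _ (n + 1) = divPow _ (n + 1) * _ + divPow _ n * _ +
      dSeries (divPow _ n)
    simp only [divPow, mul_smul_comm, smul_mul_assoc, map_smul]
    rw [T.C_mul_pow, smul_add, smul_add, smul_smul, smul_smul]
    have : (((n + 1).factorial : ℕ) : ℚ)⁻¹ * ((n : ℚ) + 1) = ((n.factorial : ℕ) : ℚ)⁻¹ := by
      rw [Nat.factorial_succ]; push_cast; field_simp
    rw [this]

end LoopTriple

/-- The triple product whose coefficients occur in the straightening of divided powers. -/
noncomputable def tripleSeries (xp xm hh : ℕ → A) (i j : ℤ) : PowerSeries A :=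
  divPowInt (altSeries xm) i * newtonSeries hh * divPowInt (altSeries xp) j

/-- Move `xp 0` through the three factors in turn. The terms coming from X^(i), with H absorbed by
E' = H E, assemble into the derivative of the whole triple product except for the part where the
last factor is differentiated, which is subtracted. -/
theorem LoopTriple.C_mul_tripleSeries {xp xm hh : ℕ → A} (T : LoopTriple xp xm hh) (i j : ℤ) :
    C (xp 0) * tripleSeries xp xm hh i j =
      ((j : ℚ) + 1) • tripleSeries xp xm hh i (j + 1) +
      X * (divPowInt (altSeries xm) i * newtonSeries hh * dSeries (altSeries xp) *
        divPowInt (altSeries xp) j) +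
      dSeries (tripleSeries xp xm hh (i - 1) j) -
      divPowInt (altSeries xm) (i - 1) * newtonSeries hh * dSeries (altSeries xp) *
        divPowInt (altSeries xp) (j - 1) := by
  have hY := commute_dSeries_altSeries T.pp
  have hYj : dSeries (divPowInt (altSeries xp) j) =
      dSeries (altSeries xp) * divPowInt (altSeries xp) (j - 1) := by
    rw [dSeries_divPowInt _ hY]
    rcases lt_or_ge (j - 1) 0 with h | h
    · simp [divPowInt_of_neg _ h]
    · obtain ⟨n, hn⟩ := Int.eq_ofNat_of_zero_le h
      rw [hn]
      exact commute_divPow_left hY n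
  unfold tripleSeries
  have h1 : divPowInt (altSeries xm) i * (newtonSeries hh *
      (altSeries xp + X * dSeries (altSeries xp))) * divPowInt (altSeries xp) j =
      ((j : ℚ) + 1) • (divPowInt (altSeries xm) i * newtonSeries hh *
        divPowInt (altSeries xp) (j + 1)) +
      X * (divPowInt (altSeries xm) i * newtonSeries hh * dSeries (altSeries xp) *
        divPowInt (altSeries xp) j) := by
    rw [← mul_smul_comm, ← mul_divPowInt, mul_add, mul_add, add_mul]
    congr 1
    · noncomm_ring
    · rw [← mul_assoc (newtonSeries hh), ← X_mul (φ := newtonSeries hh), mul_assoc X,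
        ← mul_assoc _ X, ← X_mul]
      noncomm_ring
  rw [← mul_assoc, ← mul_assoc, T.C_mul_divPowInt, dSeries_mul, dSeries_mul, hYj,
    dSeries_newtonSeries, add_mul, add_mul, add_mul, add_mul, mul_assoc _ (C (xp 0)),
    T.C_mul_newtonSeries, altSeries₂_eq, h1]
  noncomm_ring

/-- The straightening formula for divided powers in the loop algebra of `sl₂`. -/
theorem LoopTriple.divPow_mul_divPow_sum {xp xm hh : ℕ → A} (T : LoopTriple xp xm hh) (k l : ℕ) :
    divPow (xp 0) k * divPow (xm 0) l =
      ∑ n ∈ range (l + 1), coeff n (tripleSeries xp xm hh ((l : ℤ) - n) ((k : ℤ) - n)) := by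
  induction k with
  | zero =>
    rw [divPow_zero, one_mul, sum_range_succ', sum_eq_zero]
    · have h : ∀ m : ℕ, coeff 0 (altSeries xm ^ m) = xm 0 ^ m := fun m => by
        rw [coeff_zero_eq_constantCoeff_apply, map_pow, ← coeff_zero_eq_constantCoeff_apply]
        simp [altSeries]
      simp only [tripleSeries, Nat.cast_zero, sub_zero, divPowInt_zero, mul_one, zero_add,
        divPowInt_natCast]
      rw [coeff_mul]
      simp [newtonSeries, newtonE_zero, divPow, h]
    · intro n _
      rw [tripleSeries, divPowInt_of_neg _ (by push_cast; omega : ((0 : ℕ) : ℤ) - (n + 1 : ℕ) < 0)]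
      simp
  | succ k ih =>
    have h1 : ((k : ℚ) + 1) • (divPow (xp 0) (k + 1) * divPow (xm 0) l) =
        xp 0 * (divPow (xp 0) k * divPow (xm 0) l) := by
      rw [← mul_assoc, mul_divPow, smul_mul_assoc]
    -- Z gathers the terms of `C_mul_tripleSeries` containing the derivative of `altSeries xp`. They
    -- occur once multiplied by w and once with both exponents lowered by one, so their sums over n
    -- cancel after a shift (`h3`).
    set Z : ℤ → ℤ → PowerSeries A := fun i j => divPowInt (altSeries xm) i * newtonSeries hh *
      dSeries (altSeries xp) * divPowInt (altSeries xp) j with hZ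
    set G := tripleSeries xp xm hh with hG
    have hneg : ∀ i j : ℤ, i < 0 → G i j = 0 := fun i j h => by
      simp [hG, tripleSeries, divPowInt_of_neg _ h]
    have hZneg : ∀ i j : ℤ, i < 0 → Z i j = 0 := fun i j h => by
      simp [hZ, divPowInt_of_neg _ h]
    have h2 : ∀ n : ℕ, xp 0 * coeff n (G ((l : ℤ) - n) ((k : ℤ) - n)) =
        ((k : ℚ) - n + 1) • coeff n (G ((l : ℤ) - n) ((k : ℤ) - n + 1)) +
        coeff n (X * Z ((l : ℤ) - n) ((k : ℤ) - n)) +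
        ((n : ℚ) + 1) • coeff (n + 1) (G ((l : ℤ) - n - 1) ((k : ℤ) - n)) -
        coeff n (Z ((l : ℤ) - n - 1) ((k : ℤ) - n - 1)) := fun n => by
      rw [← coeff_C_mul, T.C_mul_tripleSeries, map_sub, map_add, map_add, coeff_rat_smul,
        coeff_dSeries]
      push_cast
      rfl
    have h3 : ∑ n ∈ range (l + 1), coeff n (X * Z ((l : ℤ) - n) ((k : ℤ) - n)) =
        ∑ n ∈ range (l + 1), coeff n (Z ((l : ℤ) - n - 1) ((k : ℤ) - n - 1)) := by
      rw [sum_range_succ', sum_range_succ, coeff_zero_X_mul, hZneg ((l : ℤ) - l - 1) _ (by omega)]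
      simp only [map_zero, add_zero]
      refine sum_congr rfl fun n _ => ?_
      rw [coeff_succ_X_mul]
      push_cast
      rw [sub_sub, sub_sub]
    -- After the shift n ↦ n + 1 the derivative terms contribute the factor n, which added to k - n
    -- + 1 gives the constant k + 1 needed for the divided power. The boundary terms vanish because
    -- negative exponents give zero.
    have h4 : ∑ n ∈ range (l + 1), ((n : ℚ) + 1) • coeff (n + 1)
          (G ((l : ℤ) - n - 1) ((k : ℤ) - n)) =
        ∑ n ∈ range (l + 1), (n : ℚ) • coeff n (G ((l : ℤ) - n) ((k : ℤ) - n + 1)) := by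
      rw [sum_range_succ, sum_range_succ' _ l, hneg ((l : ℤ) - l - 1) _ (by omega)]
      simp only [map_zero, smul_zero, add_zero, Nat.cast_zero, zero_smul]
      refine sum_congr rfl fun n _ => ?_
      push_cast
      rw [sub_sub, show (k : ℤ) - (n + 1) + 1 = k - n by ring]
    have h5 : ((k : ℚ) + 1) • (divPow (xp 0) (k + 1) * divPow (xm 0) l) =
        ((k : ℚ) + 1) • ∑ n ∈ range (l + 1),
          coeff n (G ((l : ℤ) - n) (((k + 1 : ℕ) : ℤ) - n)) := by
      rw [h1, ih, mul_sum, sum_congr rfl fun n _ => h2 n, sum_sub_distrib, sum_add_distrib,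
        sum_add_distrib, h3, h4, smul_sum]
      rw [add_right_comm, add_sub_cancel_right, ← sum_add_distrib]
      refine sum_congr rfl fun n _ => ?_
      rw [← add_smul]
      push_cast
      rw [show (k : ℤ) + 1 - n = k - n + 1 by ring]
      congr 1
      ring
    exact smul_right_injective A (by positivity : ((k : ℚ) + 1) ≠ 0) h5

/-- The straightening formula, as a sum over the terms which do not vanish. -/
theorem LoopTriple.divPow_mul_divPow {xp xm hh : ℕ → A} (T : LoopTriple xp xm hh) (k l : ℕ) :
    divPow (xp 0) k * divPow (xm 0) l =
      ∑ n ∈ range (min k l + 1), coeff n (divPow (altSeries xm) (l - n) * newtonSeries hh *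
        divPow (altSeries xp) (k - n)) := by
  rw [T.divPow_mul_divPow_sum]
  symm
  rw [← sum_subset (range_mono (by omega : min k l + 1 ≤ l + 1))]
  · refine sum_congr rfl fun n hn => ?_
    have := mem_range.1 hn
    rw [tripleSeries, ← divPowInt_natCast, ← divPowInt_natCast, Nat.cast_sub (by omega),
      Nat.cast_sub (by omega)]
  · intro n h1 h2
    have h3 := mem_range.1 h1
    have h4 : ¬ n < min k l + 1 := fun h => h2 (mem_range.2 h)
    rw [tripleSeries, divPowInt_of_neg (altSeries xp) (by omega)]
    simp

end Straightening

/-! ### Integrality of divided powers and binomials; ℤ-spans of the commutative subalgebras. -/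

section Lattices

open PowerSeries Finset

variable {A : Type*} [Ring A] [Algebra ℚ A]

theorem inv_factorial_mul_inv_factorial (i j : ℕ) :
    ((i.factorial : ℚ))⁻¹ * ((j.factorial : ℚ))⁻¹ =
      ((i + j).choose i : ℚ) * (((i + j).factorial : ℕ) : ℚ)⁻¹ := by
  have h : ((i + j).choose i : ℚ) * (i.factorial : ℚ) * (j.factorial : ℚ) =
      (((i + j).factorial : ℕ) : ℚ) := by
    rw [Nat.choose_symm_add]
    exact_mod_cast Nat.add_choose_mul_factorial_mul_factorial i j
  rw [← h]
  have : ((i + j).choose i : ℚ) ≠ 0 := by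
    exact_mod_cast (Nat.choose_pos (Nat.le_add_right i j)).ne'
  field_simp

theorem divPow_add {a b : A} (h : Commute a b) (k : ℕ) :
    divPow (a + b) k = ∑ p ∈ antidiagonal k, divPow a p.1 * divPow b p.2 := by
  rw [divPow, h.add_pow', smul_sum]
  refine sum_congr rfl fun p hp => ?_
  have hp := mem_antidiagonal.1 hp
  rw [divPow, divPow, smul_mul_smul_comm, ← Nat.cast_smul_eq_nsmul ℚ, smul_smul, ← hp,
    inv_factorial_mul_inv_factorial, mul_comm]

theorem divPow_zsmul (z : ℤ) (a : A) (k : ℕ) : divPow (z • a) k = z ^ k • divPow a k := by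
  rw [divPow, divPow, smul_pow, smul_comm]

theorem divPow_mul_divPow_same (a : A) (i j : ℕ) :
    divPow a i * divPow a j = ((i + j).choose i : ℤ) • divPow a (i + j) := by
  rw [divPow, divPow, divPow, smul_mul_smul_comm, ← pow_add, natCast_zsmul,
    ← Nat.cast_smul_eq_nsmul ℚ, smul_smul]
  rw [inv_factorial_mul_inv_factorial]

theorem coeff_pow_congr {B : Type*} [Ring B] {f g : PowerSeries B} {n : ℕ}
    (h : ∀ i ≤ n, coeff i f = coeff i g) (m : ℕ) : ∀ i ≤ n, coeff i (f ^ m) = coeff i (g ^ m) := by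
  induction m with
  | zero => simp
  | succ m ih =>
    intro i hi
    rw [pow_succ, pow_succ, coeff_mul, coeff_mul]
    refine sum_congr rfl fun p hp => ?_
    have := mem_antidiagonal.1 hp
    rw [ih _ (by omega), h _ (by omega)]

theorem monomial_pow' {B : Type*} [Ring B] (i : ℕ) (a : B) (m : ℕ) :
    monomial i a ^ m = monomial (i * m) (a ^ m) := by
  induction m with
  | zero => simp [monomial_zero_eq_C_apply]
  | succ m ih => rw [pow_succ, ih, monomial_mul_monomial, Nat.mul_succ, pow_succ]

theorem coeff_mul_mem {B : Type*} [Ring B] {S : Subalgebra ℤ B} {f g : PowerSeries B} (hf : ∀ n, coeff n f ∈ S)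
    (hg : ∀ n, coeff n g ∈ S) (n : ℕ) : coeff n (f * g) ∈ S := by
  rw [coeff_mul]
  exact sum_mem fun p _ => mul_mem (hf _) (hg _)

/-- The coefficients of the divided powers of a series with commuting coefficients. -/
theorem coeff_divPow_mem {S : Subalgebra ℤ A} {f : PowerSeries A} {k : ℕ}
    (hc : ∀ i j, Commute (coeff i f) (coeff j f))
    (hS : ∀ i, ∀ j ≤ k, divPow (coeff i f) j ∈ S) (n : ℕ) : coeff n (divPow f k) ∈ S := by
  -- A fixed coefficient sees only a truncation of f, and the truncation is built one monomial at a
  -- time with `divPow_add`. Only divided powers of exponent at most k occur, which a later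
  -- induction on k exploits.
  set g : ℕ → PowerSeries A := fun N => ∑ i ∈ range N, monomial i (coeff i f) with hg
  have hgc : ∀ N i, coeff i (g N) = if i < N then coeff i f else 0 := fun N i => by
    simp only [hg, map_sum, coeff_monomial]
    simp
  have key : ∀ N, ∀ j ≤ k, ∀ m, coeff m (divPow (g N) j) ∈ S := by
    intro N
    induction N with
    | zero =>
      intro j _ m
      cases j with
      | zero =>
        rw [divPow_zero, coeff_one]
        split_ifs
        · exact one_mem _
        · exact zero_mem _
      | succ j => simp [hg, divPow]
    | succ N ih =>
      intro j hj m
      have hcomm : Commute (g N) (monomial N (coeff N f)) := by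
        refine commute_of_coeff fun i j => ?_
        rw [hgc, coeff_monomial]
        split_ifs <;> simp [hc]
      have : g (N + 1) = g N + monomial N (coeff N f) := by simp [hg, sum_range_succ]
      rw [this, divPow_add hcomm, map_sum]
      refine sum_mem fun p hp => ?_
      have hp := mem_antidiagonal.1 hp
      refine coeff_mul_mem (ih _ (by omega)) (fun m => ?_) m
      rw [divPow, monomial_pow', coeff_rat_smul, coeff_monomial]
      split_ifs
      · exact hS _ _ (by omega)
      · simp
  have h1 : coeff n (divPow f k) = coeff n (divPow (g (n + 1)) k) := by
    rw [divPow, divPow, coeff_rat_smul, coeff_rat_smul,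
      coeff_pow_congr (g := g (n + 1)) (n := n) _ k n le_rfl]
    intro i hi
    rw [hgc, if_pos (by omega)]
  rw [h1]
  exact key _ _ le_rfl _

theorem rat_smul_intCast (z : ℤ) (a : A) : (z : ℚ) • a = z • a := Int.cast_smul_eq_zsmul ℚ z a

theorem coeff_divPow_altSeries_mem {S : Subalgebra ℤ A} {a : ℕ → A} {k : ℕ}
    (hc : ∀ i j, Commute (a i) (a j)) (hS : ∀ i, ∀ j ≤ k, divPow (a i) j ∈ S) (n : ℕ) :
    coeff n (divPow (altSeries a) k) ∈ S := by
  refine coeff_divPow_mem (fun i j => ?_) (fun i j hj => ?_) n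
  · simp only [altSeries, coeff_mk]
    exact commute_smul_both (hc i j) _ _
  · rw [altSeries, coeff_mk, show ((-1 : ℚ) ^ i) = (((-1) ^ i : ℤ) : ℚ) by push_cast; rfl,
      rat_smul_intCast, divPow_zsmul]
    exact S.toSubmodule.smul_mem _ (hS i j hj)

theorem coeff_divPow_altSeries₂_mem {S : Subalgebra ℤ A} {a : ℕ → A} {k : ℕ}
    (hc : ∀ i j, Commute (a i) (a j)) (hS : ∀ i, ∀ j ≤ k, divPow (a i) j ∈ S) (n : ℕ) :
    coeff n (divPow (altSeries₂ a) k) ∈ S := by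
  refine coeff_divPow_mem (fun i j => ?_) (fun i j hj => ?_) n
  · simp only [altSeries₂, coeff_mk]
    exact commute_smul_both (hc i j) _ _
  · rw [altSeries₂, coeff_mk, show ((-1 : ℚ) ^ i * ((i : ℚ) + 1)) =
      (((-1) ^ i * (i + 1) : ℤ) : ℚ) by push_cast; rfl, rat_smul_intCast, divPow_zsmul]
    exact S.toSubmodule.smul_mem _ (hS i j hj)

theorem commute_of_mem_span {ι B : Type*} [Ring B] {v : ι → B}
    (hv : ∀ i j, Commute (v i) (v j)) {a b : B}
    (ha : a ∈ Submodule.span ℤ (Set.range v)) (hb : b ∈ Submodule.span ℤ (Set.range v)) :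
    Commute a b := by
  refine Submodule.span_induction₂ (p := fun a b _ _ => Commute a b) ?_ ?_ ?_ ?_ ?_ ?_ ?_ ha hb
  · rintro _ _ ⟨i, rfl⟩ ⟨j, rfl⟩
    exact hv i j
  · intros; exact Commute.zero_left _
  · intros; exact Commute.zero_right _
  · intros _ _ _ _ _ _ h1 h2; exact h1.add_left h2
  · intros _ _ _ _ _ _ h1 h2; exact h1.add_right h2
  · intros _ _ _ _ _ h; exact h.smul_left _
  · intros _ _ _ _ _ h; exact h.smul_right _

/-- Divided powers of a sum of commuting elements expand into products of divided powers without
denominators, so those of the generators suffice. -/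
theorem divSubalgebra_eq_adjoin {ι : Type*} {v : ι → A} (hv : ∀ i j, Commute (v i) (v j)) :
    divSubalgebra v = Algebra.adjoin ℤ {y | ∃ i k, y = divPow (v i) k} := by
  apply le_antisymm
  · refine Algebra.adjoin_le ?_
    rintro _ ⟨a, ha, k, rfl⟩
    induction ha using Submodule.span_induction generalizing k with
    | mem x hx =>
      obtain ⟨i, rfl⟩ := hx
      exact Algebra.subset_adjoin ⟨i, k, rfl⟩
    | zero =>
      cases k with
      | zero => rw [divPow_zero]; exact one_mem _
      | succ k => simp [divPow]
    | add a b ha hb iha ihb =>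
      rw [divPow_add (commute_of_mem_span hv ha hb)]
      exact sum_mem fun p _ => mul_mem (iha _) (ihb _)
    | smul z a _ ih =>
      rw [divPow_zsmul]
      exact Subalgebra.smul_mem _ (ih k) _
  · refine Algebra.adjoin_mono ?_
    rintro _ ⟨i, k, rfl⟩
    exact ⟨v i, Submodule.subset_span ⟨i, rfl⟩, k, rfl⟩

/-! ### Evaluation of polynomials at commuting elements -/

section CommAeval

variable {ι R B : Type*} [CommRing R] [Ring B] [Algebra R B]

open scoped IsMulCommutative in
/-- The evaluation of polynomials at a family of pairwise commuting elements. -/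
noncomputable def commAeval (v : ι → B) (hv : ∀ i j, Commute (v i) (v j)) :
    MvPolynomial ι R →ₐ[R] B :=
  haveI : IsMulCommutative (Algebra.adjoin R (Set.range v)) :=
    Algebra.isMulCommutative_adjoin R (by
      rintro _ ⟨i, rfl⟩ _ ⟨j, rfl⟩
      exact (hv i j).eq)
  (Algebra.adjoin R (Set.range v)).val.comp
    (MvPolynomial.aeval (R := R) (S₁ := Algebra.adjoin R (Set.range v))
      fun i => ⟨v i, Algebra.subset_adjoin ⟨i, rfl⟩⟩)

theorem commAeval_X (v : ι → B) (hv : ∀ i j, Commute (v i) (v j)) (i : ι) :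
    commAeval (R := R) v hv (MvPolynomial.X i) = v i := by
  simp [commAeval]

theorem map_orderedProd [LinearOrder ι] {M N F : Type*} [Monoid M] [Monoid N] [FunLike F M N]
    [MonoidHomClass F M N] (φ : F) (g : ι → ℕ → M) (k : ι →₀ ℕ) :
    φ (orderedProd g k) = orderedProd (fun i n => φ (g i n)) k := by
  simp [orderedProd, map_list_prod, Function.comp_def]

theorem orderedProd_eq_prod [LinearOrder ι] {M : Type*} [CommMonoid M] (g : ι → ℕ → M)
    (k : ι →₀ ℕ) : orderedProd g k = k.prod g := by
  rw [orderedProd, ← Multiset.prod_coe, ← Multiset.map_coe, Finset.sort_eq]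
  rfl

theorem orderedProd_single [LinearOrder ι] {M : Type*} [Monoid M] (g : ι → ℕ → M)
    (hg : ∀ i, g i 0 = 1) (i : ι) (n : ℕ) : orderedProd g (Finsupp.single i n) = g i n := by
  rcases Nat.eq_zero_or_pos n with rfl | hn
  · simp [orderedProd, hg]
  · simp [orderedProd, Finsupp.support_single, hn.ne']

theorem adjoin_eq_range_commAeval (v : ι → B) (hv : ∀ i j, Commute (v i) (v j)) :
    Algebra.adjoin R (Set.range v) = (commAeval (R := R) v hv).range := by
  apply le_antisymm
  · refine Algebra.adjoin_le ?_
    rintro _ ⟨i, rfl⟩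
    exact ⟨MvPolynomial.X i, commAeval_X v hv i⟩
  · rintro _ ⟨p, rfl⟩
    induction p using MvPolynomial.induction_on with
    | C r => simp [← MvPolynomial.algebraMap_eq]
    | add p q hp hq => simpa using add_mem hp hq
    | mul_X p i hp =>
      simp only [AlgHom.toRingHom_eq_coe, RingHom.coe_coe, map_mul, commAeval_X] at hp ⊢
      exact mul_mem hp (Algebra.subset_adjoin ⟨i, rfl⟩)

theorem orderedProd_pow_eq_commAeval [LinearOrder ι] (v : ι → B) (hv : ∀ i j, Commute (v i) (v j))
    (k : ι →₀ ℕ) : orderedProd (fun i n => v i ^ n) k =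
      commAeval (R := R) v hv (MvPolynomial.monomial k 1) := by
  rw [MvPolynomial.monomial_eq, map_one, one_mul, ← orderedProd_eq_prod, map_orderedProd]
  simp [commAeval_X]

theorem adjoin_range_eq_span_orderedProd [LinearOrder ι] (v : ι → B)
    (hv : ∀ i j, Commute (v i) (v j)) : Subalgebra.toSubmodule (Algebra.adjoin R (Set.range v)) =
      Submodule.span R (Set.range fun k => orderedProd (fun i n => v i ^ n) k) := by
  have h1 : (fun k => orderedProd (fun i n => v i ^ n) k) =
      (commAeval (R := R) v hv).toLinearMap ∘ MvPolynomial.basisMonomials ι R := by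
    ext k
    simp [orderedProd_pow_eq_commAeval (R := R) v hv]
  rw [h1, Set.range_comp, ← Submodule.map_span, Module.Basis.span_eq,
    adjoin_eq_range_commAeval v hv]
  ext x
  simp

end CommAeval

/-- The commuting v i are images of the variables of a polynomial ring. There the product of two
divided-power monomials is a product of binomial coefficients times a third one, so their span is
already a ring. -/
theorem divSubalgebra_eq_span {ι : Type*} [LinearOrder ι] {v : ι → A}
    (hv : ∀ i j, Commute (v i) (v j)) : Subalgebra.toSubmodule (divSubalgebra v) =
      Submodule.span ℤ (Set.range fun k => orderedProd (fun i n => divPow (v i) n) k) := by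
  set D : (ι →₀ ℕ) → MvPolynomial ι ℚ :=
    fun k => k.prod fun i n => divPow (MvPolynomial.X i) n with hD
  have hφ : ∀ k, orderedProd (fun i n => divPow (v i) n) k = commAeval (R := ℚ) v hv (D k) := by
    intro k
    simp only [hD]
    rw [← orderedProd_eq_prod, map_orderedProd]
    simp only [map_divPow, commAeval_X]
  have hmul : ∀ k l, ∃ z : ℤ, D k * D l = z • D (k + l) := by
    intro k l
    classical
    have h0 : ∀ i, divPow (MvPolynomial.X i : MvPolynomial ι ℚ) 0 = 1 := fun i => divPow_zero _
    refine ⟨∏ i ∈ k.support ∪ l.support, ((k i + l i).choose (k i) : ℤ), ?_⟩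
    simp only [hD]
    rw [Finsupp.prod_of_support_subset k subset_union_left _ (fun i _ => h0 i),
      Finsupp.prod_of_support_subset l subset_union_right _ (fun i _ => h0 i),
      Finsupp.prod_of_support_subset (k + l) Finsupp.support_add _ (fun i _ => h0 i),
      ← prod_mul_distrib, ← prod_smul]
    exact prod_congr rfl fun i _ => divPow_mul_divPow_same _ _ _
  rw [divSubalgebra_eq_adjoin hv]
  apply le_antisymm
  · intro x hx
    refine Algebra.adjoin_induction (p := fun x _ => x ∈ Submodule.span ℤ
      (Set.range fun k => orderedProd (fun i n => divPow (v i) n) k)) ?_ ?_ ?_ ?_ hx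
    · rintro _ ⟨i, k, rfl⟩
      refine Submodule.subset_span ⟨Finsupp.single i k, ?_⟩
      exact orderedProd_single _ (fun i => divPow_zero _) i k
    · intro z
      rw [Algebra.algebraMap_eq_smul_one]
      refine Submodule.smul_mem _ _ (Submodule.subset_span ⟨0, ?_⟩)
      simp [orderedProd]
    · intro x y _ _ hx hy
      exact add_mem hx hy
    · intro x y _ _ hx hy
      have := Submodule.mul_mem_mul hx hy
      rw [Submodule.span_mul_span] at this
      refine Submodule.span_le.2 ?_ this
      rintro _ ⟨_, ⟨k, rfl⟩, _, ⟨l, rfl⟩, rfl⟩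
      obtain ⟨z, hz⟩ := hmul k l
      simp only [hφ]
      rw [← map_mul, hz, map_zsmul]
      exact Submodule.smul_mem _ _ (Submodule.subset_span ⟨k + l, rfl⟩)
  · rw [Submodule.span_le]
    rintro _ ⟨k, rfl⟩
    refine Subalgebra.list_prod_mem _ fun x hx => ?_
    obtain ⟨i, _, rfl⟩ := List.mem_map.1 hx
    exact Algebra.subset_adjoin ⟨i, k i, rfl⟩

/-! ### Binomials -/

/-- The analogue of exp(f + g) = exp(f) exp(g): the product solves the differential equation
attached to the sum. -/
theorem newtonSeries_add {a b : ℕ → A} (h : ∀ i j, Commute (a i) (b j)) :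
    newtonSeries (fun i => a i + b i) = newtonSeries a * newtonSeries b := by
  symm
  apply eq_newtonSeries
  · have h1 : altSeries (fun i => a i + b i) = altSeries a + altSeries b := by
      ext n; simp [altSeries]
    have h2 : Commute (newtonSeries a) (altSeries b) := commute_of_coeff fun i j => by
      simp only [altSeries, newtonSeries, coeff_mk]
      exact (commute_newtonE (fun k => h k j) i).smul_right _
    rw [dSeries_mul, dSeries_newtonSeries, dSeries_newtonSeries, h1, ← mul_assoc, h2.eq]
    noncomm_ring
  · simp [coeff_mul, newtonSeries, newtonE_zero]

theorem binom_zero (a : A) : binom a 0 = 1 := by simp [binom]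

theorem binom_one (a : A) : binom a 1 = a := by simp [binom]

theorem binom_succ (a : A) (k : ℕ) :
    ((k : ℚ) + 1) • binom a (k + 1) = a * binom a k - (k : ℚ) • binom a k := by
  rw [binom, binom, descPochhammer_succ_right, mul_comm, map_mul, smul_smul, mul_smul_comm,
    smul_comm (k : ℚ), ← smul_sub, Nat.factorial_succ]
  have : ((k : ℚ) + 1) * (((k + 1) * k.factorial : ℕ) : ℚ)⁻¹ = ((k.factorial : ℕ) : ℚ)⁻¹ := by
    push_cast; field_simp
  rw [this]
  congr 1
  simp [sub_mul, Algebra.smul_def]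

/-- For a constant sequence the equation reads F' = a (1 + w)⁻¹ F, whose solution is (1 + w)^a.
Binomials thus inherit every property of Newton elements. -/
theorem binom_eq_newtonE (a : A) (k : ℕ) : binom a k = newtonE (fun _ => a) k := by
  refine newtonE_eq_of_recursion (binom_zero a) (fun n => ?_) k
  induction n with
  | zero => simp [binom_zero, binom_one]
  | succ n ih =>
    rw [Finset.Nat.sum_antidiagonal_succ, binom_succ]
    simp only [pow_zero, one_smul, pow_succ, mul_neg, mul_one, neg_smul, sum_neg_distrib]
    rw [← ih]
    push_cast
    abel

theorem binom_add {a b : A} (h : Commute a b) (k : ℕ) :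
    binom (a + b) k = ∑ p ∈ antidiagonal k, binom a p.1 * binom b p.2 := by
  have := congrArg (coeff k) (newtonSeries_add (a := fun _ => a) (b := fun _ => b) fun _ _ => h)
  rw [coeff_mul] at this
  simpa [newtonSeries, ← binom_eq_newtonE] using this

theorem commute_binom_left {a b : A} (h : Commute a b) (k : ℕ) : Commute (binom a k) b := by
  rw [binom_eq_newtonE]
  exact commute_newtonE (fun _ => h) k

theorem map_binom {B : Type*} [Ring B] [Algebra ℚ B] (φ : A →ₐ[ℚ] B) (a : A) (k : ℕ) :
    φ (binom a k) = binom (φ a) k := by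
  rw [binom_eq_newtonE, binom_eq_newtonE, map_newtonE]

theorem binom_zero_left (k : ℕ) : binom (0 : A) (k + 1) = 0 := by
  have h : ((k : ℚ) + 1) • binom (0 : A) (k + 1) = 0 := by
    rw [binom_eq_newtonE, newtonE_succ]
    simp
  exact (smul_eq_zero.1 h).resolve_left (by positivity)

/-- From (1 + w)^a (1 + w)^(-a) = 1: the coefficient of positive degree k + 1 vanishes and can be
solved for its term with a full binomial of -a. -/
theorem binom_neg_mem {S : Subalgebra ℤ A} {a : A} (h : ∀ k, binom a k ∈ S) (k : ℕ) :
    binom (-a) k ∈ S := by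
  induction k using Nat.strong_induction_on with
  | _ k ih =>
    cases k with
    | zero => rw [binom_zero]; exact one_mem _
    | succ k =>
      have h1 := binom_add (Commute.refl a).neg_right (k + 1)
      rw [add_neg_cancel, binom_zero_left, Finset.Nat.sum_antidiagonal_succ, binom_zero,
        one_mul] at h1
      rw [eq_neg_of_add_eq_zero_left h1.symm]
      refine neg_mem (sum_mem fun p hp => mul_mem (h _) (ih _ ?_))
      have := mem_antidiagonal.1 hp
      omega

theorem binom_add_mem {S : Subalgebra ℤ A} {a b : A} (hab : Commute a b)
    (ha : ∀ k, binom a k ∈ S) (hb : ∀ k, binom b k ∈ S) (k : ℕ) : binom (a + b) k ∈ S := by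
  rw [binom_add hab]
  exact sum_mem fun p _ => mul_mem (ha _) (hb _)

theorem binom_natCast (n k : ℕ) : binom (n : A) k = (n.choose k : ℕ) := by
  have h : (Polynomial.aeval (n : A)) (descPochhammer ℚ k) = ((n.descFactorial k : ℕ) : A) := by
    have := Polynomial.aeval_algebraMap_apply A (n : ℚ) (descPochhammer ℚ k)
    rw [map_natCast] at this
    rw [this, Polynomial.coe_aeval_eq_eval, descPochhammer_eval_eq_descFactorial, map_natCast]
  rw [binom, h, Nat.descFactorial_eq_factorial_mul_choose, Nat.cast_mul,
    ← map_natCast (algebraMap ℚ A), ← Algebra.smul_def,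
    inv_smul_smul₀ (by positivity)]

theorem binom_intCast_mem (S : Subalgebra ℤ A) (n : ℤ) (k : ℕ) : binom (n : A) k ∈ S := by
  have h : ∀ (n : ℕ) (k : ℕ), binom (n : A) k ∈ S := fun n k => by
    rw [binom_natCast]; exact natCast_mem _ _
  obtain ⟨m, rfl | rfl⟩ := n.eq_nat_or_neg
  · simpa using h m k
  · simpa using binom_neg_mem (h m) k

theorem binom_zsmul_mem {S : Subalgebra ℤ A} {a : A} (h : ∀ k, binom a k ∈ S) (z : ℤ) (k : ℕ) :
    binom (z • a) k ∈ S := by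
  have hn : ∀ (n : ℕ) (k : ℕ), binom (n • a) k ∈ S := fun n => by
    induction n with
    | zero =>
      intro k
      simpa using binom_intCast_mem S 0 k
    | succ n ih =>
      intro k
      rw [succ_nsmul]
      exact binom_add_mem ((Commute.refl a).smul_left n) ih h k
  obtain ⟨m, rfl | rfl⟩ := z.eq_nat_or_neg
  · simpa using hn m k
  · simpa using binom_neg_mem (hn m) k

theorem binom_mul_binom_sub (a : A) (k j : ℕ) :
    binom a k * binom (a - (k : ℕ)) j = ((k + j).choose k : ℤ) • binom a (k + j) := by
  have h : Polynomial.aeval (a - (k : ℕ)) (descPochhammer ℚ j) =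
      Polynomial.aeval a ((descPochhammer ℚ j).comp (Polynomial.X - (k : Polynomial ℚ))) := by
    rw [Polynomial.aeval_comp]
    simp
  rw [binom, binom, binom, h, smul_mul_smul_comm, ← map_mul, descPochhammer_mul, natCast_zsmul,
    ← Nat.cast_smul_eq_nsmul ℚ, smul_smul]
  rw [inv_factorial_mul_inv_factorial]

theorem binom_mul_binom_mem (a : A) (k l : ℕ) :
    binom a k * binom a l ∈ Submodule.span ℤ (Set.range (binom a)) := by
  -- Vandermonde around a - k: `binom (a - k) j` times `binom a k` is an integer multiple of `binom
  -- a (k + j)`, and `binom k _` is an ordinary integer.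
  have h1 : binom a l = ∑ p ∈ antidiagonal l, binom (a - (k : ℕ)) p.1 * binom (k : A) p.2 := by
    rw [← binom_add (Nat.cast_commute k _).symm, sub_add_cancel]
  rw [h1, mul_sum]
  refine sum_mem fun p _ => ?_
  rw [← mul_assoc, binom_mul_binom_sub, binom_natCast, ← Nat.cast_comm, ← nsmul_eq_mul,
    ← natCast_zsmul, smul_smul]
  exact Submodule.smul_mem _ _ (Submodule.subset_span ⟨_, rfl⟩)

theorem binSubalgebra_eq_span {a b : A} (hab : Commute a b) :
    Subalgebra.toSubmodule (binSubalgebra ![a, b]) =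
      Submodule.span ℤ (Set.range fun p : ℕ × ℕ => binom a p.1 * binom b p.2) := by
  set V := Submodule.span ℤ (Set.range fun p : ℕ × ℕ => binom a p.1 * binom b p.2) with hV
  have hVmul : V = Submodule.span ℤ (Set.range (binom a)) * Submodule.span ℤ (Set.range (binom b)) := by
    rw [Submodule.span_mul_span, hV]
    congr 1
    ext x
    simp [Set.mem_mul]
  have hsq : ∀ a : A, Submodule.span ℤ (Set.range (binom a)) * Submodule.span ℤ (Set.range (binom a)) ≤
      Submodule.span ℤ (Set.range (binom a)) := fun a => by
    rw [Submodule.span_mul_span, Submodule.span_le]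
    rintro _ ⟨_, ⟨k, rfl⟩, _, ⟨l, rfl⟩, rfl⟩
    exact binom_mul_binom_mem a k l
  have hcomm : Submodule.span ℤ (Set.range (binom b)) * Submodule.span ℤ (Set.range (binom a)) ≤
      Submodule.span ℤ (Set.range (binom a)) * Submodule.span ℤ (Set.range (binom b)) := by
    rw [Submodule.span_mul_span, Submodule.span_le]
    rintro _ ⟨_, ⟨k, rfl⟩, _, ⟨l, rfl⟩, rfl⟩
    have : Commute (binom b k) (binom a l) :=
      commute_binom_left (commute_binom_left hab l).symm k
    simp only [this.eq]
    exact Submodule.mul_mem_mul (Submodule.subset_span ⟨l, rfl⟩) (Submodule.subset_span ⟨k, rfl⟩)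
  have hVV : V * V ≤ V := by
    calc V * V = Submodule.span ℤ (Set.range (binom a)) *
          (Submodule.span ℤ (Set.range (binom b)) * Submodule.span ℤ (Set.range (binom a))) *
          Submodule.span ℤ (Set.range (binom b)) := by rw [hVmul]; simp only [mul_assoc]
      _ ≤ Submodule.span ℤ (Set.range (binom a)) *
          (Submodule.span ℤ (Set.range (binom a)) * Submodule.span ℤ (Set.range (binom b))) *
          Submodule.span ℤ (Set.range (binom b)) := by gcongr
      _ = (Submodule.span ℤ (Set.range (binom a)) * Submodule.span ℤ (Set.range (binom a))) *
          (Submodule.span ℤ (Set.range (binom b)) * Submodule.span ℤ (Set.range (binom b))) := by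
        simp only [mul_assoc]
      _ ≤ V := by rw [hVmul]; exact mul_le_mul' (hsq a) (hsq b)
  have hone : (1 : A) ∈ V := Submodule.subset_span ⟨(0, 0), by simp [binom_zero]⟩
  set W : Subalgebra ℤ A := V.toSubalgebra hone
    (fun x y hx hy => hVV (Submodule.mul_mem_mul hx hy)) with hW
  have ha : ∀ k, binom a k ∈ W := fun k =>
    Submodule.subset_span ⟨(k, 0), by simp [binom_zero]⟩
  have hb : ∀ k, binom b k ∈ W := fun k =>
    Submodule.subset_span ⟨(0, k), by simp [binom_zero]⟩
  apply le_antisymm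
  · have : binSubalgebra ![a, b] ≤ W := by
      refine Algebra.adjoin_le ?_
      rintro _ ⟨x, hx, k, rfl⟩
      rw [Matrix.range_cons, Matrix.range_cons, Matrix.range_empty, Set.union_empty,
        Set.singleton_union, Submodule.mem_span_pair] at hx
      obtain ⟨m, n, rfl⟩ := hx
      exact binom_add_mem ((hab.smul_left m).smul_right n) (binom_zsmul_mem ha m)
        (binom_zsmul_mem hb n) k
    exact this
  · rw [hV, Submodule.span_le]
    rintro _ ⟨p, rfl⟩
    refine Subalgebra.mul_mem _ (Algebra.subset_adjoin ⟨a, Submodule.subset_span ⟨0, rfl⟩, p.1, rfl⟩)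
      (Algebra.subset_adjoin ⟨b, Submodule.subset_span ⟨1, rfl⟩, p.2, rfl⟩)

end Lattices

/-! ### Symmetric polynomials and plethysm with a power sum. -/

section SymmetricFunctions

open Finset MvPolynomial

variable {A : Type*} [Ring A] [Algebra ℚ A]

/-- Newton's identities: the elementary symmetric polynomials are the Newton elements of the
power sums. -/
theorem newtonE_psum (σ : Type*) [Fintype σ] (k : ℕ) :
    newtonE (fun i => psum σ ℚ (i + 1)) k = esymm σ ℚ k := by
  classical
  symm
  refine newtonE_eq_of_recursion (e := fun k => esymm σ ℚ k) (by simp) (fun n => ?_) k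
  have h := mul_esymm_eq_sum σ ℚ (n + 1)
  rw [sum_filter, Finset.Nat.sum_antidiagonal_succ'] at h
  simp only [lt_self_iff_false, if_false, zero_add] at h
  rw [Algebra.smul_def]
  push_cast at h
  rw [map_add, map_natCast, map_one, h, ← Finset.Nat.sum_antidiagonal_swap, mul_sum]
  refine sum_congr rfl fun p hp => ?_
  have hp := mem_antidiagonal.1 hp
  simp only [Prod.fst_swap, Prod.snd_swap]
  rw [if_pos (by omega), Algebra.smul_def, map_pow, map_neg, map_one, ← hp]
  ring_nf
  rw [mul_comm p.2 2, pow_mul]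
  simp

theorem expand_psum (σ : Type*) [Fintype σ] (N m : ℕ) :
    expand N (psum σ ℚ m) = psum σ ℚ (N * m) := by
  simp [psum, pow_mul]

theorem isSymmetric_expand {σ R : Type*} [CommRing R] {p : MvPolynomial σ R} (hp : p.IsSymmetric)
    (N : ℕ) : (expand N p).IsSymmetric := fun e => by
  rw [rename_expand, hp e]

/-- The plethysm with a power sum preserves the integral form of symmetric functions. -/
theorem newtonE_plethysm_mem {p : ℕ → A} (hp : ∀ i j, Commute (p i) (p j)) {N : ℕ} (hN : 0 < N)
    (k : ℕ) : newtonE (fun i => p (N * (i + 1) - 1)) k ∈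
      Algebra.adjoin ℤ (Set.range fun j : ℕ => newtonE p (j + 1)) := by
  -- N k variables are enough: only power sums of degree at most N k enter.
  set M := N * k with hM
  set P : ℕ → symmetricSubalgebra (Fin M) ℚ := fun i => ⟨psum (Fin M) ℚ (i + 1),
    psum_isSymmetric _ _ _⟩ with hP
  have hcomm : ∀ i j : Fin M, Commute (newtonE p (i + 1)) (newtonE p (j + 1)) := fun i j =>
    commute_newtonE (fun a => (commute_newtonE (fun b => hp b a) _).symm) _
  set φ : MvPolynomial (Fin M) ℚ →ₐ[ℚ] A := commAeval _ hcomm with hφ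
  set ε := esymmAlgEquiv (σ := Fin M) ℚ (n := M) (by simp) with hε
  -- The elementary symmetric polynomials are free generators, so ρ may send them to the Newton
  -- elements of p. By Newton's identities it then sends the power sums of degree at most M to the
  -- terms of p.
  set ρ : symmetricSubalgebra (Fin M) ℚ →ₐ[ℚ] A := φ.comp ε.symm.toAlgHom with hρ
  have hεX : ∀ q : MvPolynomial (Fin M) ℚ, ((ε q : symmetricSubalgebra (Fin M) ℚ) :
      MvPolynomial (Fin M) ℚ) = aeval (fun i : Fin M => esymm (Fin M) ℚ (i + 1)) q := fun q =>
    esymmAlgHom_apply _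
  have hval : ∀ (a : ℕ → symmetricSubalgebra (Fin M) ℚ) (n : ℕ),
      ((newtonE a n : symmetricSubalgebra (Fin M) ℚ) : MvPolynomial (Fin M) ℚ) =
        newtonE (fun i => (a i : MvPolynomial (Fin M) ℚ)) n := fun a n =>
    map_newtonE (symmetricSubalgebra (Fin M) ℚ).val a n
  have hρP : ∀ n ≤ M, newtonE (fun i => ρ (P i)) n = newtonE p n := by
    intro n hn
    cases n with
    | zero => simp [newtonE_zero]
    | succ n =>
      rw [← map_newtonE]
      have : newtonE P (n + 1) = ε (X ⟨n, by omega⟩) := by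
        apply Subtype.ext
        rw [hval, hεX, aeval_X]
        exact newtonE_psum (Fin M) (n + 1)
      rw [this]
      simp [hρ, hφ, commAeval_X]
  have hρp := eq_of_newtonE_eq hρP
  have h1 : newtonE (fun i => p (N * (i + 1) - 1)) k =
      ρ (newtonE (fun i => P (N * (i + 1) - 1)) k) := by
    rw [map_newtonE]
    refine newtonE_congr (N := k) (fun i hi => (hρp _ ?_).symm) k le_rfl
    have : N * (i + 1) ≤ N * k := Nat.mul_le_mul_left N hi
    have : 0 < N * (i + 1) := by positivity
    omega
  -- Substituting N-th powers of the variables into e_k leaves it symmetric with integer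
  -- coefficients; the fundamental theorem over ℤ gives the integral polynomial Q.
  obtain ⟨Q, hQ⟩ := esymmAlgHom_surjective (σ := Fin M) (n := M) ℤ (by simp)
    ⟨expand N (esymm (Fin M) ℤ k), isSymmetric_expand (esymm_isSymmetric _ _ _) N⟩
  have h2 : newtonE (fun i => P (N * (i + 1) - 1)) k = ε (map (Int.castRingHom ℚ) Q) := by
    apply Subtype.ext
    rw [hval, hεX]
    have h3 : ∀ i : ℕ, ((P (N * (i + 1) - 1) : symmetricSubalgebra (Fin M) ℚ) :
        MvPolynomial (Fin M) ℚ) = expand N (psum (Fin M) ℚ (i + 1)) := fun i => by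
      have : 0 < N * (i + 1) := by positivity
      rw [expand_psum, hP]
      simp only
      congr 1
      omega
    simp only [h3]
    rw [← map_newtonE, newtonE_psum]
    have h4 := congrArg (fun q : symmetricSubalgebra (Fin M) ℤ =>
      map (Int.castRingHom ℚ) (q : MvPolynomial (Fin M) ℤ)) hQ
    simp only [esymmAlgHom_apply] at h4
    rw [map_expand, map_esymm] at h4
    rw [← h4, map_aeval, show Int.castRingHom ℚ = algebraMap ℤ ℚ from rfl, aeval_map_algebraMap,
      aeval_eq_eval₂Hom]
    simp only [map_esymm]
    congr 2
    exact RingHom.ext_int _ _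
  rw [h1, h2]
  simp only [hρ, AlgHom.comp_apply]
  have h5 : ε.symm.toAlgHom (ε (map (Int.castRingHom ℚ) Q)) = map (Int.castRingHom ℚ) Q := by
    simp
  rw [h5]
  clear hQ h2 h5
  induction Q using MvPolynomial.induction_on with
  | C r =>
    have : map (Int.castRingHom ℚ) (C r : MvPolynomial (Fin M) ℤ) = (r : MvPolynomial (Fin M) ℚ) := by
      simp
    rw [this, map_intCast]
    exact intCast_mem _ r
  | add p q hp hq =>
    rw [map_add, map_add]
    exact add_mem hp hq
  | mul_X q i hq =>
    rw [map_mul, map_mul, map_X, commAeval_X]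
    exact mul_mem hq (Algebra.subset_adjoin ⟨i, rfl⟩)

end SymmetricFunctions

/-! ### The exponential series as solution of a differential equation. -/

section Exponential

open PowerSeries Finset

variable {A : Type*} [Ring A] [Algebra ℚ A]

theorem coeff_pow_of_lt {B : Type*} [Ring B] {f : PowerSeries B} (h0 : coeff 0 f = 0) {n m : ℕ}
    (h : n < m) : coeff n (f ^ m) = 0 := by
  have h1 := eq_X_mul_shift_add_const f
  rw [← coeff_zero_eq_constantCoeff_apply, h0, map_zero, add_zero] at h1
  rw [h1, (commute_X _).symm.mul_pow, coeff_X_pow_mul', if_neg (by omega)]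

theorem dSeries_expSeries {f : PowerSeries A} (h0 : coeff 0 f = 0) (hf : Commute f (dSeries f)) :
    dSeries (expSeries f) = dSeries f * expSeries f := by
  have hexp : ∀ n N, n ≤ N → coeff n (expSeries f) =
      ∑ m ∈ range (N + 1), ((m.factorial : ℚ)⁻¹) • coeff n (f ^ m) := fun n N hN => by
    rw [expSeries, coeff_mk]
    refine sum_subset (range_mono (by omega)) fun m _ hm => ?_
    rw [coeff_pow_of_lt h0 (by simpa using hm), smul_zero]
  ext n
  rw [coeff_dSeries, hexp (n + 1) (n + 1) le_rfl, sum_range_succ', smul_add, smul_sum, coeff_mul]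
  have h1 : ∀ m, ((n : ℚ) + 1) • ((((m + 1).factorial : ℕ) : ℚ)⁻¹) • coeff (n + 1) (f ^ (m + 1)) =
      ((m.factorial : ℚ)⁻¹) • coeff n (dSeries f * f ^ m) := fun m => by
    rw [smul_comm, ← coeff_dSeries, dSeries_pow_succ f hf, coeff_rat_smul, smul_smul,
      Nat.factorial_succ, (hf.pow_left m).eq]
    congr 1
    push_cast
    field_simp
  have h2 : coeff (n + 1) (f ^ 0) = 0 := by simp [coeff_one]
  rw [sum_congr rfl fun m _ => h1 m, h2, smul_zero, smul_zero, add_zero]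
  have h3 : ∀ p ∈ antidiagonal n, coeff p.1 (dSeries f) * coeff p.2 (expSeries f) =
      ∑ m ∈ range (n + 1), ((m.factorial : ℚ)⁻¹) • (coeff p.1 (dSeries f) * coeff p.2 (f ^ m)) := by
    intro p hp
    have := mem_antidiagonal.1 hp
    rw [hexp p.2 n (by omega), mul_sum]
    simp only [mul_smul_comm]
  rw [sum_congr rfl h3, sum_comm]
  refine sum_congr rfl fun m _ => ?_
  rw [coeff_mul, smul_sum]

end Exponential

/-! ### Relations in the affine algebra and the exchange formulas for the ĥ's. -/

section Relations

open PowerSeries Finset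

theorem mk_eq_of_rel {x y : FreeAlgebra ℚ Gen} (hxy : Rel x y) : mk x = mk y :=
  RingQuot.mkAlgHom_rel ℚ hxy

theorem mk_lie (x y : FreeAlgebra ℚ Gen) : mk ⁅x, y⁆ = mk x * mk y - mk y * mk x := by
  rw [Ring.lie_def, map_sub, map_mul, map_mul]

theorem commute_c_gen (g : Gen) : Commute c (gen g) := by
  have := mk_eq_of_rel (Rel.c_central g)
  rw [mk_lie, map_zero, sub_eq_zero] at this
  exact this

theorem h_mul_h (r s : ℤ) :
    h r * h s - h s * h r = if r + s = 0 then (2 * (r : ℚ)) • c else 0 := by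
  have := mk_eq_of_rel (Rel.h_h r s)
  rw [mk_lie] at this
  change h r * h s - h s * h r = _ at this
  rw [this]
  split_ifs <;> simp [c, gen]

theorem h_mul_xPlus (r s : ℤ) : h r * xPlus s - xPlus s * h r = (2 : ℚ) • xPlus (r + s) := by
  have := mk_eq_of_rel (Rel.h_xPlus r s)
  rw [mk_lie, map_smul] at this
  exact this

theorem h_mul_xMinus (r s : ℤ) :
    h r * xMinus s - xMinus s * h r = (-2 : ℚ) • xMinus (r + s) := by
  have := mk_eq_of_rel (Rel.h_xMinus r s)
  rw [mk_lie, map_smul] at this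
  exact this

theorem commute_xPlus (r s : ℤ) : Commute (xPlus r) (xPlus s) := by
  have := mk_eq_of_rel (Rel.xPlus_xPlus r s)
  rw [mk_lie, map_zero, sub_eq_zero] at this
  exact this

theorem commute_xMinus (r s : ℤ) : Commute (xMinus r) (xMinus s) := by
  have := mk_eq_of_rel (Rel.xMinus_xMinus r s)
  rw [mk_lie, map_zero, sub_eq_zero] at this
  exact this

theorem xPlus_mul_xMinus (r s : ℤ) : xPlus r * xMinus s - xMinus s * xPlus r =
    h (r + s) + if r + s = 0 then (r : ℚ) • c else 0 := by
  have := mk_eq_of_rel (Rel.xPlus_xMinus r s)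
  rw [mk_lie, map_add] at this
  change xPlus r * xMinus s - xMinus s * xPlus r = _ at this
  rw [this]
  congr 1
  split_ifs <;> simp [c, gen]

theorem commute_h {r s : ℤ} (hrs : r + s ≠ 0) : Commute (h r) (h s) := by
  have := h_mul_h r s
  rw [if_neg hrs, sub_eq_zero] at this
  exact this

theorem commute_h_zero (r : ℤ) : Commute (h 0) (h r) := by
  rcases eq_or_ne (0 + r) 0 with h0 | h0
  · rw [show r = 0 by omega]
  · exact commute_h h0

theorem gen_induction {p : U → Prop} (h_gen : ∀ g, p (gen g)) (h_alg : ∀ q : ℚ, p (algebraMap ℚ U q))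
    (h_add : ∀ a b, p a → p b → p (a + b)) (h_mul : ∀ a b, p a → p b → p (a * b)) (u : U) :
    p u := by
  obtain ⟨x, rfl⟩ := RingQuot.mkAlgHom_surjective ℚ Rel u
  change p (mk x)
  induction x using FreeAlgebra.induction with
  | grade0 r => rw [AlgHom.commutes]; exact h_alg r
  | grade1 x => exact h_gen x
  | mul a b ha hb => rw [map_mul]; exact h_mul _ _ ha hb
  | add a b ha hb => rw [map_add]; exact h_add _ _ ha hb

theorem commute_c (u : U) : Commute c u := by
  induction u using gen_induction with
  | h_gen g => exact commute_c_gen g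
  | h_alg q => exact (Algebra.commutes q c).symm
  | h_add a b ha hb => exact ha.add_right hb
  | h_mul a b ha hb => exact ha.mul_right hb

/-- The sequence `h_{n (i + 1)}` with a central correction for `n = 0`. -/
noncomputable def hSeq (n r : ℤ) (i : ℕ) : U :=
  h (n * (i + 1)) + if n = 0 then (r : ℚ) • c else 0

theorem hSeq_of_ne_zero {n : ℤ} (hn : n ≠ 0) (r : ℤ) : hSeq n r = fun i : ℕ => h (n * (i + 1)) := by
  ext i
  simp [hSeq, hn]

theorem hSeq_zero (r : ℤ) : hSeq 0 r = fun _ : ℕ => h 0 + (r : ℚ) • c := by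
  ext i
  simp [hSeq]

/-- This is the substitution of the (r + s)-th power for the loop variable. If r + s ≠ 0 the indices
(r + s)(i + 1) all have the same sign, so no central term survives. If r + s = 0 the only one is r
c, which `hSeq` absorbs into h₀. -/
theorem loopTriple (r s : ℤ) : LoopTriple (fun i : ℕ => xPlus (r + (r + s) * i))
    (fun i : ℕ => xMinus (s + (r + s) * i)) (hSeq (r + s) r) where
  pp _ _ := commute_xPlus _ _
  mm _ _ := commute_xMinus _ _
  hc i j := by
    rcases eq_or_ne (r + s) 0 with h0 | h0
    · rw [h0, hSeq_zero]
    · rw [hSeq_of_ne_zero h0]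
      refine commute_h fun h1 => h0 ?_
      have h2 : (r + s) * ((i : ℤ) + j + 2) = 0 := by rw [← h1]; ring
      exact (mul_eq_zero.1 h2).resolve_right (by positivity)
  hp i j := by
    have hc : Commute (if r + s = 0 then (r : ℚ) • c else 0) (xPlus (r + (r + s) * j)) := by
      split_ifs
      · exact (commute_c _).smul_left _
      · exact Commute.zero_left _
    rw [hSeq, add_mul, mul_add (xPlus _), hc.eq, add_sub_add_right_eq_sub, h_mul_xPlus]
    congr 2
    push_cast
    ring
  hm i j := by
    have hc : Commute (if r + s = 0 then (r : ℚ) • c else 0) (xMinus (s + (r + s) * j)) := by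
      split_ifs
      · exact (commute_c _).smul_left _
      · exact Commute.zero_left _
    rw [hSeq, add_mul, mul_add (xMinus _), hc.eq, add_sub_add_right_eq_sub, h_mul_xMinus]
    congr 2
    push_cast
    ring
  pm i j := by
    rw [xPlus_mul_xMinus, hSeq]
    have h1 : r + (r + s) * (i : ℤ) + (s + (r + s) * j) = (r + s) * (((i + j : ℕ) : ℤ) + 1) := by
      push_cast; ring
    rw [h1]
    congr 1
    rcases eq_or_ne (r + s) 0 with h0 | h0
    · simp [h0]
    · rw [if_neg h0, if_neg]
      exact mul_ne_zero h0 (by positivity)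

theorem unit_mul_ne_zero (ε : ℤˣ) (i j : ℕ) : (ε : ℤ) * (i + 1) + (ε : ℤ) * (j + 1) ≠ 0 := by
  rw [← mul_add]
  exact mul_ne_zero ε.ne_zero (by positivity)

theorem hHat_eq_newtonE (ε : ℤˣ) (k : ℕ) :
    hHat ε k = newtonE (fun i : ℕ => h ((ε : ℤ) * (i + 1))) k := by
  have h0 : coeff 0 (hSeries ε) = 0 := by simp [hSeries]
  have h1 : dSeries (hSeries ε) = altSeries fun i : ℕ => h ((ε : ℤ) * (i + 1)) := by
    ext n
    rw [coeff_dSeries, hSeries, coeff_mk, altSeries, coeff_mk, if_neg (by omega), smul_smul]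
    push_cast
    congr 1
    field_simp
  have h2 : Commute (hSeries ε) (dSeries (hSeries ε)) := by
    rw [h1]
    refine commute_of_coeff fun i j => ?_
    rw [hSeries, coeff_mk, altSeries, coeff_mk]
    split_ifs with hi
    · exact Commute.zero_left _
    · refine commute_smul_both (commute_h ?_) _ _
      have := unit_mul_ne_zero ε (i - 1) j
      rwa [Nat.cast_sub (by omega), Nat.cast_one, sub_add_cancel] at this
  have h3 := dSeries_expSeries h0 h2
  rw [h1] at h3
  rw [hHat, eq_newtonSeries h3 (by simp [expSeries]), newtonSeries, coeff_mk]

theorem hHat_eq_newtonE_hSeq (ε : ℤˣ) (r : ℤ) (k : ℕ) : hHat ε k = newtonE (hSeq ε r) k := by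
  rw [hHat_eq_newtonE, hSeq_of_ne_zero ε.ne_zero]

theorem hHat_zero (ε : ℤˣ) : hHat ε 0 = 1 := by rw [hHat_eq_newtonE, newtonE_zero]

theorem hHat_mem (ε : ℤˣ) (k : ℕ) : hHat ε k ∈ UZZeroSign ε := by
  cases k with
  | zero => rw [hHat_zero]; exact one_mem _
  | succ k => exact Algebra.subset_adjoin ⟨⟨k + 1, k.succ_pos⟩, rfl⟩

theorem commute_hHat (ε : ℤˣ) (i j : ℕ) : Commute (hHat ε i) (hHat ε j) := by
  rw [hHat_eq_newtonE, hHat_eq_newtonE]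
  exact commute_newtonE (fun a => (commute_newtonE (fun b => commute_h
    (unit_mul_ne_zero ε b a)) _).symm) _

theorem binom_mem_UZZeroZero (m n : ℤ) (k : ℕ) : binom (m • h 0 + n • c) k ∈ UZZeroZero := by
  refine Algebra.subset_adjoin ⟨_, ?_, k, rfl⟩
  refine add_mem (Submodule.smul_mem _ _ (Submodule.subset_span ⟨0, rfl⟩))
    (Submodule.smul_mem _ _ (Submodule.subset_span ⟨1, rfl⟩))

theorem UZZeroSign_one_le : UZZeroSign 1 ≤ UZZero := le_sup_right

theorem UZZeroZero_le : UZZeroZero ≤ UZZero := le_sup_right.trans le_sup_left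

theorem UZZeroSign_neg_one_le : UZZeroSign (-1) ≤ UZZero := le_sup_left.trans le_sup_left

theorem UZZeroSign_le (ε : ℤˣ) : UZZeroSign ε ≤ UZZero := by
  rcases Int.units_eq_one_or ε with rfl | rfl
  · exact UZZeroSign_one_le
  · exact UZZeroSign_neg_one_le

theorem newtonE_hSeq_mem_sign (ε : ℤˣ) {N : ℕ} (hN : 0 < N) (r : ℤ) (k : ℕ) :
    newtonE (hSeq (ε * N) r) k ∈ UZZeroSign ε := by
  have h1 := newtonE_plethysm_mem (p := fun i : ℕ => h ((ε : ℤ) * (i + 1)))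
    (fun i j => commute_h (unit_mul_ne_zero ε i j)) hN k
  have h2 : hSeq (ε * N) r =
      fun i : ℕ => h ((ε : ℤ) * (((N * (i + 1) - 1 : ℕ) : ℤ) + 1)) := by
    rw [hSeq_of_ne_zero (mul_ne_zero ε.ne_zero (by omega))]
    ext i
    have : 0 < N * (i + 1) := by positivity
    rw [Nat.cast_sub (by omega)]
    push_cast
    congr 1
    ring
  rw [h2]
  refine Algebra.adjoin_le ?_ h1
  rintro _ ⟨j, rfl⟩
  simp only
  rw [← hHat_eq_newtonE]
  exact hHat_mem ε _

/-- The sign of n decides which part of the Cartan subalgebra receives the coefficients: plethysm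
for n ≠ 0, binomials of h₀ + r c for n = 0. -/
theorem newtonE_hSeq_mem (n r : ℤ) (k : ℕ) : newtonE (hSeq n r) k ∈ UZZero := by
  rcases lt_trichotomy n 0 with hn | rfl | hn
  · have := newtonE_hSeq_mem_sign (-1) (N := n.natAbs) (by omega) r k
    rw [show (n.natAbs : ℤ) = -n by omega, Units.val_neg, Units.val_one, neg_one_mul,
      neg_neg] at this
    exact UZZeroSign_le _ this
  · rw [hSeq_zero, ← binom_eq_newtonE]
    have := binom_mem_UZZeroZero 1 r k
    rw [one_smul, ← rat_smul_intCast] at this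
    exact UZZeroZero_le this
  · have := newtonE_hSeq_mem_sign 1 (N := n.natAbs) (by omega) r k
    rw [show (n.natAbs : ℤ) = n by omega, Units.val_one, one_mul] at this
    exact UZZeroSign_le _ this

theorem divPow_xPlus_mem (r : ℤ) (k : ℕ) : divPow (xPlus r) k ∈ UZPlus :=
  Algebra.subset_adjoin ⟨_, Submodule.subset_span ⟨r, rfl⟩, k, rfl⟩

theorem divPow_xMinus_mem (r : ℤ) (k : ℕ) : divPow (xMinus r) k ∈ UZMinus :=
  Algebra.subset_adjoin ⟨_, Submodule.subset_span ⟨r, rfl⟩, k, rfl⟩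

theorem C_divPow {A : Type*} [Ring A] [Algebra ℚ A] (a : A) (k : ℕ) :
    C (divPow a k) = divPow (C a) k := by
  ext n
  rw [divPow, divPow, ← map_pow, coeff_rat_smul, coeff_C, coeff_C]
  split_ifs <;> simp

theorem semiconjBy_divPow {A : Type*} [Ring A] [Algebra ℚ A] {a x y : A} (h : a * x = y * a)
    (k : ℕ) : a * divPow x k = divPow y k * a := by
  have : SemiconjBy a x y := h
  rw [divPow, divPow, mul_smul_comm, smul_mul_assoc, (this.pow_right k).eq]

/-- Moving `ĥ_{ε k}` to the left past a divided power of `x_r^+`. -/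
theorem divPow_xPlus_mul_hHat (ε : ℤˣ) (r : ℤ) (m k : ℕ) : ∃ z : ℕ → U, (∀ i, z i ∈ UZPlus) ∧
    divPow (xPlus r) m * hHat ε k = ∑ p ∈ antidiagonal k, hHat ε p.1 * z p.2 := by
  -- The second index is chosen so that the step is ε, whose Newton elements are the ĥ_{ε k}
  -- themselves.
  have T := loopTriple r (ε - r)
  have h1 : r + ((ε : ℤ) - r) = ε := by ring
  rw [h1] at T
  have h2 := T.C_mul_newtonSeries
  have h3 := (semiconjBy_divPow h2.symm m)
  refine ⟨fun i => coeff i (divPow (altSeries₂ fun i : ℕ => xPlus (r + ε * i)) m), fun i =>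
    coeff_divPow_altSeries₂_mem (fun _ _ => commute_xPlus _ _) (fun i j _ =>
      divPow_xPlus_mem _ _) i, ?_⟩
  have h4 := congrArg (coeff k) h3
  rw [← C_divPow, coeff_C_mul, coeff_mul] at h4
  simpa [newtonSeries, ← hHat_eq_newtonE_hSeq] using h4.symm

/-- Moving `ĥ_{ε k}` to the right past a divided power of `x_r^-`. -/
theorem hHat_mul_divPow_xMinus (ε : ℤˣ) (r : ℤ) (m k : ℕ) : ∃ z : ℕ → U, (∀ i, z i ∈ UZMinus) ∧
    hHat ε k * divPow (xMinus r) m = ∑ p ∈ antidiagonal k, z p.1 * hHat ε p.2 := by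
  have T := loopTriple (ε - r) r
  have h1 : (ε : ℤ) - r + r = ε := by ring
  rw [h1] at T
  have h2 := T.newtonSeries_mul_C
  have h3 := (semiconjBy_divPow h2 m)
  refine ⟨fun i => coeff i (divPow (altSeries₂ fun i : ℕ => xMinus (r + ε * i)) m), fun i =>
    coeff_divPow_altSeries₂_mem (fun _ _ => commute_xMinus _ _) (fun i j _ =>
      divPow_xMinus_mem _ _) i, ?_⟩
  have h4 := congrArg (coeff k) h3
  rw [← C_divPow, coeff_mul_C, coeff_mul] at h4
  simpa [newtonSeries, ← hHat_eq_newtonE_hSeq] using h4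

theorem newtonE_semiconj {A : Type*} [Ring A] [Algebra ℚ A] {t : A} {a b : ℕ → A}
    (h : ∀ i, t * a i = b i * t) (n : ℕ) : t * newtonE a n = newtonE b n * t := by
  induction n using Nat.strong_induction_on with
  | _ n ih =>
    cases n with
    | zero => simp [newtonE_zero]
    | succ n =>
      have h1 : ((n : ℚ) + 1) • (t * newtonE a (n + 1)) =
          ((n : ℚ) + 1) • (newtonE b (n + 1) * t) := by
        rw [← mul_smul_comm, newtonE_succ, ← smul_mul_assoc, newtonE_succ, mul_sum, sum_mul]
        refine sum_congr rfl fun p hp => ?_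
        have := mem_antidiagonal.1 hp
        rw [mul_smul_comm, smul_mul_assoc, ← mul_assoc, h, mul_assoc, ih _ (by omega), mul_assoc]
      exact smul_right_injective A (by positivity : ((n : ℚ) + 1) ≠ 0) h1

/-- Newton elements are homogeneous, the i-th power sum having weight i + 1. With t = -w and the
constant sequence -2c this turns the central correction into the coefficients of (1 - uv)^{-2c}. -/
theorem newtonE_scale {A : Type*} [Ring A] [Algebra ℚ A] {t : A} (a : ℕ → A)
    (ht : ∀ x, Commute t x) (n : ℕ) :
    newtonE (fun i => t ^ (i + 1) * a i) n = t ^ n * newtonE a n := by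
  symm
  refine newtonE_eq_of_recursion (e := fun n => t ^ n * newtonE a n) (by simp [newtonE_zero])
    (fun n => ?_) n
  rw [← mul_smul_comm, newtonE_succ, mul_sum]
  refine sum_congr rfl fun p hp => ?_
  have := mem_antidiagonal.1 hp
  rw [mul_smul_comm]
  congr 1
  rw [show n + 1 = p.1 + 1 + p.2 by omega, pow_add _ (p.1 + 1), mul_assoc, mul_assoc,
    ← mul_assoc _ (a p.1), ((ht (a p.1)).pow_left p.2).eq, mul_assoc]

theorem C_rat_smul {A : Type*} [Ring A] [Algebra ℚ A] (q : ℚ) (x : A) :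
    C (q • x) = q • C x := by
  ext n
  rw [coeff_rat_smul, coeff_C, coeff_C]
  split_ifs <;> simp

theorem coeff_neg_X_pow_mul {A : Type*} [Ring A] (f : PowerSeries A) (n k : ℕ) :
    coeff k ((-X) ^ n * f) = if n ≤ k then (-1 : ℤ) ^ n • coeff (k - n) f else 0 := by
  rw [neg_pow]
  rcases neg_one_pow_eq_or ℤ n with h1 | h1 <;>
    rcases Nat.even_or_odd n with h2 | h2 <;>
    simp only [h2.neg_one_pow, one_mul, neg_mul, map_neg, one_smul, neg_smul,
      coeff_X_pow_mul'] <;> split_ifs <;> simp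

theorem newtonE_C {A : Type*} [Ring A] [Algebra ℚ A] (a : ℕ → A) (n : ℕ) :
    newtonE (fun i => C (a i)) n = C (newtonE a n) := by
  symm
  refine newtonE_eq_of_recursion (e := fun n => C (newtonE a n)) (by simp [newtonE_zero])
    (fun n => ?_) n
  rw [← C_rat_smul, newtonE_succ, map_sum]
  exact sum_congr rfl fun p _ => by rw [C_rat_smul, map_mul]

/-- The generating series of the `ĥ_k` intertwines `h_{-(i + 1)}` with its translate by a central
element. -/
theorem newtonSeries_mul_C_h (i : ℕ) :
    newtonSeries (hSeq 1 0) * C (h (-((i : ℤ) + 1))) =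
      (C (h (-((i : ℤ) + 1))) + (-X) ^ (i + 1) * C ((-2 : ℚ) • c)) * newtonSeries (hSeq 1 0) := by
  set y := h (-((i : ℤ) + 1)) with hy
  set β : PowerSeries U := (-X) ^ (i + 1) * C ((-2 : ℚ) • c) with hβ
  have hβm : β = monomial (i + 1) ((2 * (-1 : ℚ) ^ i) • c) := by
    ext n
    rw [hβ, coeff_neg_X_pow_mul, coeff_monomial, coeff_C]
    by_cases hn : n = i + 1
    · subst hn
      rw [if_pos le_rfl, Nat.sub_self, if_pos rfl, if_pos rfl, ← rat_smul_intCast, smul_smul]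
      congr 1
      push_cast
      ring
    · rw [if_neg hn]
      split_ifs
      · omega
      · simp
      · rfl
  apply eq_of_dSeries_eq_mul (L := altSeries (hSeq 1 0))
  · rw [dSeries_mul, dSeries_C, mul_zero, add_zero, dSeries_newtonSeries, mul_assoc]
  · have h1 : altSeries (hSeq 1 0) * C y - C y * altSeries (hSeq 1 0) = dSeries β := by
      ext n
      rw [hβm, coeff_dSeries, coeff_monomial, map_sub, coeff_mul_C, coeff_C_mul, altSeries,
        coeff_mk, smul_mul_assoc, mul_smul_comm, ← smul_sub, hSeq_of_ne_zero one_ne_zero, hy,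
        h_mul_h]
      by_cases hn : n = i
      · subst hn
        rw [if_pos (by ring), if_pos rfl, smul_smul, smul_smul]
        congr 1
        push_cast
        ring
      · rw [if_neg (by omega), if_neg (by omega), smul_zero, smul_zero]
    have h2 : Commute β (altSeries (hSeq 1 0)) := commute_of_coeff fun a b => by
      rw [hβm, coeff_monomial]
      split_ifs
      · exact (commute_c _).smul_left _
      · exact Commute.zero_left _
    rw [dSeries_mul, map_add, dSeries_C, zero_add, dSeries_newtonSeries, ← h1, ← mul_assoc,
      ← add_mul, add_mul (C y), h2.eq]
    noncomm_ring
  · simp [newtonSeries, newtonE_zero, hβm, coeff_mul, coeff_monomial]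

/-- Moving `ĥ_k` to the right past `ĥ_{-l}`. -/
theorem hHat_mul_hHat_neg (k l : ℕ) : hHat 1 k * hHat (-1) l =
    ∑ p ∈ antidiagonal l, hHat (-1) p.1 *
      if p.2 ≤ k then (-1 : ℤ) ^ p.2 • binom ((-2 : ℚ) • c) p.2 * hHat 1 (k - p.2) else 0 := by
  have h1 := newtonE_semiconj (fun i => newtonSeries_mul_C_h i) l
  have h2 : ∀ i j : ℕ, Commute (C (h (-((i : ℤ) + 1))))
      ((-X : PowerSeries U) ^ (j + 1) * C ((-2 : ℚ) • c)) := fun i j =>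
    (((commute_X (C (h (-((i : ℤ) + 1))))).neg_right).pow_right _).mul_right
      (commute_of_coeff fun a b => by
        rw [coeff_C, coeff_C]
        split_ifs
        · exact ((commute_c _).symm.smul_right _)
        all_goals simp)
  have h3 := congrArg (coeff l) (newtonSeries_add h2)
  rw [newtonSeries, coeff_mk, coeff_mul] at h3
  rw [h3, newtonE_C] at h1
  have h4 := congrArg (coeff k) h1
  have e1 : ∀ k, newtonE (hSeq 1 0) k = hHat 1 k := fun k => by
    simpa using (hHat_eq_newtonE_hSeq 1 0 k).symm
  have e2 : ∀ k, newtonE (fun i : ℕ => h (-((i : ℤ) + 1))) k = hHat (-1) k := fun k => by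
    simpa using (hHat_eq_newtonE (-1) k).symm
  rw [coeff_mul_C, e2, newtonSeries, coeff_mk, e1] at h4
  rw [h4, sum_mul, map_sum]
  refine sum_congr rfl fun p _ => ?_
  rw [newtonSeries, coeff_mk, newtonSeries, coeff_mk, newtonE_C, e2,
    newtonE_scale (t := (-X : PowerSeries U)) _ (fun x => (commute_X x).symm.neg_left), newtonE_C,
    mul_assoc, coeff_C_mul,
    ← binom_eq_newtonE, mul_assoc, coeff_neg_X_pow_mul]
  congr 1
  split_ifs
  · rw [coeff_C_mul, coeff_mk, e1, smul_mul_assoc]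
  · rfl

end Relations

/-! ### Exchanging the order of products of submodules, checked on generators. -/

section ProductsOfSubalgebras

variable {A : Type*} [Ring A]

theorem subalgebra_mul_self (S : Subalgebra ℤ A) :
    Subalgebra.toSubmodule S * Subalgebra.toSubmodule S = Subalgebra.toSubmodule S :=
  S.isIdempotentElem_toSubmodule

theorem mul_mem_mul_toSubmodule {S T : Subalgebra ℤ A} {a b : A} (ha : a ∈ S) (hb : b ∈ T) :
    a * b ∈ Subalgebra.toSubmodule S * Subalgebra.toSubmodule T :=
  Submodule.mul_mem_mul ha hb

theorem mul_mem_mul_toSubmodule₃ {S T R : Subalgebra ℤ A} {a b d : A} (ha : a ∈ S) (hb : b ∈ T)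
    (hd : d ∈ R) : a * b * d ∈
      Subalgebra.toSubmodule S * Subalgebra.toSubmodule T * Subalgebra.toSubmodule R :=
  Submodule.mul_mem_mul (mul_mem_mul_toSubmodule ha hb) hd

/-- The generators are absorbed one after another; the part pushed to the left accumulates in K,
which is closed under multiplication. Here V need not be an algebra, so it can be the span of the
ĥ_k, which is what the exchange formulas preserve. -/
theorem mul_adjoin_le {V K : Submodule ℤ A} {s : Set A} (hK : K * K ≤ K) (h1 : (1 : A) ∈ K)
    (h : ∀ y ∈ s, ∀ v ∈ V, v * y ∈ K * V) :
    V * Subalgebra.toSubmodule (Algebra.adjoin ℤ s) ≤ K * V := by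
  rw [Submodule.mul_le]
  intro v hv y hy
  induction hy using Algebra.adjoin_induction generalizing v with
  | mem y hy => exact h y hy v hv
  | algebraMap r =>
    rw [← Algebra.commutes]
    have := Submodule.mul_mem_mul (K.smul_mem r h1) hv
    rwa [← Algebra.algebraMap_eq_smul_one] at this
  | add x y _ _ hx hy =>
    rw [mul_add]
    exact add_mem (hx v hv) (hy v hv)
  | mul x y _ _ hx hy =>
    rw [← mul_assoc]
    have h2 : ∀ w ∈ K * V, w * y ∈ K * V := fun w hw => by
      refine Submodule.mul_induction_on hw (fun k hk v hv => ?_) (fun a b ha hb => ?_)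
      · have h3 := Submodule.mul_mem_mul hk (hy v hv)
        rw [← mul_assoc, ← mul_assoc] at h3
        exact mul_le_mul_left hK V h3
      · rw [add_mul]
        exact add_mem ha hb
    exact h2 _ (hx v hv)

theorem adjoin_mul_le {K : Submodule ℤ A} {s : Set A}
    (h : ∀ z ∈ s, ∀ k ∈ K, z * k ∈ K * Subalgebra.toSubmodule (Algebra.adjoin ℤ s)) :
    Subalgebra.toSubmodule (Algebra.adjoin ℤ s) * K ≤
      K * Subalgebra.toSubmodule (Algebra.adjoin ℤ s) := by
  rw [Submodule.mul_le]
  intro z hz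
  induction hz using Algebra.adjoin_induction with
  | mem z hz => exact h z hz
  | algebraMap r =>
    intro k hk
    rw [Algebra.commutes]
    exact Submodule.mul_mem_mul hk (Subalgebra.algebraMap_mem _ r)
  | add x y _ _ hx hy =>
    intro k hk
    rw [add_mul]
    exact add_mem (hx k hk) (hy k hk)
  | mul x y _ _ hx hy =>
    intro k hk
    rw [mul_assoc]
    have h2 : ∀ w ∈ K * Subalgebra.toSubmodule (Algebra.adjoin ℤ s),
        x * w ∈ K * Subalgebra.toSubmodule (Algebra.adjoin ℤ s) := fun w hw => by
      refine Submodule.mul_induction_on hw (fun k hk a ha => ?_) (fun a b ha hb => ?_)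
      · have h3 := Submodule.mul_mem_mul (hx k hk) ha
        rwa [mul_assoc, subalgebra_mul_self, mul_assoc] at h3
      · rw [mul_add]
        exact add_mem ha hb
    exact h2 _ (hy k hk)

end ProductsOfSubalgebras

/-! ### Triangular decompositions over ℤ. -/

section Triangular

open PowerSeries Finset

theorem UZPlus_eq_adjoin : UZPlus = Algebra.adjoin ℤ {y | ∃ i k, y = divPow (xPlus i) k} :=
  divSubalgebra_eq_adjoin commute_xPlus

theorem UZMinus_eq_adjoin : UZMinus = Algebra.adjoin ℤ {y | ∃ i k, y = divPow (xMinus i) k} :=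
  divSubalgebra_eq_adjoin commute_xMinus

/-- The `ℤ`-module spanned by the `ĥ_{ε k}`. -/
noncomputable def hHatSpan (ε : ℤˣ) : Submodule ℤ U := Submodule.span ℤ (Set.range (hHat ε))

theorem hHatSpan_le (ε : ℤˣ) : hHatSpan ε ≤ Subalgebra.toSubmodule (UZZeroSign ε) := by
  rw [hHatSpan, Submodule.span_le]
  rintro _ ⟨k, rfl⟩
  exact hHat_mem ε k

theorem span_mul_mem_iff {A : Type*} [Ring A] {s : Set A} {y : A} {K : Submodule ℤ A}
    (h : ∀ v ∈ s, v * y ∈ K) : ∀ v ∈ Submodule.span ℤ s, v * y ∈ K := fun v hv => by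
  induction hv using Submodule.span_induction with
  | mem v hv => exact h v hv
  | zero => simp
  | add a b _ _ ha hb => rw [add_mul]; exact add_mem ha hb
  | smul z a _ ha => rw [smul_mul_assoc]; exact K.smul_mem z ha

theorem mul_span_mem_iff {A : Type*} [Ring A] {s : Set A} {y : A} {K : Submodule ℤ A}
    (h : ∀ v ∈ s, y * v ∈ K) : ∀ v ∈ Submodule.span ℤ s, y * v ∈ K := fun v hv => by
  induction hv using Submodule.span_induction with
  | mem v hv => exact h v hv
  | zero => simp
  | add a b _ _ ha hb => rw [mul_add]; exact add_mem ha hb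
  | smul z a _ ha => rw [mul_smul_comm]; exact K.smul_mem z ha

/-- The exchange formula turns a single ĥ_k into a combination of single ĥ_j, so the module they
span is the natural intermediate object: the exchange is extended first to all of `UZMinus`, and
afterwards to products of ĥ's. -/
theorem hHatSpan_mul_UZMinus (ε : ℤˣ) : hHatSpan ε * Subalgebra.toSubmodule UZMinus ≤
    Subalgebra.toSubmodule UZMinus * hHatSpan ε := by
  conv_lhs => rw [UZMinus_eq_adjoin]
  refine mul_adjoin_le (subalgebra_mul_self _).le (one_mem UZMinus) ?_
  rintro _ ⟨r, m, rfl⟩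
  refine span_mul_mem_iff ?_
  rintro _ ⟨k, rfl⟩
  obtain ⟨z, hz, h⟩ := hHat_mul_divPow_xMinus ε r m k
  rw [h]
  exact sum_mem fun p _ => Submodule.mul_mem_mul (hz _) (Submodule.subset_span ⟨_, rfl⟩)

theorem UZZeroSign_mul_UZMinus (ε : ℤˣ) :
    Subalgebra.toSubmodule (UZZeroSign ε) * Subalgebra.toSubmodule UZMinus ≤
      Subalgebra.toSubmodule UZMinus * Subalgebra.toSubmodule (UZZeroSign ε) := by
  refine adjoin_mul_le ?_
  rintro _ ⟨k, rfl⟩ m hm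
  have := hHatSpan_mul_UZMinus ε (Submodule.mul_mem_mul (Submodule.subset_span ⟨k, rfl⟩) hm)
  exact mul_le_mul_right (hHatSpan_le ε) _ this

theorem UZPlus_mul_hHatSpan (ε : ℤˣ) : Subalgebra.toSubmodule UZPlus * hHatSpan ε ≤
    hHatSpan ε * Subalgebra.toSubmodule UZPlus := by
  rw [UZPlus_eq_adjoin]
  refine adjoin_mul_le ?_
  rintro _ ⟨r, m, rfl⟩
  refine mul_span_mem_iff ?_
  rintro _ ⟨k, rfl⟩
  obtain ⟨z, hz, h⟩ := divPow_xPlus_mul_hHat ε r m k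
  rw [h, ← UZPlus_eq_adjoin]
  exact sum_mem fun p _ => Submodule.mul_mem_mul (Submodule.subset_span ⟨_, rfl⟩) (hz _)

theorem UZPlus_mul_UZZeroSign (ε : ℤˣ) :
    Subalgebra.toSubmodule UZPlus * Subalgebra.toSubmodule (UZZeroSign ε) ≤
      Subalgebra.toSubmodule (UZZeroSign ε) * Subalgebra.toSubmodule UZPlus := by
  refine mul_adjoin_le (subalgebra_mul_self _).le (one_mem (UZZeroSign ε)) ?_
  rintro _ ⟨k, rfl⟩ m hm
  have := UZPlus_mul_hHatSpan ε (Submodule.mul_mem_mul hm (Submodule.subset_span ⟨k, rfl⟩))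
  exact mul_le_mul_left (hHatSpan_le ε) _ this

theorem exists_of_mem_span_h_c {a : U} (ha : a ∈ Submodule.span ℤ (Set.range ![h 0, c])) :
    ∃ m n : ℤ, a = m • h 0 + n • c := by
  rw [Matrix.range_cons, Matrix.range_cons, Matrix.range_empty, Set.union_empty,
    Set.singleton_union, Submodule.mem_span_pair] at ha
  obtain ⟨m, n, rfl⟩ := ha
  exact ⟨m, n, rfl⟩

theorem commute_UZZeroZero_h {z : U} (hz : z ∈ UZZeroZero) (r : ℤ) : Commute z (h r) := by
  induction hz using Algebra.adjoin_induction with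
  | mem x hx =>
    obtain ⟨a, ha, k, rfl⟩ := hx
    obtain ⟨m, n, rfl⟩ := exists_of_mem_span_h_c ha
    exact commute_binom_left (((commute_h_zero r).smul_left m).add_left
      ((commute_c _).smul_left n)) k
  | algebraMap q => exact Algebra.commutes q _
  | add a b _ _ ha hb => exact ha.add_left hb
  | mul a b _ _ ha hb => exact ha.mul_left hb

theorem UZZeroZero_mul_UZZeroSign (ε : ℤˣ) :
    Subalgebra.toSubmodule UZZeroZero * Subalgebra.toSubmodule (UZZeroSign ε) =
      Subalgebra.toSubmodule (UZZeroSign ε) * Subalgebra.toSubmodule UZZeroZero := by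
  refine Submodule.mul_comm_of_commute fun z hz y hy => ?_
  change y ∈ UZZeroSign ε at hy
  induction hy using Algebra.adjoin_induction with
  | mem x hx =>
    obtain ⟨k, rfl⟩ := hx
    simp only [hHat_eq_newtonE]
    exact (commute_newtonE (fun i => (commute_UZZeroZero_h hz _).symm) _).symm
  | algebraMap q => exact (Algebra.commutes q _).symm
  | add a b _ _ ha hb => exact ha.add_right hb
  | mul a b _ _ ha hb => exact ha.mul_right hb

theorem UZZeroZero_binom_sub_mem (m n t : ℤ) (k : ℕ) :
    binom (m • h 0 + n • c + (t : U)) k ∈ UZZeroZero :=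
  binom_add_mem (Int.cast_commute t _).symm (binom_mem_UZZeroZero m n) (binom_intCast_mem _ t) k

theorem semiconjBy_binom {A : Type*} [Ring A] [Algebra ℚ A] {a x y : A} (h : a * x = y * a)
    (k : ℕ) : a * binom x k = binom y k * a := by
  rw [binom_eq_newtonE, binom_eq_newtonE]
  exact newtonE_semiconj (fun _ => h) k

theorem semiconj_divPow_of_commutator {A : Type*} [Ring A] [Algebra ℚ A] {a x : A} {t : ℤ}
    (h : a * x = x * (a + (t : A))) (k : ℕ) :
    a * divPow x k = divPow x k * (a + ((t * k : ℤ) : A)) := by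
  have h1 : a * x ^ k = x ^ k * (a + ((t * k : ℤ) : A)) := by
    induction k with
    | zero => simp
    | succ k ih =>
      rw [pow_succ, ← mul_assoc, ih, mul_assoc, add_mul, h, mul_assoc, Int.cast_comm, ← mul_add]
      push_cast
      noncomm_ring
  rw [divPow, mul_smul_comm, h1, smul_mul_assoc]

theorem h_zero_mul_divPow_xPlus (r : ℤ) (k : ℕ) : h 0 * divPow (xPlus r) k =
    divPow (xPlus r) k * (h 0 + ((2 * k : ℤ) : U)) := by
  refine semiconj_divPow_of_commutator ?_ k
  have := h_mul_xPlus 0 r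
  rw [zero_add, sub_eq_iff_eq_add] at this
  rw [this, mul_add, add_comm, Algebra.smul_def]
  congr 1
  rw [Algebra.commutes, map_ofNat, Int.cast_ofNat]

theorem h_zero_mul_divPow_xMinus (r : ℤ) (k : ℕ) : h 0 * divPow (xMinus r) k =
    divPow (xMinus r) k * (h 0 + ((-2 * k : ℤ) : U)) := by
  refine semiconj_divPow_of_commutator ?_ k
  have := h_mul_xMinus 0 r
  rw [zero_add, sub_eq_iff_eq_add] at this
  rw [this, mul_add, add_comm, Algebra.smul_def]
  congr 1
  rw [Algebra.commutes, map_neg, map_ofNat, Int.cast_neg, Int.cast_ofNat]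

theorem UZZeroZero_mul_UZMinus :
    Subalgebra.toSubmodule UZZeroZero * Subalgebra.toSubmodule UZMinus ≤
      Subalgebra.toSubmodule UZMinus * Subalgebra.toSubmodule UZZeroZero := by
  conv_lhs => rw [UZMinus_eq_adjoin]
  refine mul_adjoin_le (subalgebra_mul_self _).le (one_mem UZMinus) ?_
  rintro _ ⟨r, k, rfl⟩ z hz
  have key : ∃ z' ∈ UZZeroZero, z * divPow (xMinus r) k = divPow (xMinus r) k * z' := by
    change z ∈ UZZeroZero at hz
    induction hz using Algebra.adjoin_induction with
    | mem x hx =>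
      obtain ⟨a, ha, l, rfl⟩ := hx
      obtain ⟨m, n, rfl⟩ := exists_of_mem_span_h_c ha
      -- The weight of the divided power is -2k, so h₀ is shifted by -2k and its multiple m h₀ by
      -- m(-2k); c is unchanged.
      refine ⟨_, UZZeroZero_binom_sub_mem m n (m * (-2 * k)) l, ?_⟩
      refine (semiconjBy_binom ?_ l).symm
      rw [add_mul, mul_add, smul_mul_assoc, h_zero_mul_divPow_xMinus, smul_mul_assoc,
        (commute_c (divPow (xMinus r) k)).eq, mul_add, mul_add, smul_add, mul_smul_comm,
        mul_smul_comm, Int.cast_mul, ← zsmul_eq_mul, mul_smul_comm]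
      abel
    | algebraMap q => exact ⟨_, Subalgebra.algebraMap_mem _ q, Algebra.commutes q _⟩
    | add a b _ _ ha hb =>
      obtain ⟨a', ha, ha'⟩ := ha
      obtain ⟨b', hb, hb'⟩ := hb
      exact ⟨_, add_mem ha hb, by rw [add_mul, mul_add, ha', hb']⟩
    | mul a b _ _ ha hb =>
      obtain ⟨a', ha, ha'⟩ := ha
      obtain ⟨b', hb, hb'⟩ := hb
      exact ⟨_, mul_mem ha hb, by rw [mul_assoc, hb', ← mul_assoc, ha', mul_assoc]⟩
  obtain ⟨z', hz', h⟩ := key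
  rw [h]
  exact Submodule.mul_mem_mul (divPow_xMinus_mem r k) hz'

theorem UZPlus_mul_UZZeroZero :
    Subalgebra.toSubmodule UZPlus * Subalgebra.toSubmodule UZZeroZero ≤
      Subalgebra.toSubmodule UZZeroZero * Subalgebra.toSubmodule UZPlus := by
  rw [UZPlus_eq_adjoin]
  refine adjoin_mul_le ?_
  rintro _ ⟨r, k, rfl⟩ z hz
  rw [← UZPlus_eq_adjoin]
  have key : ∃ z' ∈ UZZeroZero, divPow (xPlus r) k * z = z' * divPow (xPlus r) k := by
    change z ∈ UZZeroZero at hz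
    induction hz using Algebra.adjoin_induction with
    | mem x hx =>
      obtain ⟨a, ha, l, rfl⟩ := hx
      obtain ⟨m, n, rfl⟩ := exists_of_mem_span_h_c ha
      refine ⟨_, UZZeroZero_binom_sub_mem m n (m * (-2 * k)) l, ?_⟩
      refine semiconjBy_binom ?_ l
      rw [add_mul, add_mul, mul_add, smul_mul_assoc, h_zero_mul_divPow_xPlus, smul_mul_assoc,
        (commute_c (divPow (xPlus r) k)).eq, mul_add, smul_add, mul_smul_comm,
        mul_smul_comm, Int.cast_comm]
      rw [Int.cast_mul m, ← zsmul_eq_mul, mul_smul_comm, neg_mul, Int.cast_neg, mul_neg, smul_neg]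
      abel
    | algebraMap q => exact ⟨_, Subalgebra.algebraMap_mem _ q, (Algebra.commutes q _).symm⟩
    | add a b _ _ ha hb =>
      obtain ⟨a', ha, ha'⟩ := ha
      obtain ⟨b', hb, hb'⟩ := hb
      exact ⟨_, add_mem ha hb, by rw [add_mul, mul_add, ha', hb']⟩
    | mul a b _ _ ha hb =>
      obtain ⟨a', ha, ha'⟩ := ha
      obtain ⟨b', hb, hb'⟩ := hb
      exact ⟨_, mul_mem ha hb, by rw [← mul_assoc, ha', mul_assoc, hb', mul_assoc]⟩
  obtain ⟨z', hz', h⟩ := key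
  rw [h]
  exact Submodule.mul_mem_mul hz' (divPow_xPlus_mem r k)


/-- The coefficients of (1 - uv)^{-2c} are integral binomials and lie in Z = `UZZeroZero`. As Z
commutes with both Heisenberg halves, N Z is closed under multiplication and serves as the
accumulating factor. -/
theorem UZZeroSign_one_mul_neg_one :
    Subalgebra.toSubmodule (UZZeroSign 1) * Subalgebra.toSubmodule (UZZeroSign (-1)) ≤
      Subalgebra.toSubmodule (UZZeroSign (-1)) * Subalgebra.toSubmodule UZZeroZero *
        Subalgebra.toSubmodule (UZZeroSign 1) := by
  have hZN := UZZeroZero_mul_UZZeroSign (-1)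
  have hZP := UZZeroZero_mul_UZZeroSign 1
  set N := Subalgebra.toSubmodule (UZZeroSign (-1)) with hN
  set Z := Subalgebra.toSubmodule UZZeroZero with hZ
  set P := Subalgebra.toSubmodule (UZZeroSign 1) with hP
  have hNN : N * N = N := subalgebra_mul_self _
  have hZZ : Z * Z = Z := subalgebra_mul_self _
  have hNZ1 : (1 : U) ∈ N * Z := by
    have := mul_mem_mul_toSubmodule (one_mem (UZZeroSign (-1))) (one_mem UZZeroZero)
    rwa [one_mul] at this
  have hK : N * Z * (N * Z) ≤ N * Z := by
    rw [mul_assoc, ← mul_assoc Z, hZN, mul_assoc N Z, hZZ, ← mul_assoc, hNN]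
  have hVZ : hHatSpan 1 * Z = Z * hHatSpan 1 := by
    refine (Submodule.mul_comm_of_commute fun z hz y hy => ?_).symm
    induction hy using Submodule.span_induction with
    | mem x hx =>
      obtain ⟨k, rfl⟩ := hx
      rw [hHat_eq_newtonE]
      exact (commute_newtonE (fun i => (commute_UZZeroZero_h hz _).symm) _).symm
    | zero => exact Commute.zero_right _
    | add a b _ _ ha hb => exact ha.add_right hb
    | smul q a _ ha => exact ha.smul_right q
  have h1 : hHatSpan 1 * N ≤ N * Z * hHatSpan 1 := by
    refine mul_adjoin_le hK hNZ1 ?_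
    rintro _ ⟨l, rfl⟩
    refine span_mul_mem_iff ?_
    rintro _ ⟨k, rfl⟩
    rw [hHat_mul_hHat_neg]
    refine sum_mem fun p _ => ?_
    split_ifs
    · rw [← mul_assoc]
      refine Submodule.mul_mem_mul (Submodule.mul_mem_mul (hHat_mem _ _)
        (Submodule.smul_mem _ _ ?_)) (Submodule.subset_span ⟨_, rfl⟩)
      have := binom_mem_UZZeroZero 0 (-2) p.2
      rw [zero_smul, zero_add, ← rat_smul_intCast] at this
      have h3 : ((-2 : ℤ) : ℚ) = -2 := by norm_num
      rwa [h3] at this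
    · rw [mul_zero]
      exact zero_mem _
  have h2 : P * (N * Z) ≤ N * Z * P := by
    refine adjoin_mul_le ?_
    rintro _ ⟨k, rfl⟩ y hy
    have h3 : hHatSpan 1 * (N * Z) ≤ N * Z * hHatSpan 1 := by
      calc hHatSpan 1 * (N * Z) = hHatSpan 1 * N * Z := (mul_assoc _ _ _).symm
        _ ≤ N * Z * hHatSpan 1 * Z := mul_le_mul_left h1 Z
        _ = N * (Z * Z) * hHatSpan 1 := by rw [mul_assoc, hVZ]; simp only [mul_assoc]
        _ = N * Z * hHatSpan 1 := by rw [hZZ]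
    exact mul_le_mul_right (hHatSpan_le 1) _
      (h3 (Submodule.mul_mem_mul (Submodule.subset_span ⟨_, rfl⟩) hy))
  calc P * N = P * (N * 1) := by rw [mul_one]
    _ ≤ P * (N * Z) := by
      gcongr
      exact Submodule.one_le.2 (one_mem UZZeroZero)
    _ ≤ N * Z * P := h2

/-- Triangular decomposition of `Û_ℤ^0`. -/
theorem UZZero_eq_mul : Subalgebra.toSubmodule UZZero =
    Subalgebra.toSubmodule (UZZeroSign (-1)) * Subalgebra.toSubmodule UZZeroZero *
      Subalgebra.toSubmodule (UZZeroSign 1) := by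
  have hZN := UZZeroZero_mul_UZZeroSign (-1)
  have hZP := UZZeroZero_mul_UZZeroSign 1
  have hPN := UZZeroSign_one_mul_neg_one
  have hN1 := one_mem (UZZeroSign (-1))
  have hZ1 := one_mem UZZeroZero
  have hP1 := one_mem (UZZeroSign 1)
  have hNN := subalgebra_mul_self (UZZeroSign (-1))
  have hZZ := subalgebra_mul_self UZZeroZero
  have hPP := subalgebra_mul_self (UZZeroSign 1)
  apply le_antisymm
  · have hle : UZZero ≤ Submodule.toSubalgebra
        (Subalgebra.toSubmodule (UZZeroSign (-1)) * Subalgebra.toSubmodule UZZeroZero *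
          Subalgebra.toSubmodule (UZZeroSign 1)) (by
        have := mul_mem_mul_toSubmodule₃ hN1 hZ1 hP1
        rwa [one_mul, one_mul] at this) (by
        intro x y hx hy
        have h1 := Submodule.mul_mem_mul hx hy
        revert h1
        apply SetLike.le_def.1
        set N := Subalgebra.toSubmodule (UZZeroSign (-1)) with hN
        set Z := Subalgebra.toSubmodule UZZeroZero with hZ
        set P := Subalgebra.toSubmodule (UZZeroSign 1) with hP
        calc N * Z * P * (N * Z * P) = N * Z * (P * N) * (Z * P) := by simp only [mul_assoc]
          _ ≤ N * Z * (N * Z * P) * (Z * P) := by gcongr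
          _ = N * (Z * N) * Z * (P * Z) * P := by simp only [mul_assoc]
          _ = (N * N) * (Z * Z) * Z * (P * P) := by rw [hZN, ← hZP]; simp only [mul_assoc]
          _ = N * Z * P := by rw [hNN, hZZ, mul_assoc N, hZZ, hPP]) := by
      refine sup_le (sup_le ?_ ?_) ?_
      · intro x hx
        have := mul_mem_mul_toSubmodule₃ hx hZ1 hP1
        rwa [mul_one, mul_one] at this
      · intro x hx
        have := mul_mem_mul_toSubmodule₃ hN1 hx hP1
        rwa [one_mul, mul_one] at this
      · intro x hx
        have := mul_mem_mul_toSubmodule₃ hN1 hZ1 hx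
        rwa [one_mul, one_mul] at this
    exact hle
  · rw [Submodule.mul_le]
    intro a ha b hb
    refine UZZero.mul_mem ((?_ : _ ≤ Subalgebra.toSubmodule UZZero) ha) (UZZeroSign_one_le hb)
    rw [Submodule.mul_le]
    intro a ha b hb
    exact UZZero.mul_mem (UZZeroSign_neg_one_le ha) (UZZeroZero_le hb)

theorem UZZero_mul_UZMinus : Subalgebra.toSubmodule UZZero * Subalgebra.toSubmodule UZMinus ≤
    Subalgebra.toSubmodule UZMinus * Subalgebra.toSubmodule UZZero := by
  have h1 := UZZeroSign_mul_UZMinus (-1)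
  have h2 := UZZeroZero_mul_UZMinus
  have h3 := UZZeroSign_mul_UZMinus 1
  rw [UZZero_eq_mul]
  set N := Subalgebra.toSubmodule (UZZeroSign (-1))
  set Z := Subalgebra.toSubmodule UZZeroZero
  set P := Subalgebra.toSubmodule (UZZeroSign 1)
  set M := Subalgebra.toSubmodule UZMinus
  calc N * Z * P * M = N * Z * (P * M) := mul_assoc _ _ _
    _ ≤ N * Z * (M * P) := by gcongr
    _ = N * (Z * M) * P := by simp only [mul_assoc]
    _ ≤ N * (M * Z) * P := by gcongr
    _ = N * M * Z * P := by simp only [mul_assoc]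
    _ ≤ M * N * Z * P := by gcongr
    _ = M * (N * Z * P) := by simp only [mul_assoc]

theorem UZPlus_mul_UZZero : Subalgebra.toSubmodule UZPlus * Subalgebra.toSubmodule UZZero ≤
    Subalgebra.toSubmodule UZZero * Subalgebra.toSubmodule UZPlus := by
  have h1 := UZPlus_mul_UZZeroSign (-1)
  have h2 := UZPlus_mul_UZZeroZero
  have h3 := UZPlus_mul_UZZeroSign 1
  rw [UZZero_eq_mul]
  set N := Subalgebra.toSubmodule (UZZeroSign (-1))
  set Z := Subalgebra.toSubmodule UZZeroZero
  set P := Subalgebra.toSubmodule (UZZeroSign 1)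
  set X := Subalgebra.toSubmodule UZPlus
  calc X * (N * Z * P) = X * N * Z * P := by simp only [mul_assoc]
    _ ≤ N * X * Z * P := by gcongr
    _ = N * (X * Z) * P := by simp only [mul_assoc]
    _ ≤ N * (Z * X) * P := by gcongr
    _ = N * Z * (X * P) := by simp only [mul_assoc]
    _ ≤ N * Z * (P * X) := by gcongr
    _ = N * Z * P * X := by simp only [mul_assoc]

/-- The product `Û_ℤ^- Û_ℤ^0 Û_ℤ^+`. -/
noncomputable def triangular : Submodule ℤ U :=
  Subalgebra.toSubmodule UZMinus * Subalgebra.toSubmodule UZZero * Subalgebra.toSubmodule UZPlus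

/-- The left stabilizer of a submodule. -/
def leftStabilizer (S : Submodule ℤ U) : Subalgebra ℤ U where
  carrier := {z | ∀ s ∈ S, z * s ∈ S}
  mul_mem' {a b} ha hb s hs := by rw [mul_assoc]; exact ha _ (hb s hs)
  add_mem' {a b} ha hb s hs := by rw [add_mul]; exact S.add_mem (ha s hs) (hb s hs)
  algebraMap_mem' r s hs := by
    rw [← Algebra.smul_def]
    exact S.smul_mem r hs

/-- The triangular product is stable under right multiplication by U⁰ U⁺, so only the leftmost
factor has to be tested. -/
theorem mem_leftStabilizer_of_forall_UZMinus {z : U} (h : ∀ m ∈ UZMinus, z * m ∈ triangular) :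
    z ∈ leftStabilizer triangular := by
  have hT : triangular * (Subalgebra.toSubmodule UZZero * Subalgebra.toSubmodule UZPlus) ≤
      triangular := by
    have h1 := UZPlus_mul_UZZero
    have h2 := subalgebra_mul_self UZZero
    have h3 := subalgebra_mul_self UZPlus
    unfold triangular
    set M := Subalgebra.toSubmodule UZMinus
    set H := Subalgebra.toSubmodule UZZero
    set X := Subalgebra.toSubmodule UZPlus
    calc M * H * X * (H * X) = M * H * (X * H) * X := by simp only [mul_assoc]
      _ ≤ M * H * (H * X) * X := by gcongr
      _ = M * (H * H) * (X * X) := by simp only [mul_assoc]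
      _ = M * H * X := by rw [h2, h3]
  intro s hs
  have hs' : s ∈ Subalgebra.toSubmodule UZMinus *
      (Subalgebra.toSubmodule UZZero * Subalgebra.toSubmodule UZPlus) := by
    rwa [← mul_assoc]
  refine Submodule.mul_induction_on hs' (fun m hm n hn => ?_) (fun a b ha hb => ?_)
  · rw [← mul_assoc]
    exact hT (Submodule.mul_mem_mul (h m hm) hn)
  · rw [mul_add]
    exact add_mem ha hb

theorem UZMinus_le_leftStabilizer : UZMinus ≤ leftStabilizer triangular := fun z hz s hs => by
  have := Submodule.mul_mem_mul (show z ∈ Subalgebra.toSubmodule UZMinus from hz) hs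
  rwa [triangular, mul_assoc, ← mul_assoc (Subalgebra.toSubmodule UZMinus), subalgebra_mul_self,
    ← mul_assoc] at this

theorem mem_triangular {m y x : U} (hm : m ∈ UZMinus) (hy : y ∈ UZZero) (hx : x ∈ UZPlus) :
    m * y * x ∈ triangular :=
  Submodule.mul_mem_mul (Submodule.mul_mem_mul hm hy) hx

theorem UZZero_le_leftStabilizer : UZZero ≤ leftStabilizer triangular := fun z hz =>
  mem_leftStabilizer_of_forall_UZMinus (fun m hm => by
    have h1 := UZZero_mul_UZMinus (mul_mem_mul_toSubmodule hz hm)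
    have h2 := Submodule.mul_mem_mul h1 (show (1 : U) ∈ Subalgebra.toSubmodule UZPlus from
      one_mem UZPlus)
    rwa [mul_one] at h2)

theorem coeff_zero_mul' {A : Type*} [Ring A] (f g : PowerSeries A) :
    coeff 0 (f * g) = coeff 0 f * coeff 0 g := by
  simp [coeff_mul]

theorem coeff_zero_divPow_altSeries {A : Type*} [Ring A] [Algebra ℚ A] (a : ℕ → A) (k : ℕ) :
    coeff 0 (divPow (altSeries a) k) = divPow (a 0) k := by
  rw [divPow, coeff_rat_smul, coeff_zero_eq_constantCoeff_apply, map_pow,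
    ← coeff_zero_eq_constantCoeff_apply]
  simp [altSeries, divPow]

/-- Strong induction on the exponent k. Straightening b = (x_r⁺)^(k) against (x_s⁻)^(l) gives
(x_s⁻)^(l) b plus terms whose positive factors have exponent below k and stabilize by induction. The
claim `key` carries the assumption b t ∈ `triangular` so that it can be iterated over a product of
negative generators. -/
theorem divPow_xPlus_mem_leftStabilizer (k : ℕ) :
    ∀ r, divPow (xPlus r) k ∈ leftStabilizer triangular := by
  induction k using Nat.strong_induction_on with
  | _ k ih =>
    intro r
    set b := divPow (xPlus r) k with hb
    have key : ∀ m ∈ UZMinus, ∀ t ∈ triangular, b * t ∈ triangular →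
        b * (m * t) ∈ triangular := by
      intro m hm
      rw [UZMinus_eq_adjoin] at hm
      induction hm using Algebra.adjoin_induction with
      | mem m hm =>
        obtain ⟨s, l, rfl⟩ := hm
        intro t ht hbt
        have hT := (loopTriple r s).divPow_mul_divPow k l
        simp only [Nat.cast_zero, mul_zero, add_zero] at hT
        rw [← mul_assoc, hb, hT, sum_range_succ', add_mul]
        refine add_mem ?_ ?_
        · rw [sum_mul]
          refine sum_mem fun n hn => ?_
          have hn := mem_range.1 hn
          have h1 : ∀ i, coeff i (divPow (altSeries fun i : ℕ => xMinus (s + (r + s) * i))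
              (l - (n + 1))) ∈ leftStabilizer triangular := fun i =>
            UZMinus_le_leftStabilizer (coeff_divPow_altSeries_mem
              (fun _ _ => commute_xMinus _ _) (fun _ _ _ => divPow_xMinus_mem _ _) i)
          have h2 : ∀ i, coeff i (newtonSeries (hSeq (r + s) r)) ∈ leftStabilizer triangular :=
            fun i => by
              rw [newtonSeries, coeff_mk]
              exact UZZero_le_leftStabilizer (newtonE_hSeq_mem _ _ _)
          -- The positive factor involves divided powers of many x⁺'s, but all of exponent at most k
          -- - (n + 1), which is less than k; the induction hypothesis covers all indices r.
          have h3 : ∀ i, coeff i (divPow (altSeries fun i : ℕ => xPlus (r + (r + s) * i))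
              (k - (n + 1))) ∈ leftStabilizer triangular :=
            coeff_divPow_altSeries_mem (fun _ _ => commute_xPlus _ _)
              (fun i j hj => ih j (by omega) _)
          exact coeff_mul_mem (coeff_mul_mem h1 h2) h3 (n + 1) t ht
        · have h1 : coeff 0 (divPow (altSeries fun i : ℕ => xMinus (s + (r + s) * i)) (l - 0) *
              newtonSeries (hSeq (r + s) r) *
              divPow (altSeries fun i : ℕ => xPlus (r + (r + s) * i)) (k - 0)) =
              divPow (xMinus s) l * b := by
            rw [coeff_zero_mul', coeff_zero_mul', coeff_zero_divPow_altSeries,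
              coeff_zero_divPow_altSeries]
            simp [newtonSeries, newtonE_zero, hb]
          rw [h1, mul_assoc]
          exact UZMinus_le_leftStabilizer (divPow_xMinus_mem s l) _ hbt
      | algebraMap q =>
        intro t _ hbt
        rw [← mul_assoc, ← Algebra.commutes, mul_assoc, ← Algebra.smul_def]
        exact Submodule.smul_mem _ q hbt
      | add x y _ _ hx hy =>
        intro t ht hbt
        rw [add_mul, mul_add]
        exact add_mem (hx t ht hbt) (hy t ht hbt)
      | mul x y _ hy' hx hy =>
        intro t ht hbt
        rw [mul_assoc]
        refine hx _ (UZMinus_le_leftStabilizer ?_ t ht) (hy t ht hbt)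
        rwa [UZMinus_eq_adjoin]
    refine mem_leftStabilizer_of_forall_UZMinus fun m hm => ?_
    have h1 : (1 : U) ∈ triangular := by
      simpa using mem_triangular (one_mem UZMinus) (one_mem UZZero) (one_mem UZPlus)
    have h2 : b * 1 ∈ triangular := by
      simpa using mem_triangular (one_mem UZMinus) (one_mem UZZero) (divPow_xPlus_mem r k)
    simpa using key m hm 1 h1 h2

theorem UZ_le_triangular : Subalgebra.toSubmodule UZ ≤ triangular := fun x hx => by
  have h1 : UZ ≤ leftStabilizer triangular := by
    refine Algebra.adjoin_le ?_
    rintro _ ⟨r, k, rfl | rfl⟩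
    · exact divPow_xPlus_mem_leftStabilizer k r
    · exact UZMinus_le_leftStabilizer (divPow_xMinus_mem r k)
  have h2 : (1 : U) ∈ triangular := by
    simpa using mem_triangular (one_mem UZMinus) (one_mem UZZero) (one_mem UZPlus)
  simpa using h1 hx 1 h2

theorem UZPlus_le : UZPlus ≤ UZ := by
  rw [UZPlus_eq_adjoin]
  refine Algebra.adjoin_mono ?_
  rintro _ ⟨r, k, rfl⟩
  exact ⟨r, k, Or.inl rfl⟩

theorem UZMinus_le : UZMinus ≤ UZ := by
  rw [UZMinus_eq_adjoin]
  refine Algebra.adjoin_mono ?_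
  rintro _ ⟨r, k, rfl⟩
  exact ⟨r, k, Or.inr rfl⟩

theorem coeff_mul_mem_of_lt {B : Type*} [Ring B] {S : Subalgebra ℤ B} {f g : PowerSeries B}
    {n : ℕ} (hf : ∀ i ≤ n, coeff i f ∈ S) (hg : ∀ i ≤ n, coeff i g ∈ S) :
    ∀ i ≤ n, coeff i (f * g) ∈ S := fun i hi => by
  rw [coeff_mul]
  refine sum_mem fun p hp => ?_
  have := mem_antidiagonal.1 hp
  exact mul_mem (hf _ (by omega)) (hg _ (by omega))

/-- In the straightening formula with k = l the term n = k is the Newton element alone. The left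
side lies in `UZ`, and the earlier terms involve only Newton elements of smaller index. -/
theorem newtonE_hSeq_mem_UZ (r s : ℤ) (k : ℕ) : newtonE (hSeq (r + s) r) k ∈ UZ := by
  induction k using Nat.strong_induction_on with
  | _ k ih =>
    have hT := (loopTriple r s).divPow_mul_divPow k k
    simp only [Nat.cast_zero, mul_zero, add_zero, min_self] at hT
    rw [sum_range_succ, Nat.sub_self, divPow_zero, divPow_zero, one_mul, mul_one, newtonSeries,
      coeff_mk, ← sub_eq_iff_eq_add'] at hT
    rw [← hT]
    refine sub_mem (mul_mem (UZPlus_le (divPow_xPlus_mem _ _))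
      (UZMinus_le (divPow_xMinus_mem _ _))) (sum_mem fun n hn => ?_)
    have hn := mem_range.1 hn
    refine coeff_mul_mem_of_lt (n := n) (coeff_mul_mem_of_lt (fun i _ => ?_) (fun i hi => ?_))
      (fun i _ => ?_) n le_rfl
    · exact UZMinus_le (coeff_divPow_altSeries_mem
        (fun _ _ => commute_xMinus _ _) (fun _ _ _ => divPow_xMinus_mem _ _) i)
    · rw [coeff_mk]
      exact ih i (by omega)
    · exact UZPlus_le (coeff_divPow_altSeries_mem
        (fun _ _ => commute_xPlus _ _) (fun _ _ _ => divPow_xPlus_mem _ _) i)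

theorem UZZeroSign_le_UZ (ε : ℤˣ) : UZZeroSign ε ≤ UZ := by
  refine Algebra.adjoin_le ?_
  rintro _ ⟨k, rfl⟩
  have := newtonE_hSeq_mem_UZ 0 ε k
  rwa [zero_add, ← hHat_eq_newtonE_hSeq] at this

/-- The pairs (r, -r) yield binomials of h₀ + r c; r = 0 and r = 1 suffice, since c = (h₀ + c) - h₀.
-/
theorem UZZeroZero_le_UZ : UZZeroZero ≤ UZ := by
  have h1 : ∀ (r : ℤ) k, binom (h 0 + (r : ℚ) • c) k ∈ UZ := fun r k => by
    have := newtonE_hSeq_mem_UZ r (-r) k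
    rwa [add_neg_cancel, hSeq_zero, ← binom_eq_newtonE] at this
  have h2 : ∀ k, binom (h 0) k ∈ UZ := by simpa using h1 0
  have h3 : ∀ k, binom c k ∈ UZ := fun k => by
    have h4 : ∀ k, binom (h 0 + c) k ∈ UZ := by simpa using h1 1
    have := binom_add_mem ((Commute.refl (h 0)).add_left (commute_c _)).neg_right h4
      (fun k => binom_neg_mem h2 k) k
    simpa using this
  refine Algebra.adjoin_le ?_
  rintro _ ⟨a, ha, k, rfl⟩
  obtain ⟨m, n, rfl⟩ := exists_of_mem_span_h_c ha
  exact binom_add_mem (((commute_c (h 0)).symm.smul_left m).smul_right n) (binom_zsmul_mem h2 m)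
    (binom_zsmul_mem h3 n) k

theorem UZZero_le_UZ : UZZero ≤ UZ :=
  sup_le (sup_le (UZZeroSign_le_UZ _) UZZeroZero_le_UZ) (UZZeroSign_le_UZ _)

/-- Triangular decomposition of `Û_ℤ`. -/
theorem UZ_eq_triangular : Subalgebra.toSubmodule UZ = triangular := by
  refine le_antisymm UZ_le_triangular ?_
  rw [triangular, Submodule.mul_le]
  intro a ha x hx
  refine UZ.mul_mem ((?_ : _ ≤ Subalgebra.toSubmodule UZ) ha) (UZPlus_le hx)
  rw [Submodule.mul_le]
  exact fun m hm z hz => UZ.mul_mem (UZMinus_le hm) (UZZero_le_UZ hz)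

end Triangular

/-! ### Linearly independent families of polynomials. -/

section PolynomialFamilies

open MvPolynomial Finset

theorem linearIndependent_congr {K M ι : Type*} [Ring K] [AddCommGroup M] [Module K M]
    {f g : ι → M} (hf : LinearIndependent K f) (hfg : ∀ i, g i = f i) : LinearIndependent K g := by
  rwa [funext hfg]

/-- A polynomial ring in a disjoint union of variables is a tensor product, and tensors of
independent families are independent. -/
theorem linearIndependent_rename_mul_rename {σ τ ι κ : Type*} {f : ι → MvPolynomial σ ℚ}
    {g : κ → MvPolynomial τ ℚ} (hf : LinearIndependent ℚ f) (hg : LinearIndependent ℚ g) :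
    LinearIndependent ℚ fun p : ι × κ =>
      rename (Sum.inl : σ → σ ⊕ τ) (f p.1) * rename (Sum.inr : τ → σ ⊕ τ) (g p.2) := by
  have h1 := (hf.tmul_of_isDomain hg).map' (tensorEquivSum ℚ σ τ ℚ).toLinearMap
    (LinearMap.ker_eq_bot.2 (tensorEquivSum ℚ σ τ ℚ).injective)
  have hl : ∀ p : MvPolynomial σ ℚ, tensorEquivSum ℚ σ τ ℚ (p ⊗ₜ 1) = rename Sum.inl p := by
    intro p
    have : ((tensorEquivSum ℚ σ τ ℚ).toAlgHom.comp Algebra.TensorProduct.includeLeft) =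
        rename (Sum.inl : σ → σ ⊕ τ) := by
      ext i; simp
    exact DFunLike.congr_fun this p
  have hr : ∀ p : MvPolynomial τ ℚ, tensorEquivSum ℚ σ τ ℚ (1 ⊗ₜ p) = rename Sum.inr p := by
    intro p
    have : ((tensorEquivSum ℚ σ τ ℚ).toAlgHom.comp Algebra.TensorProduct.includeRight) =
        rename (Sum.inr : τ → σ ⊕ τ) := by
      ext i; simp
    exact DFunLike.congr_fun this p
  refine linearIndependent_congr h1 fun p => ?_
  simp only [Function.comp_apply, AlgEquiv.toLinearMap_apply]
  rw [← hl, ← hr, ← map_mul, Algebra.TensorProduct.tmul_mul_tmul, mul_one, one_mul]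

/-- The Newton elements of the variables of a polynomial ring. -/
noncomputable def polyNewton (k : ℕ) : MvPolynomial ℕ+ ℚ := newtonE (fun i => X i.succPNat) k

/-- Newton's recursion expressing power sums through elementary symmetric functions. -/
noncomputable def newtonP (e : ℕ → MvPolynomial ℕ+ ℚ) : ℕ → MvPolynomial ℕ+ ℚ
  | n => (-1 : ℚ) ^ n • (((n : ℚ) + 1) • e (n + 1) -
      ∑ i : Fin n, (-1 : ℚ) ^ (i : ℕ) • (newtonP e i * e (n - i)))

theorem newtonE_newtonP {e : ℕ → MvPolynomial ℕ+ ℚ} (h0 : e 0 = 1) (n : ℕ) :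
    newtonE (newtonP e) n = e n := by
  symm
  refine newtonE_eq_of_recursion h0 (fun n => ?_) n
  rw [Finset.Nat.sum_antidiagonal_eq_sum_range_succ_mk, sum_range_succ, Nat.sub_self, h0, mul_one]
  conv_rhs => rw [newtonP]
  rw [smul_smul, ← mul_pow, neg_one_mul, neg_neg, one_pow, one_smul, sum_range]
  abel

/-- Newton's recursion can be inverted over ℚ: replacing the variables, viewed as power sums, by
their expressions in elementary functions is a left inverse. -/
theorem aeval_polyNewton_injective :
    Function.Injective (aeval (R := ℚ) fun l : ℕ+ => polyNewton l) := by
  -- The value 1 at index 0 is the normalization e₀ = 1 required by Newton's recursion.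
  set e : ℕ → MvPolynomial ℕ+ ℚ := fun k => if h : 0 < k then X ⟨k, h⟩ else 1 with he
  set θ : MvPolynomial ℕ+ ℚ →ₐ[ℚ] MvPolynomial ℕ+ ℚ := aeval fun l => newtonP e l.natPred with hθ
  refine Function.LeftInverse.injective (g := θ) fun p => ?_
  rw [← AlgHom.comp_apply]
  have : θ.comp (aeval (R := ℚ) fun l : ℕ+ => polyNewton l) = AlgHom.id ℚ _ := by
    ext l : 1
    rw [AlgHom.comp_apply, aeval_X, polyNewton, map_newtonE]
    simp only [hθ, aeval_X, Nat.natPred_succPNat]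
    rw [newtonE_newtonP (by simp [he])]
    simp only [he, PNat.pos, dif_pos]
    rfl
  rw [this, AlgHom.id_apply]

theorem linearIndependent_polyNewton : LinearIndependent ℚ fun k : ℕ+ →₀ ℕ =>
    orderedProd (fun (l : ℕ+) n => polyNewton l ^ n) k := by
  have h1 := (basisMonomials ℕ+ ℚ).linearIndependent.map'
    (aeval (R := ℚ) fun l : ℕ+ => polyNewton l).toLinearMap
    (LinearMap.ker_eq_bot.2 aeval_polyNewton_injective)
  refine linearIndependent_congr h1 fun k => ?_
  simp only [Function.comp_apply, coe_basisMonomials, AlgHom.toLinearMap_apply]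
  rw [aeval_monomial, map_one, one_mul, orderedProd_eq_prod]

theorem linearIndependent_divPow_X : LinearIndependent ℚ fun k : ℤ →₀ ℕ =>
    orderedProd (fun (r : ℤ) n => divPow (X r : MvPolynomial ℤ ℚ) n) k := by
  have h1 := (basisMonomials ℤ ℚ).linearIndependent.units_smul
    (fun k => k.prod fun _ n => Units.mk0 ((n.factorial : ℚ)⁻¹) (by positivity))
  refine linearIndependent_congr h1 fun k => ?_
  rw [orderedProd_eq_prod]
  simp only [Pi.smul_apply', coe_basisMonomials, divPow]
  rw [monomial_eq, map_one, one_mul, Finsupp.prod, Finsupp.prod, Finsupp.prod, prod_smul,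
    Units.smul_def]
  congr 1
  simp

theorem linearIndependent_binom_X :
    LinearIndependent ℚ fun k : ℕ => binom (X () : MvPolynomial Unit ℚ) k := by
  have h0 : ∀ k : ℕ, ((k.factorial : ℚ)⁻¹) ≠ 0 := fun k => by positivity
  let S : Polynomial.Sequence ℚ :=
    { elems' := fun k => descPochhammer ℚ k
      degree_eq' := fun k => by
        rw [Polynomial.degree_eq_natDegree (monic_descPochhammer ℚ k).ne_zero,
          descPochhammer_natDegree] }
  have h1 := (S.linearIndependent.units_smul fun k => Units.mk0 _ (h0 k)).map'
    (Polynomial.aeval (X () : MvPolynomial Unit ℚ)).toLinearMap (by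
      refine LinearMap.ker_eq_bot.2 (Function.LeftInverse.injective
        (g := aeval fun _ => (Polynomial.X : Polynomial ℚ)) fun p => ?_)
      rw [AlgHom.toLinearMap_apply, ← AlgHom.comp_apply]
      have : (aeval fun _ : Unit => (Polynomial.X : Polynomial ℚ)).comp
          (Polynomial.aeval (X () : MvPolynomial Unit ℚ)) = AlgHom.id ℚ _ := by
        ext; simp
      rw [this, AlgHom.id_apply])
  refine linearIndependent_congr h1 fun k => ?_
  simp only [Function.comp_apply, Pi.smul_apply', AlgHom.toLinearMap_apply, Units.smul_def,
    Units.val_mk0, map_smul]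
  rfl

end PolynomialFamilies

/-! ### Commutator identities. -/

section Commutators

variable {A : Type*} [Ring A]

theorem comm_add_left (a b x : A) : ⁅a + b, x⁆ = ⁅a, x⁆ + ⁅b, x⁆ := by
  simp only [Ring.lie_def]; noncomm_ring

theorem comm_add_right (a b x : A) : ⁅x, a + b⁆ = ⁅x, a⁆ + ⁅x, b⁆ := by
  simp only [Ring.lie_def]; noncomm_ring

theorem comm_sub_left (a b x : A) : ⁅a - b, x⁆ = ⁅a, x⁆ - ⁅b, x⁆ := by
  simp only [Ring.lie_def]; noncomm_ring

theorem comm_smul_left [Algebra ℚ A] (q : ℚ) (a x : A) : ⁅q • a, x⁆ = q • ⁅a, x⁆ := by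
  simp only [Ring.lie_def, smul_mul_assoc, mul_smul_comm, smul_sub]

theorem comm_smul_right [Algebra ℚ A] (q : ℚ) (a x : A) : ⁅x, q • a⁆ = q • ⁅x, a⁆ := by
  simp only [Ring.lie_def, smul_mul_assoc, mul_smul_comm, smul_sub]

theorem comm_zero_left (x : A) : ⁅(0 : A), x⁆ = 0 := by simp [Ring.lie_def]

theorem comm_zero_right (x : A) : ⁅x, (0 : A)⁆ = 0 := by simp [Ring.lie_def]

theorem comm_self (x : A) : ⁅x, x⁆ = 0 := by simp [Ring.lie_def]

theorem comm_skew (a b : A) : -⁅b, a⁆ = ⁅a, b⁆ := by simp [Ring.lie_def]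

theorem comm_comm (a b x : A) : ⁅⁅a, b⁆, x⁆ = ⁅a, ⁅b, x⁆⁆ - ⁅b, ⁅a, x⁆⁆ := by
  simp only [Ring.lie_def]; noncomm_ring

end Commutators

/-! ### The module induced from a representation of the Borel subalgebra. -/

section InducedModule

open MvPolynomial

/-- A representation, by elements of an algebra, of the subalgebra of affine `sl₂` spanned by the
`h_r`, the `x_r^+` and `c`. -/
structure BorelRep (A : Type*) [Ring A] [Algebra ℚ A] where
  /-- the images of the `h_r` -/
  h : ℤ → A
  /-- the images of the `x_r^+` -/
  x : ℤ → A
  /-- the image of `c` -/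
  c : A
  lie_h_h : ∀ r s, ⁅h r, h s⁆ = if r + s = 0 then (2 * (r : ℚ)) • c else 0
  lie_h_x : ∀ r s, ⁅h r, x s⁆ = (2 : ℚ) • x (r + s)
  lie_x_x : ∀ r s, ⁅x r, x s⁆ = 0
  lie_c_h : ∀ r, ⁅c, h r⁆ = 0
  lie_c_x : ∀ r, ⁅c, x r⁆ = 0

/-- The gradient of a polynomial in the variables indexed by `ℤ`. -/
noncomputable def grad :
    Derivation ℚ (MvPolynomial ℤ ℚ) (ℤ →₀ MvPolynomial ℤ ℚ) :=
  mkDerivation ℚ fun s => Finsupp.single s 1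

/-- The derivation `X_s ↦ -2 X_{n+s}`. -/
noncomputable def shiftDer (n : ℤ) : Derivation ℚ (MvPolynomial ℤ ℚ) (MvPolynomial ℤ ℚ) :=
  (Finsupp.linearCombination (MvPolynomial ℤ ℚ) fun t => (-2 : ℚ) • X (n + t)).compDer grad

theorem grad_X (s : ℤ) : grad (X s) = Finsupp.single s 1 := mkDerivation_X _ _ _

theorem compDer_grad_apply (L : (ℤ →₀ MvPolynomial ℤ ℚ) →ₗ[MvPolynomial ℤ ℚ] MvPolynomial ℤ ℚ)
    (f : MvPolynomial ℤ ℚ) : L.compDer grad f = L (grad f) := rfl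

theorem shiftDer_X (n s : ℤ) : shiftDer n (X s) = (-2 : ℚ) • X (n + s) := by
  rw [shiftDer, compDer_grad_apply, grad_X, Finsupp.linearCombination_single, one_smul]

namespace BorelRep

variable {A : Type*} [Ring A] [Algebra ℚ A] (ϱ : BorelRep A)

/-- The space of the induced module. -/
def IndMod (A : Type*) [Ring A] [Algebra ℚ A] : Type _ := MvPolynomial ℤ ℚ ⊗[ℚ] A

noncomputable instance : AddCommGroup (IndMod A) :=
  inferInstanceAs (AddCommGroup (MvPolynomial ℤ ℚ ⊗[ℚ] A))

noncomputable instance : Module ℚ (IndMod A) :=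
  inferInstanceAs (Module ℚ (MvPolynomial ℤ ℚ ⊗[ℚ] A))

/-- The pure tensors in the induced module. -/
noncomputable def tm : MvPolynomial ℤ ℚ →ₗ[ℚ] A →ₗ[ℚ] IndMod A :=
  TensorProduct.mk ℚ (MvPolynomial ℤ ℚ) A

/-- The operators on the induced module. -/
abbrev Ops (A : Type*) [Ring A] [Algebra ℚ A] : Type _ := Module.End ℚ (IndMod A)

theorem tm_ext {S T : Ops A} (h : ∀ f a, S (tm f a) = T (tm f a)) : S = T :=
  TensorProduct.ext (LinearMap.ext fun f => LinearMap.ext fun a => h f a)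

/-- Left multiplication on the first factor. -/
noncomputable def mulX (A : Type*) [Ring A] [Algebra ℚ A] : MvPolynomial ℤ ℚ →ₐ[ℚ] Ops A :=
  (Module.End.rTensorAlgHom ℚ (MvPolynomial ℤ ℚ) A).comp (Algebra.lmul ℚ (MvPolynomial ℤ ℚ))

/-- Left multiplication on the second factor. -/
noncomputable def mulA (A : Type*) [Ring A] [Algebra ℚ A] : A →ₐ[ℚ] Ops A :=
  (Module.End.lTensorAlgHom ℚ A (MvPolynomial ℤ ℚ)).comp (Algebra.lmul ℚ A)

/-- The action of `shiftDer n` on the first factor. -/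
noncomputable def derX (A : Type*) [Ring A] [Algebra ℚ A] (n : ℤ) : Ops A :=
  LinearMap.rTensor A (shiftDer n : MvPolynomial ℤ ℚ →ₗ[ℚ] MvPolynomial ℤ ℚ)

theorem mulX_tmul (f g : MvPolynomial ℤ ℚ) (a : A) : mulX A f (tm g a) = tm (f * g) a := rfl

theorem mulA_tmul (b : A) (g : MvPolynomial ℤ ℚ) (a : A) : mulA A b (tm g a) = tm g (b * a) := rfl

theorem derX_tmul (n : ℤ) (g : MvPolynomial ℤ ℚ) (a : A) :
    derX A n (tm g a) = tm (shiftDer n g) a := rfl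

/-- The difference commutes with multiplication by every X_s and kills 1 ⊗ A, which generates the
module. Each relation below is thereby reduced to its values on 1 ⊗ A and to brackets with the X_s,
computed by the Jacobi identity. -/
theorem ops_ext {S T : Ops A} (h1 : ∀ a : A, S (tm 1 a) = T (tm 1 a))
    (h2 : ∀ s, ⁅S, mulX A (X s)⁆ = ⁅T, mulX A (X s)⁆) : S = T := by
  rw [← sub_eq_zero]
  set D := S - T with hD
  have hc : ∀ s w, D (mulX A (X s) w) = mulX A (X s) (D w) := by
    intro s w
    have : ⁅D, mulX A (X s)⁆ = 0 := by rw [hD, comm_sub_left, h2, sub_self]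
    rw [Ring.lie_def, sub_eq_zero] at this
    exact LinearMap.congr_fun this w
  refine tm_ext fun f a => ?_
  rw [LinearMap.zero_apply]
  induction f using MvPolynomial.induction_on with
  | C q =>
    have : tm (C q) a = q • tm 1 a := by
      rw [← LinearMap.smul_apply, ← map_smul, ← C_mul', mul_one]
    rw [this, map_smul, hD, LinearMap.sub_apply, h1, sub_self, smul_zero]
  | add f g hf hg => rw [map_add, LinearMap.add_apply, map_add, hf, hg, add_zero]
  | mul_X f s hf => rw [mul_comm, ← mulX_tmul, hc, hf, map_zero]

/-- The action of `h_r`. -/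
noncomputable def hOp (r : ℤ) : Ops A := derX A r + mulA A (ϱ.h r)

/-- The action of `c`. -/
noncomputable def cOp : Ops A := mulA A ϱ.c

/-- The coefficients of the second order operator in the action of `x_r^+`. -/
noncomputable def coeffOp (r t : ℤ) : Ops A :=
  mulA A (ϱ.h (r + t) + if r + t = 0 then (r : ℚ) • ϱ.c else 0) + (2⁻¹ : ℚ) • derX A (r + t)

/-- Contraction of a vector of polynomials with the `coeffOp`. -/
noncomputable def contract (r : ℤ) :
    (ℤ →₀ MvPolynomial ℤ ℚ) →ₗ[ℚ] A →ₗ[ℚ] IndMod A :=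
  Finsupp.lsum ℚ fun t => tm.compr₂ (ϱ.coeffOp r t)

/-- The second order operator in the action of `x_r^+`. -/
noncomputable def gradOp (r : ℤ) : Ops A :=
  TensorProduct.lift (ϱ.contract r ∘ₗ (grad : MvPolynomial ℤ ℚ →ₗ[ℚ] _))

/-- The action of `x_r^+`. -/
noncomputable def xOp (r : ℤ) : Ops A := mulA A (ϱ.x r) + ϱ.gradOp r

theorem hOp_one_tmul (r : ℤ) (a : A) : ϱ.hOp r (tm 1 a) = tm 1 (ϱ.h r * a) := by
  rw [hOp, LinearMap.add_apply, derX_tmul, mulA_tmul, Derivation.map_one_eq_zero,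
    map_zero, LinearMap.zero_apply, zero_add]

theorem cOp_one_tmul (a : A) : ϱ.cOp (tm 1 a) = tm 1 (ϱ.c * a) := rfl

theorem gradOp_tmul (r : ℤ) (f : MvPolynomial ℤ ℚ) (a : A) :
    ϱ.gradOp r (tm f a) = ϱ.contract r (grad f) a := rfl

theorem xOp_one_tmul (r : ℤ) (a : A) : ϱ.xOp r (tm 1 a) = tm 1 (ϱ.x r * a) := by
  rw [xOp, LinearMap.add_apply, mulA_tmul, gradOp_tmul, Derivation.map_one_eq_zero, map_zero,
    LinearMap.zero_apply, add_zero]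

theorem lie_mulX_mulX (f g : MvPolynomial ℤ ℚ) : ⁅mulX A f, mulX A g⁆ = 0 := by
  rw [Ring.lie_def, ← map_mul, ← map_mul, mul_comm, sub_self]

theorem lie_mulA_mulX (a : A) (g : MvPolynomial ℤ ℚ) : ⁅mulA A a, mulX A g⁆ = 0 := by
  rw [Ring.lie_def, sub_eq_zero]
  exact tm_ext fun _ _ => rfl

theorem lie_derX_mulX (n s : ℤ) :
    ⁅derX A n, mulX A (X s)⁆ = (-2 : ℚ) • mulX A (X (n + s)) := by
  rw [Ring.lie_def, ← map_smul]
  refine tm_ext fun f a => ?_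
  change derX A n (mulX A (X s) (tm f a)) - mulX A (X s) (derX A n (tm f a)) =
    mulX A _ (tm f a)
  rw [mulX_tmul, derX_tmul, derX_tmul, mulX_tmul, mulX_tmul, Derivation.leibniz, shiftDer_X,
    ← LinearMap.sub_apply, ← map_sub, smul_eq_mul, smul_eq_mul, add_sub_cancel_left, mul_comm]

theorem lie_hOp_mulX (r s : ℤ) : ⁅ϱ.hOp r, mulX A (X s)⁆ = (-2 : ℚ) • mulX A (X (r + s)) := by
  rw [hOp, comm_add_left, lie_derX_mulX, lie_mulA_mulX, add_zero]

theorem lie_cOp_mulX (s : ℤ) : ⁅ϱ.cOp, mulX A (X s)⁆ = 0 := lie_mulA_mulX _ _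

theorem lie_coeffOp_mulX (r t s : ℤ) :
    ⁅ϱ.coeffOp r t, mulX A (X s)⁆ = -mulX A (X (r + t + s)) := by
  rw [coeffOp, comm_add_left, lie_mulA_mulX, comm_smul_left, lie_derX_mulX, zero_add, smul_smul]
  norm_num

theorem contract_single (r t : ℤ) (f : MvPolynomial ℤ ℚ) (a : A) :
    ϱ.contract r (Finsupp.single t f) a = ϱ.coeffOp r t (tm f a) := by
  rw [contract, Finsupp.lsum_single]
  rfl

/-- `coeffOp r t` fails to commute with X_s by -X_{r+t+s}; for v the gradient of f, the correction
is half of `shiftDer (r + s) f`. -/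
theorem contract_smul (r s : ℤ) (v : ℤ →₀ MvPolynomial ℤ ℚ) (a : A) :
    ϱ.contract r ((X s : MvPolynomial ℤ ℚ) • v) a = mulX A (X s) (ϱ.contract r v a) + (2⁻¹ : ℚ) •
      tm (Finsupp.linearCombination (MvPolynomial ℤ ℚ)
        (fun t => (-2 : ℚ) • (X (r + s + t) : MvPolynomial ℤ ℚ)) v) a := by
  induction v using Finsupp.induction_linear with
  | zero => simp
  | add f g hf hg =>
    rw [smul_add, map_add, map_add, map_add, LinearMap.add_apply, LinearMap.add_apply, hf, hg,
      map_add, map_add, LinearMap.add_apply, smul_add]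
    abel
  | single t f =>
    have h1 := LinearMap.congr_fun (ϱ.lie_coeffOp_mulX r t s) (tm f a)
    rw [Ring.lie_def] at h1
    rw [LinearMap.sub_apply, sub_eq_iff_eq_add'] at h1
    rw [Finsupp.smul_single, contract_single, contract_single, smul_eq_mul, ← mulX_tmul,
      Finsupp.linearCombination_single]
    refine h1.trans ?_
    congr 1
    rw [LinearMap.neg_apply, mulX_tmul, smul_eq_mul, mul_smul_comm, map_smul, LinearMap.smul_apply,
      smul_smul, mul_comm, add_right_comm]
    norm_num

theorem lie_gradOp_mulX (r s : ℤ) :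
    ⁅ϱ.gradOp r, mulX A (X s)⁆ = ϱ.coeffOp r s + (2⁻¹ : ℚ) • derX A (r + s) := by
  rw [Ring.lie_def]
  refine tm_ext fun f a => ?_
  change ϱ.gradOp r (mulX A (X s) (tm f a)) - mulX A (X s) (ϱ.gradOp r (tm f a)) =
    ϱ.coeffOp r s (tm f a) + (2⁻¹ : ℚ) • derX A (r + s) (tm f a)
  rw [mulX_tmul, gradOp_tmul, gradOp_tmul, Derivation.leibniz, grad_X, map_add,
    LinearMap.add_apply, contract_smul, Finsupp.smul_single, contract_single, smul_eq_mul, mul_one,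
    derX_tmul, shiftDer, compDer_grad_apply]
  abel

theorem lie_xOp_mulX (r s : ℤ) : ⁅ϱ.xOp r, mulX A (X s)⁆ =
    ϱ.hOp (r + s) + if r + s = 0 then (r : ℚ) • ϱ.cOp else 0 := by
  -- One half comes from `coeffOp r s` and one from the failure to commute; together they form the
  -- full derivation in `hOp (r + s)`.
  have h2 : (2⁻¹ : ℚ) • derX A (r + s) + (2⁻¹ : ℚ) • derX A (r + s) = derX A (r + s) := by
    rw [← add_smul]; norm_num
  rw [xOp, comm_add_left, lie_mulA_mulX, zero_add, lie_gradOp_mulX, coeffOp, add_assoc, h2, hOp, cOp,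
    map_add, apply_ite (mulA A), map_zero, map_smul]
  abel

theorem lie_one_tmul {S T : Ops A} {a b : A} (hS : ∀ w, S (tm 1 w) = tm 1 (a * w))
    (hT : ∀ w, T (tm 1 w) = tm 1 (b * w)) (w : A) : ⁅S, T⁆ (tm 1 w) = tm 1 (⁅a, b⁆ * w) := by
  rw [Ring.lie_def, Ring.lie_def, LinearMap.sub_apply, Module.End.mul_apply, Module.End.mul_apply,
    hT, hS, hS, hT, sub_mul, map_sub, mul_assoc, mul_assoc]

theorem lie_cOp_hOp (r : ℤ) : ⁅ϱ.cOp, ϱ.hOp r⁆ = 0 := by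
  refine ops_ext (fun a => ?_) fun s => ?_
  · rw [lie_one_tmul ϱ.cOp_one_tmul (ϱ.hOp_one_tmul r), ϱ.lie_c_h, zero_mul,
      map_zero, LinearMap.zero_apply]
  · rw [comm_comm, lie_hOp_mulX, lie_cOp_mulX, comm_smul_right, lie_cOp_mulX, comm_zero_right, smul_zero, sub_zero,
      comm_zero_left]

theorem lie_hOp_hOp (r s : ℤ) :
    ⁅ϱ.hOp r, ϱ.hOp s⁆ = if r + s = 0 then (2 * (r : ℚ)) • ϱ.cOp else 0 := by
  refine ops_ext (fun a => ?_) fun t => ?_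
  · rw [lie_one_tmul (ϱ.hOp_one_tmul r) (ϱ.hOp_one_tmul s), ϱ.lie_h_h]
    split_ifs
    · rw [LinearMap.smul_apply, cOp_one_tmul, smul_mul_assoc, map_smul]
    · rw [zero_mul, map_zero, LinearMap.zero_apply]
  · have : ⁅(if r + s = 0 then (2 * (r : ℚ)) • ϱ.cOp else 0 : Ops A), mulX A (X t)⁆ = 0 := by
      split_ifs
      · rw [comm_smul_left, lie_cOp_mulX, smul_zero]
      · rw [comm_zero_left]
    rw [this, comm_comm, lie_hOp_mulX, lie_hOp_mulX, comm_smul_right, comm_smul_right, lie_hOp_mulX, lie_hOp_mulX,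
      add_left_comm, sub_self]

theorem lie_cOp_xOp (r : ℤ) : ⁅ϱ.cOp, ϱ.xOp r⁆ = 0 := by
  refine ops_ext (fun a => ?_) fun s => ?_
  · rw [lie_one_tmul ϱ.cOp_one_tmul (ϱ.xOp_one_tmul r), ϱ.lie_c_x, zero_mul,
      map_zero, LinearMap.zero_apply]
  · rw [comm_comm, lie_xOp_mulX, lie_cOp_mulX, comm_zero_right, sub_zero, comm_zero_left, comm_add_right, lie_cOp_hOp,
      zero_add]
    split_ifs
    · rw [comm_smul_right, comm_self, smul_zero]
    · rw [comm_zero_right]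

theorem lie_hOp_xOp (r s : ℤ) : ⁅ϱ.hOp r, ϱ.xOp s⁆ = (2 : ℚ) • ϱ.xOp (r + s) := by
  refine ops_ext (fun a => ?_) fun t => ?_
  · rw [lie_one_tmul (ϱ.hOp_one_tmul r) (ϱ.xOp_one_tmul s), ϱ.lie_h_x, LinearMap.smul_apply,
      xOp_one_tmul, smul_mul_assoc, map_smul]
  · have hc : ⁅ϱ.hOp r, ϱ.cOp⁆ = 0 := by rw [← comm_skew, lie_cOp_hOp, neg_zero]
    rw [comm_comm, lie_xOp_mulX, lie_hOp_mulX, comm_smul_right, lie_xOp_mulX, comm_smul_left, lie_xOp_mulX,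
      comm_add_right, lie_hOp_hOp]
    have h1 : r + (s + t) = r + s + t := (add_assoc _ _ _).symm
    have h2 : s + (r + t) = r + s + t := by ring
    rw [h1, h2]
    have h3 : ⁅ϱ.hOp r, (if s + t = 0 then (s : ℚ) • ϱ.cOp else 0 : Ops A)⁆ = 0 := by
      split_ifs
      · rw [comm_smul_right, hc, smul_zero]
      · rw [comm_zero_right]
    rw [h3]
    split_ifs
    · push_cast
      module
    · module

/-- The double bracket with X_t depends only on r + s + t, so the two terms of the Jacobi identity
cancel. -/
theorem lie_xOp_xOp (r s : ℤ) : ⁅ϱ.xOp r, ϱ.xOp s⁆ = 0 := by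
  refine ops_ext (fun a => ?_) fun t => ?_
  · rw [lie_one_tmul (ϱ.xOp_one_tmul r) (ϱ.xOp_one_tmul s), ϱ.lie_x_x, zero_mul,
      map_zero, LinearMap.zero_apply]
  · have key : ∀ r s : ℤ, ⁅ϱ.xOp r, ⁅ϱ.xOp s, mulX A (X t)⁆⁆ = (-2 : ℚ) • ϱ.xOp (r + s + t) := by
      intro r s
      have h3 : ⁅ϱ.xOp r, (if s + t = 0 then (s : ℚ) • ϱ.cOp else 0 : Ops A)⁆ = 0 := by
        split_ifs
        · rw [comm_smul_right, ← comm_skew, lie_cOp_xOp, neg_zero, smul_zero]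
        · rw [comm_zero_right]
      rw [lie_xOp_mulX, comm_add_right, h3, add_zero, ← comm_skew, lie_hOp_xOp, ← neg_smul,
        show s + t + r = r + s + t by ring]
    rw [comm_comm, key, key, add_comm s r, sub_self, comm_zero_left]

/-- The operators by which the generators act on the induced module. -/
noncomputable def genOp : Gen → Ops A
  | Gen.xPlus r => ϱ.xOp r
  | Gen.xMinus r => mulX A (X r)
  | Gen.h r => ϱ.hOp r
  | Gen.c => ϱ.cOp

theorem lift_genOp_eq_of_rel {a b : FreeAlgebra ℚ Gen} (hab : Rel a b) :
    FreeAlgebra.lift ℚ ϱ.genOp a = FreeAlgebra.lift ℚ ϱ.genOp b := by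
  induction hab with
  | c_central g =>
    rw [Ring.lie_def, map_sub, map_mul, map_mul, FreeAlgebra.lift_ι_apply,
      FreeAlgebra.lift_ι_apply, map_zero, ← Ring.lie_def]
    cases g with
    | xPlus r => exact ϱ.lie_cOp_xOp r
    | xMinus r => exact ϱ.lie_cOp_mulX r
    | h r => exact ϱ.lie_cOp_hOp r
    | c => exact comm_self _
  | h_h r s =>
    rw [Ring.lie_def, map_sub, map_mul, map_mul, FreeAlgebra.lift_ι_apply,
      FreeAlgebra.lift_ι_apply, apply_ite (FreeAlgebra.lift ℚ ϱ.genOp), map_smul, map_zero,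
      FreeAlgebra.lift_ι_apply]
    exact ϱ.lie_hOp_hOp r s
  | h_xPlus r s =>
    rw [Ring.lie_def, map_sub, map_mul, map_mul, FreeAlgebra.lift_ι_apply,
      FreeAlgebra.lift_ι_apply, map_smul, FreeAlgebra.lift_ι_apply]
    exact ϱ.lie_hOp_xOp r s
  | h_xMinus r s =>
    rw [Ring.lie_def, map_sub, map_mul, map_mul, FreeAlgebra.lift_ι_apply,
      FreeAlgebra.lift_ι_apply, map_smul, FreeAlgebra.lift_ι_apply]
    exact ϱ.lie_hOp_mulX r s
  | xPlus_xPlus r s =>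
    rw [Ring.lie_def, map_sub, map_mul, map_mul, FreeAlgebra.lift_ι_apply,
      FreeAlgebra.lift_ι_apply, map_zero]
    exact ϱ.lie_xOp_xOp r s
  | xMinus_xMinus r s =>
    rw [Ring.lie_def, map_sub, map_mul, map_mul, FreeAlgebra.lift_ι_apply,
      FreeAlgebra.lift_ι_apply, map_zero]
    exact lie_mulX_mulX _ _
  | xPlus_xMinus r s =>
    rw [Ring.lie_def, map_sub, map_mul, map_mul, FreeAlgebra.lift_ι_apply,
      FreeAlgebra.lift_ι_apply, map_add, apply_ite (FreeAlgebra.lift ℚ ϱ.genOp), map_smul, map_zero,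
      FreeAlgebra.lift_ι_apply, FreeAlgebra.lift_ι_apply]
    exact ϱ.lie_xOp_mulX r s

/-- The action of `Û` on the module induced from a representation of the Borel subalgebra. -/
noncomputable def induced : U →ₐ[ℚ] Ops A :=
  RingQuot.liftAlgHom ℚ ⟨FreeAlgebra.lift ℚ ϱ.genOp, fun _ _ => ϱ.lift_genOp_eq_of_rel⟩

theorem induced_gen (g : Gen) : ϱ.induced (gen g) = ϱ.genOp g := by
  unfold induced gen AffineSl2.mk
  exact (RingQuot.liftAlgHom_mkAlgHom_apply _ _ _ _).trans (FreeAlgebra.lift_ι_apply ..)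

end BorelRep

end InducedModule

/-! ### The right action of the Borel subalgebra on polynomials, symbols and independence. -/

section BorelModule

open MvPolynomial

/-- The index set of the variables `y_{-k}`, `y_0`, `z`, `y_k` (`k > 0`) and `x_s` (`s ∈ ℤ`). -/
abbrev BorelVar : Type := ℕ+ ⊕ (Unit ⊕ (Unit ⊕ (ℕ+ ⊕ ℤ)))

/-- The polynomial ring on which the Borel subalgebra acts from the right. -/
abbrev BorelPoly : Type := MvPolynomial BorelVar ℚ

/-- Inclusion of the polynomials in the `y_{-k}`, `k > 0`. -/
noncomputable def inclNeg : MvPolynomial ℕ+ ℚ →ₐ[ℚ] BorelPoly := rename Sum.inl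

/-- Inclusion of the polynomials in `y_0`. -/
noncomputable def inclZero : MvPolynomial Unit ℚ →ₐ[ℚ] BorelPoly :=
  (rename Sum.inr).comp (rename Sum.inl)

/-- Inclusion of the polynomials in `z`. -/
noncomputable def inclCentre : MvPolynomial Unit ℚ →ₐ[ℚ] BorelPoly :=
  (rename Sum.inr).comp ((rename Sum.inr).comp (rename Sum.inl))

/-- Inclusion of the polynomials in the `y_k`, `k > 0`. -/
noncomputable def inclPos : MvPolynomial ℕ+ ℚ →ₐ[ℚ] BorelPoly :=
  (rename Sum.inr).comp ((rename Sum.inr).comp ((rename Sum.inr).comp (rename Sum.inl)))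

/-- Inclusion of the polynomials in the `x_s`. -/
noncomputable def inclX : MvPolynomial ℤ ℚ →ₐ[ℚ] BorelPoly :=
  (rename Sum.inr).comp ((rename Sum.inr).comp ((rename Sum.inr).comp (rename Sum.inr)))

/-- The variable `z`. -/
noncomputable def centreVar : BorelPoly := inclCentre (X ())

/-- The variable `y_r`. -/
noncomputable def hVar : ℤ → BorelPoly
  | Int.ofNat 0 => inclZero (X ())
  | Int.ofNat (n + 1) => inclPos (X n.succPNat)
  | Int.negSucc n => inclNeg (X n.succPNat)

/-- The derivation `y_k ↦ 2 k δ_{r+k,0} z` (`k > 0`), `x_s ↦ -2 x_{r+s}`. -/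
noncomputable def hDer (r : ℤ) : Derivation ℚ BorelPoly BorelPoly :=
  mkDerivation ℚ (Sum.elim (fun _ => 0) (Sum.elim (fun _ => 0) (Sum.elim (fun _ => 0)
    (Sum.elim (fun k => if r + k = 0 then (2 * (k : ℚ)) • centreVar else 0)
      fun s => (-2 : ℚ) • inclX (X (r + s))))))

theorem hDer_inclNeg (r : ℤ) (k : ℕ+) : hDer r (inclNeg (X k)) = 0 := by
  simp [inclNeg, hDer, mkDerivation_X]

theorem hDer_inclZero (r : ℤ) : hDer r (inclZero (X ())) = 0 := by
  simp [inclZero, hDer, mkDerivation_X]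

theorem hDer_centreVar (r : ℤ) : hDer r centreVar = 0 := by
  simp [centreVar, inclCentre, hDer, mkDerivation_X]

theorem hDer_inclPos (r : ℤ) (k : ℕ+) :
    hDer r (inclPos (X k)) = if r + k = 0 then (2 * (k : ℚ)) • centreVar else 0 := by
  simp [inclPos, hDer, mkDerivation_X]

theorem hDer_inclX (r s : ℤ) : hDer r (inclX (X s)) = (-2 : ℚ) • inclX (X (r + s)) := by
  simp [inclX, hDer, mkDerivation_X]

theorem hDer_hVar (r s : ℤ) :
    hDer r (hVar s) = if 0 < s ∧ r + s = 0 then (2 * (s : ℚ)) • centreVar else 0 := by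
  match s with
  | Int.ofNat 0 => rw [hVar, hDer_inclZero, if_neg (by simp)]
  | Int.ofNat (n + 1) =>
    rw [hVar, hDer_inclPos]
    simp
  | Int.negSucc n => rw [hVar, hDer_inclNeg, if_neg (by simp)]

theorem hDer_comm (r s : ℤ) (p : BorelPoly) : hDer r (hDer s p) = hDer s (hDer r p) := by
  have : ⁅hDer r, hDer s⁆ = 0 := by
    refine derivation_ext fun i => ?_
    rw [Derivation.commutator_apply, Derivation.zero_apply, sub_eq_zero]
    rcases i with k | _ | _ | k | t
    · have := hDer_inclNeg
      simp only [inclNeg, rename_X] at this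
      rw [this, this, map_zero, map_zero]
    · have := hDer_inclZero
      simp only [inclZero, AlgHom.comp_apply, rename_X] at this
      erw [this, this]
      rw [map_zero, map_zero]
    · have := hDer_centreVar
      simp only [centreVar, inclCentre, AlgHom.comp_apply, rename_X] at this
      erw [this, this]
      rw [map_zero, map_zero]
    · have := hDer_inclPos
      simp only [inclPos, AlgHom.comp_apply, rename_X] at this
      rw [this, this, apply_ite (hDer r), apply_ite (hDer s), Derivation.map_smul,
        Derivation.map_smul, hDer_centreVar, hDer_centreVar]
      simp
    · have := hDer_inclX
      simp only [inclX, AlgHom.comp_apply, rename_X] at this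
      rw [this, this, Derivation.map_smul, Derivation.map_smul, this, this, ← add_assoc,
        ← add_assoc, add_comm r s]
  have h2 := congrArg (fun D : Derivation ℚ BorelPoly BorelPoly => D p) this
  simpa [Derivation.commutator_apply, sub_eq_zero] using h2

/-- The right action by `f + D`. -/
noncomputable def rightOp (f : BorelPoly) (D : Derivation ℚ BorelPoly BorelPoly) :
    (Module.End ℚ BorelPoly)ᵐᵒᵖ :=
  MulOpposite.op (Algebra.lmul ℚ BorelPoly f + (D : BorelPoly →ₗ[ℚ] BorelPoly))

theorem unop_rightOp (f : BorelPoly) (D : Derivation ℚ BorelPoly BorelPoly) (p : BorelPoly) :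
    (rightOp f D).unop p = f * p + D p := rfl

/-- In the opposite algebra the composition is reversed, hence the sign of E f - D g; the
second-order terms cancel since D and E commute. -/
theorem lie_rightOp {f g k : BorelPoly} {D E : Derivation ℚ BorelPoly BorelPoly}
    (hDE : ∀ p, D (E p) = E (D p)) (hk : E f - D g = k) :
    ⁅rightOp f D, rightOp g E⁆ = rightOp k 0 := by
  refine MulOpposite.unop_injective (LinearMap.ext fun p => ?_)
  rw [unop_rightOp, Ring.lie_def]
  change (rightOp g E).unop ((rightOp f D).unop p) - (rightOp f D).unop ((rightOp g E).unop p) = _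
  simp only [unop_rightOp, map_add, Derivation.leibniz, smul_eq_mul, ← hk, hDE,
    Derivation.zero_apply]
  ring

theorem rightOp_smul_zero (q : ℚ) (f : BorelPoly) : rightOp (q • f) 0 = q • rightOp f 0 := by
  refine MulOpposite.unop_injective (LinearMap.ext fun p => ?_)
  change (q • f) * p + 0 = q • (f * p + 0)
  simp

theorem rightOp_zero_zero : rightOp 0 0 = 0 := by
  refine MulOpposite.unop_injective (LinearMap.ext fun p => ?_)
  change 0 * p + 0 = 0
  simp

/-- The representation of the Borel subalgebra by right operators on polynomials. -/
noncomputable def polyRep : BorelRep (Module.End ℚ BorelPoly)ᵐᵒᵖ where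
  h r := rightOp (hVar r) (hDer r)
  x s := rightOp (inclX (X s)) 0
  c := rightOp centreVar 0
  lie_h_h r s := by
    rw [lie_rightOp (hDer_comm r s) rfl, hDer_hVar, hDer_hVar, ← rightOp_smul_zero,
      ← rightOp_zero_zero, ← apply_ite (fun f => rightOp f 0)]
    congr 1
    -- If r + s = 0 and r ≠ 0, exactly one of r and s is positive, so exactly one of the two
    -- derivations contributes, and both cases give 2r z.
    rcases lt_trichotomy r 0 with hr | hr | hr <;> by_cases hrs : r + s = 0
    · rw [if_neg (by omega), if_pos (by omega), if_pos hrs, eq_neg_of_add_eq_zero_right hrs]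
      push_cast
      module
    · rw [if_neg (by omega), if_neg (by omega), if_neg hrs, sub_zero]
    · rw [if_neg (by omega), if_neg (by omega), if_pos hrs, hr]
      simp
    · rw [if_neg (by omega), if_neg (by omega), if_neg hrs, sub_zero]
    · rw [if_pos (by omega), if_neg (by omega), if_pos hrs, sub_zero]
    · rw [if_neg (by omega), if_neg (by omega), if_neg hrs, sub_zero]
  lie_h_x r s := by
    rw [← rightOp_smul_zero]
    refine lie_rightOp (fun p => by simp) ?_
    rw [hDer_inclX, Derivation.zero_apply, zero_sub, ← neg_smul, neg_neg]
  lie_x_x r s := by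
    rw [← rightOp_zero_zero]
    exact lie_rightOp (fun p => by simp) (by simp)
  lie_c_h r := by
    rw [← rightOp_zero_zero]
    exact lie_rightOp (fun p => by simp) (by simp [hDer_centreVar])
  lie_c_x r := by
    rw [← rightOp_zero_zero]
    exact lie_rightOp (fun p => by simp) (by simp)

/-- The pairs `(u, q)` such that `u` acts on `1 ⊗ A` by left multiplication by an operator which,
on the polynomials in `K`, is the multiplication by `q`. -/
noncomputable def symbolPairs (K : Submodule ℚ BorelPoly) : Subalgebra ℚ (U × BorelPoly) where
  carrier := {w | ∃ α : (Module.End ℚ BorelPoly)ᵐᵒᵖ,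
    (∀ a, polyRep.induced w.1 (BorelRep.tm 1 a) = BorelRep.tm 1 (α * a)) ∧
      ∀ p ∈ K, α.unop p = p * w.2 ∧ p * w.2 ∈ K}
  mul_mem' := by
    rintro ⟨u, q⟩ ⟨v, s⟩ ⟨α, hα, hα'⟩ ⟨β, hβ, hβ'⟩
    refine ⟨α * β, fun a => ?_, fun p hp => ⟨?_, ?_⟩⟩
    · rw [Prod.fst_mul, map_mul, Module.End.mul_apply, hβ, hα, mul_assoc]
    · change β.unop (α.unop p) = p * (q * s)
      rw [(hα' p hp).1, (hβ' _ (hα' p hp).2).1, mul_assoc]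
    · change p * (q * s) ∈ K
      rw [← mul_assoc]
      exact (hβ' _ (hα' p hp).2).2
  add_mem' := by
    rintro ⟨u, q⟩ ⟨v, s⟩ ⟨α, hα, hα'⟩ ⟨β, hβ, hβ'⟩
    refine ⟨α + β, fun a => ?_, fun p hp => ⟨?_, ?_⟩⟩
    · rw [Prod.fst_add, map_add, LinearMap.add_apply, hβ, hα, add_mul, map_add]
    · change α.unop p + β.unop p = p * (q + s)
      rw [(hα' p hp).1, (hβ' p hp).1, mul_add]
    · change p * (q + s) ∈ K
      rw [mul_add]
      exact K.add_mem (hα' p hp).2 (hβ' p hp).2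
  algebraMap_mem' t := by
    refine ⟨algebraMap ℚ _ t, fun a => ?_, fun p hp => ⟨?_, ?_⟩⟩
    · rw [Prod.algebraMap_apply, AlgHom.commutes, Module.algebraMap_end_apply, ← Algebra.smul_def,
        map_smul]
    · change t • p = p * C t
      rw [mul_comm, C_mul']
    · change p * C t ∈ K
      rw [mul_comm, C_mul']
      exact K.smul_mem t hp

theorem newtonE_mem_symbolPairs {K : Submodule ℚ BorelPoly} {a : ℕ → U} {b : ℕ → BorelPoly}
    (hab : ∀ i, (a i, b i) ∈ symbolPairs K) (k : ℕ) :
    (newtonE a k, newtonE b k) ∈ symbolPairs K := by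
  have := newtonE_mem (symbolPairs K) hab k
  convert this
  · exact (map_newtonE (AlgHom.fst ℚ U BorelPoly) (fun i => (a i, b i)) k).symm
  · exact (map_newtonE (AlgHom.snd ℚ U BorelPoly) (fun i => (a i, b i)) k).symm

theorem orderedProd_mem_symbolPairs {ι : Type*} [LinearOrder ι] {K : Submodule ℚ BorelPoly}
    {a : ι → ℕ → U} {b : ι → ℕ → BorelPoly} (hab : ∀ i n, (a i n, b i n) ∈ symbolPairs K)
    (k : ι →₀ ℕ) : (orderedProd a k, orderedProd b k) ∈ symbolPairs K := by
  have h1 : orderedProd (fun i n => (a i n, b i n)) k ∈ symbolPairs K :=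
    list_prod_mem (by
      intro x hx
      obtain ⟨i, -, rfl⟩ := List.mem_map.1 hx
      exact hab _ _)
  convert h1
  · exact (map_orderedProd (MonoidHom.fst U BorelPoly) (fun i n => (a i n, b i n)) k).symm
  · exact (map_orderedProd (MonoidHom.snd U BorelPoly) (fun i n => (a i n, b i n)) k).symm

theorem h_mem_symbolPairs {K : Submodule ℚ BorelPoly} {r : ℤ} (hK : ∀ p ∈ K, hDer r p = 0)
    (hK' : ∀ p ∈ K, p * hVar r ∈ K) : (h r, hVar r) ∈ symbolPairs K := by
  refine ⟨polyRep.h r, fun a => ?_, fun p hp => ⟨?_, hK' p hp⟩⟩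
  · rw [h, BorelRep.induced_gen]
    exact polyRep.hOp_one_tmul r a
  · rw [mul_comm]
    exact (unop_rightOp _ _ p).trans (by rw [hK p hp, add_zero])

theorem c_mem_symbolPairs {K : Submodule ℚ BorelPoly} (hK' : ∀ p ∈ K, p * centreVar ∈ K) :
    (c, centreVar) ∈ symbolPairs K := by
  refine ⟨polyRep.c, fun a => ?_, fun p hp => ⟨?_, hK' p hp⟩⟩
  · rw [c, BorelRep.induced_gen]
    exact polyRep.cOp_one_tmul a
  · rw [mul_comm]
    exact (unop_rightOp _ _ p).trans (add_zero _)

theorem xPlus_mem_symbolPairs (r : ℤ) : (xPlus r, inclX (X r)) ∈ symbolPairs ⊤ := by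
  refine ⟨polyRep.x r, fun a => ?_, fun p hp => ⟨?_, trivial⟩⟩
  · rw [xPlus, BorelRep.induced_gen]
    exact polyRep.xOp_one_tmul r a
  · rw [mul_comm]
    exact (unop_rightOp _ _ p).trans (add_zero _)

/-- The polynomials killed by the derivations `hDer r`, `r ∈ S`. -/
noncomputable def hConstants (S : Set ℤ) : Submodule ℚ BorelPoly :=
  ⨅ r ∈ S, LinearMap.ker (hDer r : BorelPoly →ₗ[ℚ] BorelPoly)

theorem mem_hConstants {S : Set ℤ} {p : BorelPoly} : p ∈ hConstants S ↔ ∀ r ∈ S, hDer r p = 0 := by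
  simp [hConstants]

theorem mul_mem_hConstants {S : Set ℤ} {p q : BorelPoly} (hp : p ∈ hConstants S)
    (hq : q ∈ hConstants S) : p * q ∈ hConstants S := by
  rw [mem_hConstants] at *
  intro r hr
  rw [Derivation.leibniz, hp r hr, hq r hr, smul_zero, smul_zero, add_zero]

theorem one_mem_hConstants (S : Set ℤ) : 1 ∈ hConstants S :=
  mem_hConstants.2 fun _ _ => Derivation.map_one_eq_zero _

theorem basisZeroSign_mem_symbolPairs {ε : ℤˣ} {K : Submodule ℚ BorelPoly}
    (θ : MvPolynomial ℕ+ ℚ →ₐ[ℚ] BorelPoly)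
    (hK : ∀ i : ℕ, (h ((ε : ℤ) * (i + 1)), θ (X i.succPNat)) ∈ symbolPairs K) (k : ℕ+ →₀ ℕ) :
    (basisZeroSign ε k, θ (orderedProd (fun (l : ℕ+) n => polyNewton l ^ n) k)) ∈
      symbolPairs K := by
  rw [map_orderedProd]
  refine orderedProd_mem_symbolPairs (fun l n => ?_) k
  rw [map_pow, polyNewton, map_newtonE, hHat_eq_newtonE]
  exact pow_mem (newtonE_mem_symbolPairs hK l) n

theorem basisZeroSign_neg_mem_symbolPairs (k : ℕ+ →₀ ℕ) :
    (basisZeroSign (-1) k, inclNeg (orderedProd (fun (l : ℕ+) n => polyNewton l ^ n) k)) ∈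
      symbolPairs (hConstants Set.univ) := by
  refine basisZeroSign_mem_symbolPairs inclNeg (fun i => ?_) k
  have h1 : (((-1 : ℤˣ) : ℤ) * ((i : ℤ) + 1)) = Int.negSucc i := by
    rw [Int.negSucc_eq]; simp
  rw [h1]
  refine h_mem_symbolPairs (fun p hp => mem_hConstants.1 hp _ trivial) fun p hp =>
    mul_mem_hConstants hp (mem_hConstants.2 fun r _ => hDer_inclNeg r _)

/-- For r ≥ 0 and k > 0 the sum r + k is never zero, so `hDer r` kills y_k. Only the derivations
with r ≥ 0 must vanish here, which allows the y_k themselves to enter. -/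
theorem basisZeroSign_one_mem_symbolPairs (k : ℕ+ →₀ ℕ) :
    (basisZeroSign 1 k, inclPos (orderedProd (fun (l : ℕ+) n => polyNewton l ^ n) k)) ∈
      symbolPairs (hConstants (Set.Ici 0)) := by
  refine basisZeroSign_mem_symbolPairs inclPos (fun i => ?_) k
  have h1 : (((1 : ℤˣ) : ℤ) * ((i : ℤ) + 1)) = Int.ofNat (i + 1) := by simp
  rw [h1]
  refine h_mem_symbolPairs (fun p hp => mem_hConstants.1 hp _ (by simp; omega)) fun p hp =>
    mul_mem_hConstants hp (mem_hConstants.2 fun r hr => ?_)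
  rw [hDer_hVar, if_neg]
  have : 0 ≤ r := hr
  omega

theorem basisZeroZero_mem_symbolPairs (p : ℕ × ℕ) :
    (basisZeroZero p, inclZero (binom (X ()) p.1) * inclCentre (binom (X ()) p.2)) ∈
      symbolPairs (hConstants (Set.Ici 0)) := by
  rw [basisZeroZero, map_binom, map_binom, binom_eq_newtonE, binom_eq_newtonE, binom_eq_newtonE,
    binom_eq_newtonE]
  refine mul_mem (newtonE_mem_symbolPairs (fun _ => ?_) _) (newtonE_mem_symbolPairs (fun _ => ?_) _)
  · exact h_mem_symbolPairs (r := 0) (fun p hp => mem_hConstants.1 hp _ (by simp)) fun p hp =>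
      mul_mem_hConstants hp (mem_hConstants.2 fun r _ => hDer_inclZero r)
  · exact c_mem_symbolPairs fun p hp =>
      mul_mem_hConstants hp (mem_hConstants.2 fun r _ => hDer_centreVar r)

theorem basisPlus_mem_symbolPairs (k : ℤ →₀ ℕ) :
    (basisPlus k, inclX (orderedProd (fun r n => divPow (X r) n) k)) ∈ symbolPairs ⊤ := by
  rw [map_orderedProd]
  refine orderedProd_mem_symbolPairs (fun r n => ?_) k
  rw [map_divPow]
  exact (symbolPairs ⊤).smul_mem (pow_mem (xPlus_mem_symbolPairs r) n) _

theorem induced_basisMinus (k : ℤ →₀ ℕ) : polyRep.induced (basisMinus k) =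
    BorelRep.mulX _ (orderedProd (fun r n => divPow (X r) n) k) := by
  rw [basisMinus, map_orderedProd, map_orderedProd]
  congr 1
  funext r n
  rw [map_divPow, map_divPow, xMinus, BorelRep.induced_gen]
  rfl

/-- The value at `1` of the symbol of an element of the induced module. -/
noncomputable def symbolAtOne : BorelRep.IndMod (Module.End ℚ BorelPoly)ᵐᵒᵖ →ₗ[ℚ]
    MvPolynomial ℤ ℚ ⊗[ℚ] BorelPoly :=
  LinearMap.lTensor (MvPolynomial ℤ ℚ)
    ((LinearMap.applyₗ (1 : BorelPoly)) ∘ₗ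
      (MulOpposite.opLinearEquiv ℚ (M := Module.End ℚ BorelPoly)).symm.toLinearMap)

theorem symbolAtOne_tm (f : MvPolynomial ℤ ℚ) (α : (Module.End ℚ BorelPoly)ᵐᵒᵖ) :
    symbolAtOne (BorelRep.tm f α) = f ⊗ₜ α.unop 1 := rfl

/-- The product `B^- B^{0,-} B^{0,0} B^{0,+} B^+`. -/
noncomputable def pbw
    (x : (ℤ →₀ ℕ) × (ℕ+ →₀ ℕ) × (ℕ × ℕ) × (ℕ+ →₀ ℕ) × (ℤ →₀ ℕ)) : U :=
  basisMinus x.1 * basisZeroSign (-1) x.2.1 * basisZeroZero x.2.2.1 *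
    basisZeroSign 1 x.2.2.2.1 * basisPlus x.2.2.2.2

/-- In the opposite algebra the leftmost factor acts first, so the polynomial grows from 1 in the
order y_{-k}, then y₀ and z, then y_k, then x_s. At each stage the accumulated polynomial is killed
by the derivations about to be applied, and the right action reduces to multiplication. -/
theorem symbolAtOne_induced_pbw
    (x : (ℤ →₀ ℕ) × (ℕ+ →₀ ℕ) × (ℕ × ℕ) × (ℕ+ →₀ ℕ) × (ℤ →₀ ℕ)) :
    symbolAtOne (polyRep.induced (pbw x) (BorelRep.tm 1 1)) =
      orderedProd (fun r n => divPow (X r) n) x.1 ⊗ₜ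
        (inclNeg (orderedProd (fun (l : ℕ+) n => polyNewton l ^ n) x.2.1) *
          (inclZero (binom (X ()) x.2.2.1.1) * inclCentre (binom (X ()) x.2.2.1.2)) *
          inclPos (orderedProd (fun (l : ℕ+) n => polyNewton l ^ n) x.2.2.2.1) *
          inclX (orderedProd (fun r n => divPow (X r) n) x.2.2.2.2)) := by
  obtain ⟨α, hα, hα'⟩ := basisZeroSign_neg_mem_symbolPairs x.2.1
  obtain ⟨β, hβ, hβ'⟩ := mul_mem (basisZeroZero_mem_symbolPairs x.2.2.1)
    (basisZeroSign_one_mem_symbolPairs x.2.2.2.1)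
  obtain ⟨γ, hγ, hγ'⟩ := basisPlus_mem_symbolPairs x.2.2.2.2
  have h1 := hα' 1 (one_mem_hConstants _)
  have h2 : (1 : BorelPoly) * inclNeg (orderedProd (fun (l : ℕ+) n => polyNewton l ^ n) x.2.1) ∈
      hConstants (Set.Ici 0) :=
    mem_hConstants.2 fun r _ => mem_hConstants.1 h1.2 r trivial
  have h3 := hβ' _ h2
  have h4 := hγ' _ (Submodule.mem_top (x := 1 *
    inclNeg (orderedProd (fun (l : ℕ+) n => polyNewton l ^ n) x.2.1) *
      ((inclZero (binom (X ()) x.2.2.1.1) * inclCentre (binom (X ()) x.2.2.1.2)) *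
        inclPos (orderedProd (fun (l : ℕ+) n => polyNewton l ^ n) x.2.2.2.1))))
  have h5 : pbw x = basisMinus x.1 * (basisZeroSign (-1) x.2.1 *
      ((basisZeroZero x.2.2.1 * basisZeroSign 1 x.2.2.2.1) * basisPlus x.2.2.2.2)) := by
    simp only [pbw, mul_assoc]
  rw [Prod.mk_mul_mk] at hβ h3
  rw [h5, map_mul, map_mul, map_mul, Module.End.mul_apply, Module.End.mul_apply,
    Module.End.mul_apply, hγ, hβ, hα, induced_basisMinus, BorelRep.mulX_tmul, symbolAtOne_tm,
    mul_one, mul_one]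
  congr 1
  change γ.unop (β.unop (α.unop 1)) = _
  rw [h1.1, h3.1, h4.1]
  simp only [one_mul, mul_assoc]

theorem linearIndependent_pbw : LinearIndependent ℚ pbw := by
  -- The nesting follows the nested sums in `BorelVar`.
  have hR := linearIndependent_rename_mul_rename linearIndependent_polyNewton
    (linearIndependent_rename_mul_rename linearIndependent_binom_X
      (linearIndependent_rename_mul_rename linearIndependent_binom_X
        (linearIndependent_rename_mul_rename linearIndependent_polyNewton
          linearIndependent_divPow_X)))
  have hT := (linearIndependent_divPow_X.tmul_of_isDomain hR).comp
    (fun x : (ℤ →₀ ℕ) × (ℕ+ →₀ ℕ) × (ℕ × ℕ) × (ℕ+ →₀ ℕ) × (ℤ →₀ ℕ) =>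
      (x.1, x.2.1, x.2.2.1.1, x.2.2.1.2, x.2.2.2.1, x.2.2.2.2)) (by
      rintro ⟨a, b, ⟨p, q⟩, d, e⟩ ⟨a', b', ⟨p', q'⟩, d', e'⟩ h
      simp only [Prod.mk.injEq] at h ⊢
      tauto)
  refine LinearIndependent.of_comp (symbolAtOne ∘ₗ
    (LinearMap.applyₗ (BorelRep.tm 1 1)) ∘ₗ polyRep.induced.toLinearMap)
    (linearIndependent_congr hT fun x => ?_)
  refine (symbolAtOne_induced_pbw x).trans ?_
  simp only [Function.comp_apply, map_mul]
  congr 1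
  simp only [mul_assoc]
  rfl

end BorelModule

/-! ### Bases of the lattices, the integral form and the tensor decompositions. -/

section IntegralForm

theorem span_range_mul_span_range {ι κ : Type*} (f : ι → U) (g : κ → U) :
    Submodule.span ℤ (Set.range f) * Submodule.span ℤ (Set.range g) =
      Submodule.span ℤ (Set.range fun p : ι × κ => f p.1 * g p.2) := by
  rw [Submodule.span_mul_span]
  congr 1
  ext u
  simp [Set.mem_mul]

theorem UZMinus_eq_span : Subalgebra.toSubmodule UZMinus =
    Submodule.span ℤ (Set.range basisMinus) := divSubalgebra_eq_span commute_xMinus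

theorem UZPlus_eq_span : Subalgebra.toSubmodule UZPlus =
    Submodule.span ℤ (Set.range basisPlus) := divSubalgebra_eq_span commute_xPlus

theorem UZZeroSign_eq_span (ε : ℤˣ) : Subalgebra.toSubmodule (UZZeroSign ε) =
    Submodule.span ℤ (Set.range (basisZeroSign ε)) :=
  adjoin_range_eq_span_orderedProd (R := ℤ) (fun k : ℕ+ => hHat ε k) fun i j => commute_hHat ε i j

theorem UZZeroZero_eq_span : Subalgebra.toSubmodule UZZeroZero =
    Submodule.span ℤ (Set.range basisZeroZero) := binSubalgebra_eq_span (commute_c (h 0)).symm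

/-- The product `B^{0,-} B^{0,0} B^{0,+}`. -/
noncomputable def basisZero (x : (ℕ+ →₀ ℕ) × (ℕ × ℕ) × (ℕ+ →₀ ℕ)) : U :=
  basisZeroSign (-1) x.1 * basisZeroZero x.2.1 * basisZeroSign 1 x.2.2

theorem UZZero_eq_span : Subalgebra.toSubmodule UZZero =
    Submodule.span ℤ (Set.range basisZero) := by
  rw [UZZero_eq_mul, UZZeroSign_eq_span, UZZeroSign_eq_span, UZZeroZero_eq_span,
    span_range_mul_span_range, span_range_mul_span_range,
    ← (Equiv.prodAssoc (ℕ+ →₀ ℕ) (ℕ × ℕ) (ℕ+ →₀ ℕ)).surjective.range_comp basisZero]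
  rfl

theorem UZ_eq_span : Subalgebra.toSubmodule UZ = Submodule.span ℤ (Set.range pbw) := by
  rw [UZ_eq_triangular, triangular, UZMinus_eq_span, UZZero_eq_span, UZPlus_eq_span,
    span_range_mul_span_range, span_range_mul_span_range]
  congr 1
  ext u
  constructor
  · rintro ⟨⟨⟨a, b, p, d⟩, e⟩, rfl⟩
    exact ⟨(a, b, p, d, e), by simp only [pbw, basisZero, mul_assoc]⟩
  · rintro ⟨⟨a, b, p, d, e⟩, rfl⟩
    exact ⟨((a, b, p, d), e), by simp only [pbw, basisZero, mul_assoc]⟩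

theorem orderedProd_zero {ι M : Type*} [LinearOrder ι] [Monoid M] (g : ι → ℕ → M) :
    orderedProd g 0 = 1 := by simp [orderedProd]

theorem basisZeroZero_zero : basisZeroZero (0, 0) = 1 := by
  rw [basisZeroZero, binom_zero, binom_zero, mul_one]

theorem linearIndependent_int_pbw : LinearIndependent ℤ pbw :=
  linearIndependent_pbw.restrict_scalars' ℤ

/-- Every factor basis is a subfamily of `pbw`, obtained by setting the remaining exponents to zero.
-/
theorem linearIndependent_of_pbw {ι : Type*} {v : ι → U}
    (σ : ι → (ℤ →₀ ℕ) × (ℕ+ →₀ ℕ) × (ℕ × ℕ) × (ℕ+ →₀ ℕ) × (ℤ →₀ ℕ))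
    (hσ : Function.Injective σ) (hv : ∀ i, v i = pbw (σ i)) : LinearIndependent ℤ v :=
  linearIndependent_congr (linearIndependent_int_pbw.comp σ hσ) hv

theorem linearIndependent_basisMinus : LinearIndependent ℤ basisMinus :=
  linearIndependent_of_pbw (fun k => (k, 0, (0, 0), 0, 0)) (fun _ _ h => (Prod.mk.inj h).1)
    fun k => by simp [pbw, basisZeroSign, basisPlus, orderedProd_zero, basisZeroZero_zero]

theorem linearIndependent_basisPlus : LinearIndependent ℤ basisPlus :=
  linearIndependent_of_pbw (fun k => (0, 0, (0, 0), 0, k)) (fun _ _ h => by simpa using h)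
    fun k => by simp [pbw, basisZeroSign, basisMinus, orderedProd_zero, basisZeroZero_zero]

theorem linearIndependent_basisZero : LinearIndependent ℤ basisZero :=
  linearIndependent_of_pbw (fun x => (0, x.1, x.2.1, x.2.2, 0)) (fun x y h => by
      simp only [Prod.mk.injEq] at h
      exact Prod.ext h.2.1 (Prod.ext h.2.2.1 h.2.2.2.1))
    fun k => by simp [pbw, basisZero, basisPlus, basisMinus, orderedProd_zero]

theorem linearIndependent_basisZeroZero : LinearIndependent ℤ basisZeroZero :=
  linearIndependent_of_pbw (fun p => (0, 0, p, 0, 0)) (fun _ _ h => by simpa using h)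
    fun k => by simp [pbw, basisZeroSign, basisPlus, basisMinus, orderedProd_zero]

theorem linearIndependent_basisZeroSign (ε : ℤˣ) : LinearIndependent ℤ (basisZeroSign ε) := by
  rcases Int.units_eq_one_or ε with rfl | rfl
  · refine linearIndependent_of_pbw (fun k => (0, 0, (0, 0), k, 0)) (fun _ _ h => by simpa using h)
      fun k => ?_
    simp only [pbw, basisPlus, basisMinus, orderedProd_zero, basisZeroZero_zero]
    rw [show basisZeroSign (-1) 0 = 1 from orderedProd_zero _]
    simp
  · refine linearIndependent_of_pbw (fun k => (0, k, (0, 0), 0, 0)) (fun _ _ h => by simpa using h)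
      fun k => ?_
    simp only [pbw, basisPlus, basisMinus, orderedProd_zero, basisZeroZero_zero]
    rw [show basisZeroSign 1 0 = 1 from orderedProd_zero _]
    simp

theorem exists_basis {ι : Type*} {S : Subalgebra ℤ U} {v : ι → U} (hv : LinearIndependent ℤ v)
    (hS : Subalgebra.toSubmodule S = Submodule.span ℤ (Set.range v)) :
    ∃ b : Module.Basis ι ℤ S, ∀ i, (b i : U) = v i :=
  ⟨(Module.Basis.span hv).map (LinearEquiv.ofEq _ _ hS.symm), fun i => by
    rw [Module.Basis.map_apply]
    exact (LinearEquiv.coe_ofEq_apply hS.symm _).trans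
      (congrArg Subtype.val (Module.Basis.span_apply hv i))⟩

/-- The remaining generators are brackets: [x_r⁺, x₀⁻] = h_r, and [x₁⁺, x₋₁⁻] = h₀ + c. -/
theorem adjoin_rat_UZ : Algebra.adjoin ℚ (UZ : Set U) = ⊤ := by
  rw [eq_top_iff]
  have hP : ∀ r, xPlus r ∈ Algebra.adjoin ℚ (UZ : Set U) := fun r =>
    Algebra.subset_adjoin (UZPlus_le (by simpa [divPow_one] using divPow_xPlus_mem r 1))
  have hM : ∀ r, xMinus r ∈ Algebra.adjoin ℚ (UZ : Set U) := fun r =>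
    Algebra.subset_adjoin (UZMinus_le (by simpa [divPow_one] using divPow_xMinus_mem r 1))
  have hlie : ∀ r s, xPlus r * xMinus s - xMinus s * xPlus r ∈ Algebra.adjoin ℚ (UZ : Set U) :=
    fun r s => sub_mem (mul_mem (hP r) (hM s)) (mul_mem (hM s) (hP r))
  have hh : ∀ r, h r ∈ Algebra.adjoin ℚ (UZ : Set U) := by
    intro r
    have h1 := hlie r 0
    rw [xPlus_mul_xMinus, add_zero] at h1
    split_ifs at h1 with hr
    · simpa [hr] using h1
    · simpa using h1
  intro u _
  induction u using gen_induction with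
  | h_gen g =>
    cases g with
    | xPlus r => exact hP r
    | xMinus r => exact hM r
    | h r => exact hh r
    | c =>
      have h1 := hlie 1 (-1)
      rw [xPlus_mul_xMinus] at h1
      have h2 : c ∈ Algebra.adjoin ℚ (UZ : Set U) := by simpa using sub_mem h1 (hh 0)
      exact h2
  | h_alg q => exact Subalgebra.algebraMap_mem _ q
  | h_add a b ha hb => exact add_mem (ha trivial) (hb trivial)
  | h_mul a b ha hb => exact mul_mem (ha trivial) (hb trivial)

theorem span_rat_pbw : Submodule.span ℚ (Set.range pbw) = ⊤ := by
  have h1 : Submodule.span ℚ (UZ : Set U) = ⊤ := by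
    have h2 := Algebra.adjoin_eq_span ℚ (UZ : Set U)
    rw [adjoin_rat_UZ, Algebra.top_toSubmodule] at h2
    rw [h2]
    congr 1
    -- `UZ` is closed under multiplication, so the rational algebra it generates is just its
    -- rational span.
    exact (congrArg SetLike.coe (Submonoid.closure_eq UZ.toSubmonoid)).symm
  rw [eq_top_iff, ← h1, Submodule.span_le]
  intro u hu
  have h3 : u ∈ Submodule.span ℤ (Set.range pbw) := by
    rw [← UZ_eq_span]
    exact hu
  exact Submodule.span_le_restrictScalars ℤ ℚ _ h3

/-- Extension of scalars carries the ℤ-basis `pbw` of `UZ` to the ℚ-basis `pbw` of the whole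
algebra. -/
theorem isIntegralForm_UZ : IsIntegralForm UZ := by
  obtain ⟨b, hb⟩ := exists_basis linearIndependent_int_pbw UZ_eq_span
  refine ⟨Module.Free.of_basis b, ?_⟩
  let bQ := Module.Basis.mk linearIndependent_pbw span_rat_pbw.ge
  refine IsBaseChange.of_equiv ((b.baseChange ℚ).equiv bQ (Equiv.refl _)) fun x => ?_
  have : (((b.baseChange ℚ).equiv bQ (Equiv.refl _)).toLinearMap.restrictScalars ℤ) ∘ₗ
      (TensorProduct.mk ℤ ℚ UZ 1) = UZ.val.toLinearMap := by
    refine b.ext fun i => ?_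
    have h1 : (1 : ℚ) ⊗ₜ[ℤ] b i = b.baseChange ℚ i := (Module.Basis.baseChange_apply ℚ b i).symm
    change (b.baseChange ℚ).equiv bQ (Equiv.refl _) ((1 : ℚ) ⊗ₜ[ℤ] b i) = (b i : U)
    rw [h1, Module.Basis.equiv_apply, Module.Basis.mk_apply, hb]
    rfl
  exact LinearMap.congr_fun this x

/-- The multiplication `S ⊗ N → U` for a module `N` mapping to `U`. -/
noncomputable def mulTensor (S : Subalgebra ℤ U) {N : Type*} [AddCommMonoid N] [Module ℤ N]
    (j : N →ₗ[ℤ] U) : S ⊗[ℤ] N →ₗ[ℤ] U :=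
  LinearMap.mul' ℤ U ∘ₗ TensorProduct.map S.val.toLinearMap j

/-- Multiplication maps the tensor products of the factor bases bijectively onto `pbw`; a linear map
matching two bases is an isomorphism. -/
theorem exists_equiv_of_basis {N ι κ : Type*} [AddCommMonoid N] [Module ℤ N] {S : Subalgebra ℤ U}
    (bN : Module.Basis ι ℤ N) (bS : Module.Basis κ ℤ S) (j : N →ₗ[ℤ] U) (σ : ι ≃ κ)
    (hj : ∀ i, j (bN i) = bS (σ i)) : ∃ e : N ≃ₗ[ℤ] S, ∀ x, (e x : U) = j x := by
  refine ⟨bN.equiv bS σ, fun x => ?_⟩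
  have : S.val.toLinearMap ∘ₗ (bN.equiv bS σ).toLinearMap = j := by
    refine bN.ext fun i => ?_
    rw [hj]
    change ((bN.equiv bS σ (bN i) : S) : U) = _
    rw [Module.Basis.equiv_apply]
  exact LinearMap.congr_fun this x

theorem exists_mvPolynomial_equiv (ε : ℤˣ) : ∃ e : MvPolynomial ℕ+ ℤ ≃ₐ[ℤ] UZZeroSign ε,
    ∀ k : ℕ+, (e (MvPolynomial.X k) : U) = hHat ε k := by
  have hv : ∀ i j : ℕ+, Commute (hHat ε i) (hHat ε j) := fun i j => commute_hHat ε i j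
  set φ := commAeval (R := ℤ) (fun k : ℕ+ => hHat ε k) hv with hφ
  have hinj : Function.Injective φ := by
    refine LinearMap.injective_of_linearIndependent (f := φ.toLinearMap)
      (MvPolynomial.basisMonomials ℕ+ ℤ).span_eq
      (linearIndependent_congr (linearIndependent_basisZeroSign ε) fun k => ?_)
    rw [Function.comp_apply, MvPolynomial.coe_basisMonomials]
    exact (orderedProd_pow_eq_commAeval (R := ℤ) _ hv k).symm
  have hr : φ.range = UZZeroSign ε := (adjoin_eq_range_commAeval _ hv).symm
  refine ⟨(AlgEquiv.ofInjective φ hinj).trans (Subalgebra.equivOfEq _ _ hr), fun k => ?_⟩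
  exact commAeval_X _ hv k

end IntegralForm

end AffineSl2

theorem mainTheorem2 :
    -- `Û_ℤ` is an integral form of `Û`
    IsIntegralForm UZ ∧
    -- multiplication gives `Û_ℤ^- ⊗ Û_ℤ^0 ⊗ Û_ℤ^+ ≅ Û_ℤ`
    (∃ e : (UZMinus ⊗[ℤ] (UZZero ⊗[ℤ] UZPlus)) ≃ₗ[ℤ] UZ,
      ∀ (a : UZMinus) (z : UZZero) (b : UZPlus),
        (e (a ⊗ₜ[ℤ] (z ⊗ₜ[ℤ] b)) : U) = a * z * b) ∧
    -- multiplication gives `Û_ℤ^- ⊗ Û_ℤ^{0,-} ⊗ Û_ℤ^{0,0} ⊗ Û_ℤ^{0,+} ⊗ Û_ℤ^+ ≅ Û_ℤ`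
    (∃ e : (UZMinus ⊗[ℤ] (UZZeroSign (-1) ⊗[ℤ] (UZZeroZero ⊗[ℤ] (UZZeroSign 1 ⊗[ℤ] UZPlus))))
          ≃ₗ[ℤ] UZ,
      ∀ (a : UZMinus) (y : UZZeroSign (-1)) (z : UZZeroZero) (w : UZZeroSign 1) (b : UZPlus),
        (e (a ⊗ₜ[ℤ] (y ⊗ₜ[ℤ] (z ⊗ₜ[ℤ] (w ⊗ₜ[ℤ] b)))) : U) = a * y * z * w * b) ∧
    -- the `ℤ`-bases of the factors
    (∃ b : Module.Basis (ℤ →₀ ℕ) ℤ UZMinus, ∀ k, (b k : U) = basisMinus k) ∧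
    (∃ b : Module.Basis (ℤ →₀ ℕ) ℤ UZPlus, ∀ k, (b k : U) = basisPlus k) ∧
    (∀ ε : ℤˣ, ∃ b : Module.Basis (ℕ+ →₀ ℕ) ℤ (UZZeroSign ε),
      ∀ k, (b k : U) = basisZeroSign ε k) ∧
    (∃ b : Module.Basis (ℕ × ℕ) ℤ UZZeroZero, ∀ p, (b p : U) = basisZeroZero p) ∧
    -- the product `B^- B^{0,-} B^{0,0} B^{0,+} B^+` is a `ℤ`-basis of `Û_ℤ`
    (∃ b : Module.Basis
        ((ℤ →₀ ℕ) × (ℕ+ →₀ ℕ) × (ℕ × ℕ) × (ℕ+ →₀ ℕ) × (ℤ →₀ ℕ)) ℤ UZ,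
      ∀ km lm p lp kp, (b (km, lm, p, lp, kp) : U) =
        basisMinus km * basisZeroSign (-1) lm * basisZeroZero p * basisZeroSign 1 lp *
          basisPlus kp) ∧
    -- `Û_ℤ^{0,±}` is the algebra of polynomials over `ℤ` in the `ĥ_{± k}`, `k > 0`
    (∀ ε : ℤˣ, ∃ e : MvPolynomial ℕ+ ℤ ≃ₐ[ℤ] UZZeroSign ε,
      ∀ k : ℕ+, (e (MvPolynomial.X k) : U) = hHat ε k) := by
  obtain ⟨bM, hM⟩ := exists_basis linearIndependent_basisMinus UZMinus_eq_span
  obtain ⟨bP, hP⟩ := exists_basis linearIndependent_basisPlus UZPlus_eq_span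
  have hS := fun ε => exists_basis (linearIndependent_basisZeroSign ε) (UZZeroSign_eq_span ε)
  obtain ⟨bN, hN⟩ := hS (-1)
  obtain ⟨bO, hO⟩ := hS 1
  obtain ⟨bC, hC⟩ := exists_basis linearIndependent_basisZeroZero UZZeroZero_eq_span
  obtain ⟨bZ, hZ⟩ := exists_basis linearIndependent_basisZero UZZero_eq_span
  obtain ⟨bU, hU⟩ := exists_basis linearIndependent_int_pbw UZ_eq_span
  refine ⟨isIntegralForm_UZ, ?_, ?_, ⟨bM, hM⟩, ⟨bP, hP⟩, hS, ⟨bC, hC⟩,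
    ⟨bU, fun _ _ _ _ _ => hU _⟩, exists_mvPolynomial_equiv⟩
  · obtain ⟨e, he⟩ := exists_equiv_of_basis (bM.tensorProduct (bZ.tensorProduct bP)) bU
      (mulTensor UZMinus (mulTensor UZZero UZPlus.val.toLinearMap))
      ⟨fun x => (x.1, x.2.1.1, x.2.1.2.1, x.2.1.2.2, x.2.2),
        fun x => (x.1, (x.2.1, x.2.2.1, x.2.2.2.1), x.2.2.2.2), fun _ => rfl, fun _ => rfl⟩
      fun ⟨a, ⟨b, p, d⟩, e⟩ => by
        rw [Module.Basis.tensorProduct_apply, Module.Basis.tensorProduct_apply, hU]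
        change (bM a : U) * ((bZ _ : U) * (bP e : U)) = _
        rw [hM, hZ, hP]
        simp only [pbw, basisZero, Equiv.coe_fn_mk, mul_assoc]
    exact ⟨e, fun a z b => (he _).trans (mul_assoc _ _ _).symm⟩
  · obtain ⟨e, he⟩ := exists_equiv_of_basis
      (bM.tensorProduct (bN.tensorProduct (bC.tensorProduct (bO.tensorProduct bP)))) bU
      (mulTensor UZMinus (mulTensor (UZZeroSign (-1)) (mulTensor UZZeroZero
        (mulTensor (UZZeroSign 1) UZPlus.val.toLinearMap)))) (Equiv.refl _)
      fun ⟨a, b, p, d, e⟩ => by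
        rw [Module.Basis.tensorProduct_apply, Module.Basis.tensorProduct_apply,
          Module.Basis.tensorProduct_apply, Module.Basis.tensorProduct_apply, hU]
        change (bM a : U) * ((bN b : U) * ((bC p : U) * ((bO d : U) * (bP e : U)))) = _
        rw [hM, hN, hC, hO, hP]
        simp only [pbw, Equiv.refl_apply, mul_assoc]
    refine ⟨e, fun a y z w b => (he _).trans ?_⟩
    change (a : U) * (y * (z * (w * b))) = _
    simp only [mul_assoc]
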